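/- Let $\sigma_1=\begin{pmatrix}0&1\\1&0\end{pmatrix}$, $\sigma_3=\begin{pmatrix}1&0\\0&-1\end{pmatrix}$, $\mathcal H=L^2(\mathbb R;\mathbb C^2)$, $\mathcal H^1=H^1(\mathbb R;\mathbb C^2)$. For a bounded measurable $m:\mathbb R\to\mathbb R$ let $\mathcal D_m=i\partial_x\sigma_3+m(x)\sigma_1$ be the Dirac operator on $\mathcal H$ with domain $\mathcal H^1$. Let $\kappa_\infty>0$ and let $\kappa\in C^1(\mathbb R)$ be real-valued and odd, with $\kappa(x)=-\kappa_\infty$ for $x\le -1$ and $\kappa(x)=\kappa_\infty$ for $x\ge 1$. Put $$\alpha_\star(x)=\gamma\begin{pmatrix}1\\ i\end{pmatrix}e^{-\int_0^x\kappa(y)\,dy},\qquad \gamma=\frac{1}{\sqrt2\,\|e^{-\int_0^x\kappa(y)\,dy}\|_{L^2}},$$ the normalized zero mode of $\mathcal D_\kappa$. Assume the spectral gap condition: $\|\mathcal D_\kappa f\|_{\mathcal H}\ge\kappa_\infty\|f\|_{\mathcal H}$ for all $f\in\mathcal H^1$ with $\langle\alpha_\star,f\rangle_{\mathcal H}=0$.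 Let $n\ge1$. For $\delta>1$ and $j=0,\dots,n-1$ put $x_j=(n-1-2j)\delta$ (so the $x_j$ are spaced $2\delta$ apart and numbered from right to left), and let the $n$ domain wall function $\kappa^\delta$ be given by $\kappa^\delta(x)=(-1)^j\kappa(x-x_j)$ for $x_j-\delta\le x\le x_j+\delta$, where the cell of $j=0$ is extended to $+\infty$ and that of $j=n-1$ to $-\infty$. Let $\alpha_\star^{(j)}(x)=\alpha_\star(x-x_j)$ for $j$ even and $\alpha_\star^{(j)}(x)=\overline{\alpha_\star(x-x_j)}$ for $j$ odd. Let $M_0(\delta)$ be the $n\times n$ tridiagonal matrix with zero diagonal, entries $-2i\gamma^2e^{-2\int_0^\delta\kappa(y)\,dy}$ directly above the diagonal and $2i\gamma^2e^{-2\int_0^\delta\kappa(y)\,dy}$ directly below it. **Theorem.** There is a constant $C$, depending only on $\kappa$ and $n$, such that for every $K\in(0,\kappa_\infty)$ there is $\delta_0(K)\ge1$ such that for all $\delta>\delta_0(K)$ the following hold. 1. $\mathcal D_{\kappa^\delta}$ has precisely $n$ eigenvalues $E_1^\delta<\dots<E_n^\delta$ in $[-K,K]$, and each of them is simple (its eigenspace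 is one-dimensional). 2. $M_0(\delta)$ has precisely $n$ distinct eigenvalues, all real, $E_{1,0}^\delta<\dots<E_{n,0}^\delta$, and $|E_j^\delta-E_{j,0}^\delta|\le Ce^{-4\kappa_\infty\delta}$ for $j=1,\dots,n$. 3. For every $j$ and every normalized eigenfunction $\alpha_j^\delta$ of $\mathcal D_{\kappa^\delta}$ with eigenvalue $E_j^\delta$ there is a normalized eigenvector $b=(b_0,\dots,b_{n-1})\in\mathbb C^n$ of $M_0(\delta)$ with eigenvalue $E_{j,0}^\delta$ such that $$\Big\|\alpha_j^\delta-\sum_{k=0}^{n-1}b_k\,\alpha_\star^{(k)}\Big\|_{\mathcal H}\le Ce^{-2\kappa_\infty\delta}.$$ -/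

import Mathlib

open MeasureTheory
open scoped ContDiff

noncomputable section

namespace DiracWalls

/-- The fibre `ℂ²` with its Euclidean (Hermitian) norm. -/
abbrev Spinor : Type := EuclideanSpace ℂ (Fin 2)

/-- The Hilbert space `𝓗 = L²(ℝ; ℂ²)`. -/
abbrev SpinorL2 : Type := Lp Spinor 2 (volume : Measure ℝ)

/-- The Pauli matrix `σ₁`. -/
def sigma1 : Matrix (Fin 2) (Fin 2) ℂ := !![0, 1; 1, 0]

/-- The Pauli matrix `σ₃`. -/
def sigma3 : Matrix (Fin 2) (Fin 2) ℂ := !![1, 0; 0, -1]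

/-- The action of a `2 × 2` matrix on `ℂ²`. -/
def act (A : Matrix (Fin 2) (Fin 2) ℂ) : Spinor →L[ℂ] Spinor :=
  Matrix.toEuclideanCLM (n := Fin 2) (𝕜 := ℂ) A

/-- `g ∈ 𝓗` is the weak derivative of `f ∈ 𝓗`: `∫ φ' f = - ∫ φ g` for all test functions `φ`. -/
def IsWeakDeriv (f g : SpinorL2) : Prop :=
  ∀ φ : ℝ → ℝ, ContDiff ℝ ∞ φ → HasCompactSupport φ →
    ∫ x, deriv φ x • f x = -∫ x, φ x • g x

lemma integrable_test (f : SpinorL2) {φ : ℝ → ℝ} (hφ : Continuous φ) (hc : HasCompactSupport φ) :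
    Integrable (fun x => φ x • f x) := by
  have hf : LocallyIntegrable (f : ℝ → Spinor) volume :=
    (Lp.memLp f).locallyIntegrable (by norm_num)
  exact hf.integrable_smul_left_of_hasCompactSupport hφ hc

lemma continuous_deriv_test {φ : ℝ → ℝ} (hφ : ContDiff ℝ ∞ φ) : Continuous (deriv φ) :=
  hφ.continuous_deriv (by simp)

lemma IsWeakDeriv.add {f₁ g₁ f₂ g₂ : SpinorL2} (h₁ : IsWeakDeriv f₁ g₁) (h₂ : IsWeakDeriv f₂ g₂) :
    IsWeakDeriv (f₁ + f₂) (g₁ + g₂) := by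
  intro φ hφ hc
  have e₁ : ∫ x, deriv φ x • (f₁ + f₂ : SpinorL2) x
      = ∫ x, (deriv φ x • f₁ x + deriv φ x • f₂ x) := by
    refine integral_congr_ae ?_
    filter_upwards [Lp.coeFn_add f₁ f₂] with x hx
    rw [hx, Pi.add_apply, smul_add]
  have e₂ : ∫ x, φ x • (g₁ + g₂ : SpinorL2) x = ∫ x, (φ x • g₁ x + φ x • g₂ x) := by
    refine integral_congr_ae ?_
    filter_upwards [Lp.coeFn_add g₁ g₂] with x hx
    rw [hx, Pi.add_apply, smul_add]
  rw [e₁, e₂, integral_add (integrable_test _ (continuous_deriv_test hφ) hc.deriv)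
      (integrable_test _ (continuous_deriv_test hφ) hc.deriv),
    integral_add (integrable_test _ hφ.continuous hc) (integrable_test _ hφ.continuous hc),
    h₁ φ hφ hc, h₂ φ hφ hc, neg_add]

lemma IsWeakDeriv.smul {f g : SpinorL2} (c : ℂ) (h : IsWeakDeriv f g) :
    IsWeakDeriv (c • f) (c • g) := by
  intro φ hφ hc
  have e₁ : ∫ x, deriv φ x • (c • f : SpinorL2) x = ∫ x, c • (deriv φ x • f x) := by
    refine integral_congr_ae ?_
    filter_upwards [Lp.coeFn_smul c f] with x hx
    rw [hx, Pi.smul_apply, smul_comm]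
  have e₂ : ∫ x, φ x • (c • g : SpinorL2) x = ∫ x, c • (φ x • g x) := by
    refine integral_congr_ae ?_
    filter_upwards [Lp.coeFn_smul c g] with x hx
    rw [hx, Pi.smul_apply, smul_comm]
  rw [e₁, e₂, integral_smul, integral_smul, h φ hφ hc, smul_neg]

lemma IsWeakDeriv.zero : IsWeakDeriv 0 0 := by
  have h := fun φ : ℝ → ℝ => integral_congr_ae (μ := volume) (f := fun x => φ x • (0 : SpinorL2) x)
    (g := fun _ => (0 : Spinor)) (by
      filter_upwards [Lp.coeFn_zero Spinor 2 (volume : Measure ℝ)] with x hx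
      rw [hx]; simp)
  intro φ _ _
  rw [h (deriv φ), h φ]
  simp

lemma IsWeakDeriv.unique {f g₁ g₂ : SpinorL2} (h₁ : IsWeakDeriv f g₁) (h₂ : IsWeakDeriv f g₂) :
    g₁ = g₂ := by
  apply Lp.ext
  refine ae_eq_of_integral_contDiff_smul_eq ((Lp.memLp g₁).locallyIntegrable (by norm_num))
    ((Lp.memLp g₂).locallyIntegrable (by norm_num)) ?_
  intro φ hφ hc
  have := (h₁ φ hφ hc).symm.trans (h₂ φ hφ hc)
  exact neg_injective this

/-- The Sobolev space `𝓗¹ = H¹(ℝ; ℂ²)`, as a subspace of `𝓗`. -/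
def H1 : Submodule ℂ SpinorL2 where
  carrier := {f | ∃ g, IsWeakDeriv f g}
  add_mem' := by
    rintro f₁ f₂ ⟨g₁, h₁⟩ ⟨g₂, h₂⟩
    exact ⟨g₁ + g₂, h₁.add h₂⟩
  zero_mem' := ⟨0, IsWeakDeriv.zero⟩
  smul_mem' := by
    rintro c f ⟨g, h⟩
    exact ⟨c • g, h.smul c⟩

/-- `h = i σ₃ ∂ₓ f + κ σ₁ f`, with `f ∈ H¹`, `h ∈ L²` and `∂ₓ` the weak derivative. -/
def DiracRel (κ : ℝ → ℝ) (f h : SpinorL2) : Prop :=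
  ∃ g : SpinorL2, IsWeakDeriv f g ∧
    ∀ᵐ x : ℝ, h x = Complex.I • act sigma3 (g x) + (κ x : ℂ) • act sigma1 (f x)

lemma DiracRel.add {κ : ℝ → ℝ} {f₁ h₁ f₂ h₂ : SpinorL2} (H₁ : DiracRel κ f₁ h₁)
    (H₂ : DiracRel κ f₂ h₂) : DiracRel κ (f₁ + f₂) (h₁ + h₂) := by
  obtain ⟨g₁, d₁, e₁⟩ := H₁
  obtain ⟨g₂, d₂, e₂⟩ := H₂
  refine ⟨g₁ + g₂, d₁.add d₂, ?_⟩
  filter_upwards [e₁, e₂, Lp.coeFn_add f₁ f₂, Lp.coeFn_add g₁ g₂, Lp.coeFn_add h₁ h₂]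
    with x a b c d e
  rw [c, d, e, Pi.add_apply, Pi.add_apply, Pi.add_apply, a, b, map_add, map_add, smul_add,
    smul_add]
  abel

lemma DiracRel.smul {κ : ℝ → ℝ} {f h : SpinorL2} (c : ℂ) (H : DiracRel κ f h) :
    DiracRel κ (c • f) (c • h) := by
  obtain ⟨g, d, e⟩ := H
  refine ⟨c • g, d.smul c, ?_⟩
  filter_upwards [e, Lp.coeFn_smul c f, Lp.coeFn_smul c g, Lp.coeFn_smul c h] with x a b p q
  rw [b, p, q, Pi.smul_apply, Pi.smul_apply, Pi.smul_apply, a, map_smul, map_smul, smul_add,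
    smul_comm c, smul_comm c (κ x : ℂ)]

lemma DiracRel.zero {κ : ℝ → ℝ} : DiracRel κ 0 0 := by
  refine ⟨0, IsWeakDeriv.zero, ?_⟩
  filter_upwards [Lp.coeFn_zero Spinor 2 (volume : Measure ℝ)] with x hx
  rw [hx]; simp

lemma DiracRel.unique {κ : ℝ → ℝ} {f h₁ h₂ : SpinorL2} (H₁ : DiracRel κ f h₁)
    (H₂ : DiracRel κ f h₂) : h₁ = h₂ := by
  obtain ⟨g₁, d₁, e₁⟩ := H₁
  obtain ⟨g₂, d₂, e₂⟩ := H₂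
  obtain rfl := d₁.unique d₂
  apply Lp.ext
  filter_upwards [e₁, e₂] with x a b
  rw [a, b]

/-- The Dirac operator `D_κ = i ∂ₓ σ₃ + κ(x) σ₁`, an unbounded operator on `L²(ℝ; ℂ²)`.
Its domain consists of the `f ∈ H¹` with `κ σ₁ f ∈ L²`; for a bounded measurable mass `κ`
this is all of `H¹`, see `dirac_domain`. -/
def dirac (κ : ℝ → ℝ) : SpinorL2 →ₗ.[ℂ] SpinorL2 where
  domain :=
    { carrier := {f | ∃ h, DiracRel κ f h}
      add_mem' := by
        rintro f₁ f₂ ⟨h₁, H₁⟩ ⟨h₂, H₂⟩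
        exact ⟨h₁ + h₂, H₁.add H₂⟩
      zero_mem' := ⟨0, DiracRel.zero⟩
      smul_mem' := by
        rintro c f ⟨h, H⟩
        exact ⟨c • h, H.smul c⟩ }
  toFun :=
    { toFun := fun f => Classical.choose f.2
      map_add' := fun f₁ f₂ => (Classical.choose_spec (f₁ + f₂).2).unique
        ((Classical.choose_spec f₁.2).add (Classical.choose_spec f₂.2))
      map_smul' := fun c f => (Classical.choose_spec (c • f).2).unique
        ((Classical.choose_spec f.2).smul c) }

lemma dirac_apply {κ : ℝ → ℝ} (f : (dirac κ).domain) {h : SpinorL2} :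
    dirac κ f = h ↔ DiracRel κ f h :=
  ⟨fun e => e ▸ Classical.choose_spec f.2, fun H => (Classical.choose_spec f.2).unique H⟩

lemma dirac_domain {κ : ℝ → ℝ} (hm : Measurable κ) {B : ℝ} (hB : ∀ x, |κ x| ≤ B) :
    (dirac κ).domain = H1 := by
  ext f
  constructor
  · rintro ⟨h, g, d, -⟩
    exact ⟨g, d⟩
  · rintro ⟨g, d⟩
    have m₁ : MemLp (fun x => Complex.I • act sigma3 (g x)) 2 (volume : Measure ℝ) :=
      ((act sigma3).comp_memLp g).const_smul Complex.I
    have m₂ : MemLp (fun x => (κ x : ℂ) • act sigma1 (f x)) 2 (volume : Measure ℝ) := by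
      have m₃ : MemLp (fun x => act sigma1 (f x)) 2 (volume : Measure ℝ) :=
        (act sigma1).comp_memLp f
      refine m₃.of_le_mul (c := B) ?_ ?_
      · exact (Complex.measurable_ofReal.comp hm).aestronglyMeasurable.smul m₃.1
      · refine Filter.Eventually.of_forall fun x => ?_
        rw [norm_smul, Complex.norm_real, Real.norm_eq_abs]
        exact mul_le_mul_of_nonneg_right (hB x) (norm_nonneg _)
    exact ⟨(m₁.add m₂).toLp _, g, d, (m₁.add m₂).coeFn_toLp⟩

/-- The eigenspace `ker (T - z)` of an unbounded operator `T`. -/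
def eigenspace (T : SpinorL2 →ₗ.[ℂ] SpinorL2) (z : ℂ) : Submodule ℂ T.domain :=
  LinearMap.ker (T.toFun - z • T.domain.subtype)

/-- `z` is an eigenvalue of `T`. -/
def IsEigenvalue (T : SpinorL2 →ₗ.[ℂ] SpinorL2) (z : ℂ) : Prop := eigenspace T z ≠ ⊥

/-- `z` is a simple eigenvalue of `T`: its eigenspace is one-dimensional. -/
def IsSimpleEigenvalue (T : SpinorL2 →ₗ.[ℂ] SpinorL2) (z : ℂ) : Prop :=
  Module.finrank ℂ (eigenspace T z) = 1

/-- `κ` is a domain wall function with asymptotic mass `κinf`. -/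
structure IsDomainWall (κ : ℝ → ℝ) (κinf : ℝ) : Prop where
  pos : 0 < κinf
  contDiff : ContDiff ℝ 1 κ
  odd : ∀ x, κ (-x) = -κ x
  left : ∀ x, x ≤ -1 → κ x = -κinf
  right : ∀ x, 1 ≤ x → κ x = κinf

/-- The scalar profile `x ↦ exp (-∫₀ˣ κ)`. -/
def profile (κ : ℝ → ℝ) (x : ℝ) : ℝ := Real.exp (-∫ y in (0 : ℝ)..x, κ y)

/-- The constant `γ = 1 / (√2 ‖exp (-∫₀ˣ κ)‖_{L²})`. -/
def gam (κ : ℝ → ℝ) : ℝ :=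
  1 / (Real.sqrt 2 * (eLpNorm (profile κ) 2 (volume : Measure ℝ)).toReal)

/-- The normalized zero mode `α⋆(x) = γ (1, i)ᵀ exp (-∫₀ˣ κ)` of `D_κ`. -/
def zeroMode (κ : ℝ → ℝ) (x : ℝ) : Spinor :=
  !₂[((gam κ * profile κ x : ℝ) : ℂ), Complex.I * ((gam κ * profile κ x : ℝ) : ℂ)]

/-- The spectral gap assumption on `D_κ`: `‖D_κ f‖ ≥ κinf ‖f‖` for all `f` in the domain of `D_κ`
that are orthogonal to the zero mode `α⋆`. -/
def SpectralGap (κ : ℝ → ℝ) (κinf : ℝ) : Prop :=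
  ∀ f : (dirac κ).domain, (∫ x, inner ℂ (zeroMode κ x) ((f : SpinorL2) x)) = 0 →
    κinf * ‖(f : SpinorL2)‖ ≤ ‖dirac κ f‖

/-- The centre of the `j`-th of `n` walls, `j = 0, …, n - 1`, numbered from right to left, with
neighbours at distance `2 δ` and placed symmetrically about the origin. -/
def center (n : ℕ) (δ : ℝ) (j : ℕ) : ℝ := ((n : ℝ) - 1 - 2 * j) * δ

/-- The number `j` of the wall in whose cell `center j - δ < x ≤ center j + δ` the point `x` lies;
the cells of the two outermost walls are extended to `±∞`. -/
def cell (n : ℕ) (δ x : ℝ) : ℕ := min ⌊((n : ℝ) * δ - x) / (2 * δ)⌋₊ (n - 1)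

/-- The `n` domain wall mass `κ^δ`, equal to `(-1)^j κ(x - center j)` on the `j`-th cell. -/
def wallMass (κ : ℝ → ℝ) (n : ℕ) (δ x : ℝ) : ℝ :=
  (-1) ^ cell n δ x * κ (x - center n δ (cell n δ x))

/-- Componentwise complex conjugation on `ℂ²`. -/
def conjSpinor (v : Spinor) : Spinor := WithLp.toLp 2 fun i => starRingEnd ℂ (v i)

/-- The shifted zero mode at the `j`-th wall: `α⋆(x - center j)` at a wall of the type of `κ`
(`j` even), and the complex conjugate of this at a wall of the type of `-κ` (`j` odd). -/
def shiftedMode (κ : ℝ → ℝ) (n : ℕ) (δ : ℝ) (j : ℕ) (x : ℝ) : Spinor :=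
  if Even j then zeroMode κ (x - center n δ j) else conjSpinor (zeroMode κ (x - center n δ j))

/-- The hopping coefficient `2 γ² exp (-2 ∫₀^δ κ)`. -/
def hopping (κ : ℝ → ℝ) (δ : ℝ) : ℝ :=
  2 * gam κ ^ 2 * Real.exp (-2 * ∫ y in (0 : ℝ)..δ, κ y)

/-- The tridiagonal matrix `M₀(δ)`: zero on the diagonal, `-2 i γ² exp (-2 ∫₀^δ κ)` above it and
`2 i γ² exp (-2 ∫₀^δ κ)` below it. -/
def matrixM0 (κ : ℝ → ℝ) (n : ℕ) (δ : ℝ) : Matrix (Fin n) (Fin n) ℂ := fun i j =>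
  if (j : ℕ) = i + 1 then -(Complex.I * (hopping κ δ : ℂ))
  else if (i : ℕ) = j + 1 then Complex.I * (hopping κ δ : ℂ)
  else 0

end DiracWalls

end

noncomputable section

namespace DiracWalls

section SelfAdjointRelations

open Filter Topology
open scoped InnerProductSpace ComplexConjugate

variable {H : Type*} [NormedAddCommGroup H] [InnerProductSpace ℂ H]

/-- A linear relation on `H` (thought of as the graph of an unbounded operator) which is
self-adjoint. -/
structure IsSelfAdjointRel (G : Submodule ℂ (H × H)) : Prop where
  symm : ∀ p ∈ G, ∀ q ∈ G, ⟪p.2, q.1⟫_ℂ = ⟪p.1, q.2⟫_ℂ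
  maximal : ∀ p : H × H, (∀ q ∈ G, ⟪p.1, q.2⟫_ℂ = ⟪p.2, q.1⟫_ℂ) → p ∈ G

lemma IsSelfAdjointRel.isClosed {G : Submodule ℂ (H × H)} (hG : IsSelfAdjointRel G) :
    IsClosed (G : Set (H × H)) := by
  have : (G : Set (H × H)) = ⋂ q ∈ G, {p : H × H | ⟪p.1, q.2⟫_ℂ = ⟪p.2, q.1⟫_ℂ} := by
    ext p
    simp only [SetLike.mem_coe, Set.mem_iInter, Set.mem_ofPred_eq]
    exact ⟨fun hp q hq => (hG.symm p hp q hq).symm, hG.maximal p⟩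
  rw [this]
  refine isClosed_biInter fun q _ => isClosed_eq ?_ ?_ <;> fun_prop

/-- A lower bound off a finite-dimensional space `V` contained in the domain extends to the whole
domain at the price of a multiple of the projection to `V`. -/
lemma exists_coercive {G : Submodule ℂ (H × H)} (V : Submodule ℂ H) [FiniteDimensional ℂ V]
    (hV : ∀ v ∈ V, ∃ w, (v, w) ∈ G) {c : ℝ} (hc : 0 ≤ c)
    (hgap : ∀ p ∈ G, p.1 ∈ Vᗮ → c * ‖p.1‖ ≤ ‖p.2‖) :
    ∃ C : ℝ, ∀ p ∈ G, c * ‖p.1‖ ≤ ‖p.2‖ + C * ‖V.starProjection p.1‖ := by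
  let b := stdOrthonormalBasis ℂ V
  choose! w hw using hV
  refine ⟨(∑ i, ‖w (b i)‖) + c, fun p hp => ?_⟩
  set v := V.starProjection p.1 with hv
  set u : H := ∑ i, ⟪(b i : H), p.1⟫_ℂ • w (b i) with hu
  have hvu : (v, u) ∈ G := by
    have e : (v, u) = ∑ i, ⟪(b i : H), p.1⟫_ℂ • ((b i : H), w (b i)) := by
      ext1
      · simp only [Prod.fst_sum, Prod.smul_fst]
        have := b.sum_repr (V.orthogonalProjectionOnto p.1)
        rw [hv, Submodule.starProjection_apply, ← this]
        push_cast
        refine Finset.sum_congr rfl fun i _ => ?_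
        rw [b.repr_apply_apply, Submodule.coe_inner]
        congr 1
        have := V.inner_starProjection_left_eq_right (b i) p.1
        rw [Submodule.starProjection_eq_self_iff.2 (b i).2] at this
        rw [this, Submodule.starProjection_apply]
      · simp only [Prod.snd_sum, Prod.smul_snd, hu]
    rw [e]
    exact G.sum_mem fun i _ => G.smul_mem _ (hw _ (b i).2)
  have hbi : ∀ i, ‖⟪(b i : H), p.1⟫_ℂ‖ ≤ ‖v‖ := by
    intro i
    have h1 := V.inner_starProjection_left_eq_right (b i) p.1
    rw [Submodule.starProjection_eq_self_iff.2 (b i).2] at h1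
    rw [h1]
    refine (norm_inner_le_norm _ _).trans ?_
    have : ‖(b i : H)‖ = 1 := b.orthonormal.1 i
    rw [this, one_mul]
  have hun : ‖u‖ ≤ (∑ i, ‖w (b i)‖) * ‖v‖ := by
    rw [hu, Finset.sum_mul]
    refine (norm_sum_le _ _).trans (Finset.sum_le_sum fun i _ => ?_)
    rw [norm_smul, mul_comm]
    exact mul_le_mul_of_nonneg_left (hbi i) (norm_nonneg _)
  have h1 := hgap _ (G.sub_mem hp hvu) (V.sub_starProjection_mem_orthogonal p.1)
  have h2 : ‖p.1‖ ≤ ‖p.1 - v‖ + ‖v‖ := by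
    simpa using norm_add_le (p.1 - v) v
  have h3 : ‖p.2 - u‖ ≤ ‖p.2‖ + ‖u‖ := norm_sub_le _ _
  simp only [Prod.fst_sub, Prod.snd_sub] at h1
  nlinarith [mul_le_mul_of_nonneg_left h2 hc]

/-- The infimum of `‖h‖ / ‖f‖` over a closed linear relation is attained if it is smaller than a
lower bound that holds modulo a finite-dimensional space. -/
lemma exists_minimizer [CompleteSpace H] {G : Submodule ℂ (H × H)}
    (hG : IsClosed (G : Set (H × H)))
    (V : Submodule ℂ H) [FiniteDimensional ℂ V] {c C K : ℝ}
    (hco : ∀ p ∈ G, c * ‖p.1‖ ≤ ‖p.2‖ + C * ‖V.starProjection p.1‖) (hKc : K < c)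
    (hK : ∃ p ∈ G, ‖p.2‖ < K * ‖p.1‖) :
    ∃ l : ℝ, 0 ≤ l ∧ l ≤ K ∧ (∀ q ∈ G, l * ‖q.1‖ ≤ ‖q.2‖) ∧
      ∃ p ∈ G, ‖p.1‖ = 1 ∧ ‖p.2‖ = l := by
  set S : Set ℝ := {r | ∃ p ∈ G, ‖p.1‖ = 1 ∧ ‖p.2‖ = r} with hS
  have hnorm : ∀ p ∈ G, p.1 ≠ 0 → ‖p.2‖ / ‖p.1‖ ∈ S := by
    intro p hp h0
    have hpos : 0 < ‖p.1‖ := norm_pos_iff.2 h0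
    refine ⟨((‖p.1‖⁻¹ : ℝ) : ℂ) • p, G.smul_mem _ hp, ?_, ?_⟩
    · simp [norm_smul, hpos.ne']
    · simp [norm_smul, div_eq_inv_mul]
  have hbdd : BddBelow S := ⟨0, by rintro r ⟨p, -, -, rfl⟩; exact norm_nonneg _⟩
  obtain ⟨p₀, hp₀, hlt⟩ := hK
  have hp₀1 : p₀.1 ≠ 0 := by
    intro h
    rw [h, norm_zero, mul_zero] at hlt
    exact absurd hlt (not_lt.2 (norm_nonneg _))
  have hp₀pos : 0 < ‖p₀.1‖ := norm_pos_iff.2 hp₀1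
  have hne : S.Nonempty := ⟨_, hnorm p₀ hp₀ hp₀1⟩
  set l := sInf S with hl
  have hl0 : 0 ≤ l := le_csInf hne (by rintro r ⟨p, -, -, rfl⟩; exact norm_nonneg _)
  have hlK : l ≤ K := (csInf_le hbdd (hnorm p₀ hp₀ hp₀1)).trans ((div_le_iff₀ hp₀pos).2 hlt.le)
  have hmin : ∀ q ∈ G, l * ‖q.1‖ ≤ ‖q.2‖ := by
    intro q hq
    by_cases h0 : q.1 = 0
    · simp [h0]
    · exact (le_div_iff₀ (norm_pos_iff.2 h0)).1 (csInf_le hbdd (hnorm q hq h0))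
  refine ⟨l, hl0, hlK, hmin, ?_⟩
  obtain ⟨r, -, hr, hrS⟩ := exists_seq_tendsto_sInf hne hbdd
  choose p hpG hp1 hp2 using hrS
  -- a subsequence along which the projections to `V` converge
  have hbound : ∀ j, V.orthogonalProjectionOnto (p j).1 ∈ Metric.closedBall (0 : V) 1 := by
    intro j
    rw [mem_closedBall_zero_iff]
    exact (V.norm_orthogonalProjectionOnto_apply_le _).trans (hp1 j).le
  have : ProperSpace V := FiniteDimensional.proper_rclike ℂ V
  obtain ⟨v, -, φ, hφ, hv⟩ := tendsto_subseq_of_bounded Metric.isBounded_closedBall hbound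
  set q := fun j => p (φ j) with hq
  have hq2 : Tendsto (fun j => ‖(q j).2‖) atTop (𝓝 l) := by
    have : (fun j => ‖(q j).2‖) = r ∘ φ := funext fun j => hp2 _
    rw [this]
    exact hr.comp hφ.tendsto_atTop
  have hpv : Tendsto (fun j => V.starProjection (q j).1) atTop (𝓝 (v : H)) :=
    (continuous_subtype_val.tendsto v).comp hv
  -- the energy of differences tends to zero
  have hen : ∀ i j, ‖(q i).2 - (q j).2‖ ^ 2 ≤ l ^ 2 * ‖(q i).1 - (q j).1‖ ^ 2
      + (2 * (‖(q i).2‖ ^ 2 - l ^ 2) + 2 * (‖(q j).2‖ ^ 2 - l ^ 2)) := by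
    intro i j
    have e1 := parallelogram_law_with_norm ℂ (q i).1 (q j).1
    have e2 := parallelogram_law_with_norm ℂ (q i).2 (q j).2
    have h := hmin _ (G.add_mem (hpG (φ i)) (hpG (φ j)))
    have h' : (l * ‖(q i).1 + (q j).1‖) ^ 2 ≤ ‖(q i).2 + (q j).2‖ ^ 2 :=
      pow_le_pow_left₀ (by positivity) h 2
    have a1 : ‖(q i).1‖ = 1 := hp1 _
    have a2 : ‖(q j).1‖ = 1 := hp1 _
    rw [a1, a2] at e1
    have e3 : l ^ 2 * (‖(q i).1 + (q j).1‖ ^ 2 + ‖(q i).1 - (q j).1‖ ^ 2) = l ^ 2 * 4 := by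
      rw [e1]; norm_num
    rw [mul_pow] at h'
    linarith
  set e : ℕ → ℝ := fun j => 2 * (‖(q j).2‖ ^ 2 - l ^ 2) with he
  have he0 : ∀ j, 0 ≤ e j := by
    intro j
    have := hmin _ (hpG (φ j))
    rw [hp1, mul_one] at this
    have : l ^ 2 ≤ ‖(q j).2‖ ^ 2 := pow_le_pow_left₀ hl0 this 2
    simp only [he]; linarith
  have hlim : Tendsto e atTop (𝓝 0) := by
    have := ((hq2.pow 2).sub_const (l ^ 2)).const_mul 2
    simpa [he] using this
  have hpair : ∀ i j, ‖(q i).2 - (q j).2‖ ≤ l * ‖(q i).1 - (q j).1‖ + √(e i + e j) := by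
    intro i j
    refine abs_le_of_sq_le_sq' ?_ (by positivity) |>.2
    have := hen i j
    have hs := Real.sq_sqrt (add_nonneg (he0 i) (he0 j))
    have : 0 ≤ l * ‖(q i).1 - (q j).1‖ * √(e i + e j) := by positivity
    nlinarith
  have hpair1 : ∀ i j, (c - l) * ‖(q i).1 - (q j).1‖
      ≤ √(e i + e j) + C * ‖V.starProjection (q i).1 - V.starProjection (q j).1‖ := by
    intro i j
    have := hco _ (G.sub_mem (hpG (φ i)) (hpG (φ j)))
    simp only [Prod.fst_sub, Prod.snd_sub, map_sub] at this
    have := hpair i j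
    simp only [hq] at *
    linarith
  have hcl : 0 < c - l := by linarith
  have hsq : Tendsto (fun x : ℕ × ℕ => √(e x.1 + e x.2)) atTop (𝓝 0) := by
    rw [← prod_atTop_atTop_eq]
    have := ((hlim.comp tendsto_fst).add (hlim.comp tendsto_snd) :
      Tendsto (fun x : ℕ × ℕ => e x.1 + e x.2) (atTop ×ˢ atTop) (𝓝 (0 + 0)))
    rw [add_zero] at this
    simpa using this.sqrt
  have hproj : Tendsto (fun x : ℕ × ℕ =>
      ‖V.starProjection (q x.1).1 - V.starProjection (q x.2).1‖) atTop (𝓝 0) := by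
    rw [← prod_atTop_atTop_eq]
    have := ((hpv.comp tendsto_fst).sub (hpv.comp tendsto_snd) : Tendsto (fun x : ℕ × ℕ =>
      V.starProjection (q x.1).1 - V.starProjection (q x.2).1) (atTop ×ˢ atTop)
      (𝓝 ((v : H) - v)))
    rw [sub_self] at this
    simpa using this.norm
  have hd1 : Tendsto (fun x : ℕ × ℕ => ‖(q x.1).1 - (q x.2).1‖) atTop (𝓝 0) := by
    have hb := (hsq.add (hproj.const_mul C)).const_mul (c - l)⁻¹
    simp only [mul_zero, add_zero] at hb
    refine squeeze_zero (fun _ => norm_nonneg _) (fun x => ?_) hb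
    rw [← div_eq_inv_mul, le_div_iff₀ hcl, mul_comm]
    exact hpair1 _ _
  have hd2 : Tendsto (fun x : ℕ × ℕ => ‖(q x.1).2 - (q x.2).2‖) atTop (𝓝 0) := by
    have hb := (hd1.const_mul l).add hsq
    simp only [mul_zero, add_zero] at hb
    exact squeeze_zero (fun _ => norm_nonneg _) (fun x => hpair _ _) hb
  have hc1 : CauchySeq (fun j => (q j).1) := by
    rw [cauchySeq_iff_tendsto_dist_atTop_0]; simpa [dist_eq_norm] using hd1
  have hc2 : CauchySeq (fun j => (q j).2) := by
    rw [cauchySeq_iff_tendsto_dist_atTop_0]; simpa [dist_eq_norm] using hd2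
  obtain ⟨f, hf⟩ := cauchySeq_tendsto_of_complete hc1
  obtain ⟨h, hh⟩ := cauchySeq_tendsto_of_complete hc2
  refine ⟨(f, h), hG.mem_of_tendsto (hf.prodMk_nhds hh)
    (Eventually.of_forall fun j => hpG (φ j)), ?_, ?_⟩
  · refine tendsto_nhds_unique hf.norm ?_
    have : (fun j => ‖(q j).1‖) = fun _ => 1 := funext fun j => hp1 _
    rw [this]; exact tendsto_const_nhds
  · exact tendsto_nhds_unique hh.norm hq2

lemma minimizer_re_eq {G : Submodule ℂ (H × H)} {l : ℝ} (hl : 0 ≤ l)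
    (hmin : ∀ q ∈ G, l * ‖q.1‖ ≤ ‖q.2‖) {p : H × H} (hp : p ∈ G) (hpl : ‖p.2‖ = l * ‖p.1‖)
    {q : H × H} (hq : q ∈ G) : (⟪p.2, q.2⟫_ℂ).re = l ^ 2 * (⟪p.1, q.1⟫_ℂ).re := by
  set β := (⟪p.2, q.2⟫_ℂ).re - l ^ 2 * (⟪p.1, q.1⟫_ℂ).re with hβ
  set A := ‖q.2‖ ^ 2 - l ^ 2 * ‖q.1‖ ^ 2 with hA
  have key : ∀ t : ℝ, 0 ≤ A * (t * t) + (2 * β) * t + 0 := by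
    intro t
    have h1 := hmin _ (G.add_mem hp (G.smul_mem (t : ℂ) hq))
    have h2 : (l * ‖p.1 + (t : ℂ) • q.1‖) ^ 2 ≤ ‖p.2 + (t : ℂ) • q.2‖ ^ 2 :=
      pow_le_pow_left₀ (by positivity) h1 2
    rw [mul_pow, norm_add_sq (𝕜 := ℂ), norm_add_sq (𝕜 := ℂ), inner_smul_right, inner_smul_right,
      norm_smul, norm_smul, hpl] at h2
    simp only [RCLike.re_to_complex, Complex.re_ofReal_mul, Complex.norm_real, Real.norm_eq_abs,
      mul_pow, sq_abs] at h2
    rw [hβ, hA]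
    linarith
  have := discrim_le_zero key
  rw [discrim] at this
  have : β = 0 := by nlinarith
  linarith

lemma minimizer_eq {G : Submodule ℂ (H × H)} {l : ℝ} (hl : 0 ≤ l)
    (hmin : ∀ q ∈ G, l * ‖q.1‖ ≤ ‖q.2‖) {p : H × H} (hp : p ∈ G) (hpl : ‖p.2‖ = l * ‖p.1‖)
    {q : H × H} (hq : q ∈ G) : ⟪p.2, q.2⟫_ℂ = (l : ℂ) ^ 2 * ⟪p.1, q.1⟫_ℂ := by
  have h1 := minimizer_re_eq hl hmin hp hpl hq
  have h2 := minimizer_re_eq hl hmin hp hpl (G.smul_mem (-Complex.I) hq)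
  simp only [Prod.smul_fst, Prod.smul_snd, inner_smul_right] at h2
  have e : (l : ℂ) ^ 2 = ((l ^ 2 : ℝ) : ℂ) := by push_cast; rfl
  rw [e]
  apply Complex.ext
  · rw [h1, Complex.re_ofReal_mul]
  · rw [Complex.im_ofReal_mul]
    simpa using h2

/-- If a self-adjoint relation with a lower bound `c` modulo a finite-dimensional space violates
the lower bound `K < c` on the orthogonal complement of an invariant space `W`, then it has an
eigenvector in this complement with eigenvalue in `[-K, K]`. -/
lemma exists_eigenvector [CompleteSpace H] {G : Submodule ℂ (H × H)} (hG : IsSelfAdjointRel G)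
    (V : Submodule ℂ H) [FiniteDimensional ℂ V] {c C K : ℝ}
    (hco : ∀ p ∈ G, c * ‖p.1‖ ≤ ‖p.2‖ + C * ‖V.starProjection p.1‖) (hKc : K < c)
    (W : Submodule ℂ H) [W.HasOrthogonalProjection] (hW : ∀ w ∈ W, ∃ w' ∈ W, (w, w') ∈ G)
    (hK : ∃ p ∈ G, p.1 ∈ Wᗮ ∧ ‖p.2‖ < K * ‖p.1‖) :
    ∃ l : ℝ, |l| ≤ K ∧ ∃ u ∈ Wᗮ, u ≠ 0 ∧ (u, (l : ℂ) • u) ∈ G := by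
  set G' : Submodule ℂ (H × H) := G ⊓ Wᗮ.comap (LinearMap.fst ℂ H H) with hG'
  have hmem : ∀ p, p ∈ G' ↔ p ∈ G ∧ p.1 ∈ Wᗮ := fun p => by simp [hG']
  have hcl : IsClosed (G' : Set (H × H)) := by
    have : (G' : Set (H × H)) = (G : Set (H × H)) ∩ Prod.fst ⁻¹' (Wᗮ : Set H) := by
      ext p; simp [hmem]
    rw [this]
    exact hG.isClosed.inter (W.isClosed_orthogonal.preimage continuous_fst)
  have hperp : ∀ p ∈ G', p.2 ∈ Wᗮ := by
    intro p hp
    obtain ⟨h1, h2⟩ := (hmem p).1 hp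
    rw [Submodule.mem_orthogonal']
    intro w hw
    obtain ⟨w', hw', hww⟩ := hW w hw
    rw [hG.symm p h1 _ hww]
    exact Submodule.inner_left_of_mem_orthogonal hw' h2
  obtain ⟨l, hl0, hlK, hmin, p, hp, hp1, hp2⟩ := exists_minimizer hcl V
    (fun p hp => hco p ((hmem p).1 hp).1) hKc
    (by obtain ⟨p, h1, h2, h3⟩ := hK; exact ⟨p, (hmem p).2 ⟨h1, h2⟩, h3⟩)
  obtain ⟨hpG, hpW⟩ := (hmem p).1 hp
  have hp2W := hperp p hp
  have hvar : ∀ q ∈ G, ⟪p.2, q.2⟫_ℂ = ⟪((l : ℂ) ^ 2) • p.1, q.1⟫_ℂ := by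
    intro q hq
    obtain ⟨w', hw', hww⟩ := hW _ (W.starProjection_apply_mem q.1)
    have hq' : q - (W.starProjection q.1, w') ∈ G' :=
      (hmem _).2 ⟨G.sub_mem hq hww, W.sub_starProjection_mem_orthogonal _⟩
    have h := minimizer_eq hl0 hmin hp (by rw [hp1, hp2, mul_one]) hq'
    simp only [Prod.fst_sub, Prod.snd_sub, inner_sub_right] at h
    rw [Submodule.inner_left_of_mem_orthogonal hw' hp2W,
      Submodule.inner_left_of_mem_orthogonal (W.starProjection_apply_mem q.1) hpW, sub_zero,
      sub_zero] at h
    rw [h, inner_smul_left]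
    simp
  have hTT : (p.2, ((l : ℂ) ^ 2) • p.1) ∈ G := hG.maximal _ hvar
  by_cases hu : p.2 + (l : ℂ) • p.1 = 0
  · refine ⟨-l, by rwa [abs_neg, abs_of_nonneg hl0], p.1, hpW, ?_, ?_⟩
    · rw [← norm_pos_iff, hp1]; exact one_pos
    · have : ((-l : ℝ) : ℂ) • p.1 = p.2 := by
        rw [eq_neg_of_add_eq_zero_left hu]; push_cast; rw [neg_smul]
      rw [this]; exact hpG
  · refine ⟨l, by rwa [abs_of_nonneg hl0], p.2 + (l : ℂ) • p.1,
      Wᗮ.add_mem hp2W (Wᗮ.smul_mem _ hpW), hu, ?_⟩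
    have := G.add_mem hTT (G.smul_mem (l : ℂ) hpG)
    convert this using 1
    ext1
    · rfl
    · simp only [Prod.snd_add, Prod.smul_snd, smul_add, smul_smul, pow_two]
      abel

lemma orthonormal_cons {m : ℕ} {ψ : Fin m → H} (hψ : Orthonormal ℂ ψ) {u : H} (hu : ‖u‖ = 1)
    (hp : ∀ i, ⟪ψ i, u⟫_ℂ = 0) : Orthonormal ℂ (Fin.cons u ψ : Fin (m + 1) → H) := by
  rw [orthonormal_iff_ite]
  have huu : ⟪u, u⟫_ℂ = 1 := by rw [inner_self_eq_norm_sq_to_K, hu]; simp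
  intro i j
  refine Fin.cases ?_ (fun i => ?_) i <;> refine Fin.cases ?_ (fun j => ?_) j
  · simpa using huu
  · simpa [Fin.succ_ne_zero, (Fin.succ_ne_zero j).symm] using inner_eq_zero_symm.1 (hp j)
  · simpa [Fin.succ_ne_zero] using hp i
  · simpa [Fin.succ_inj] using orthonormal_iff_ite.1 hψ i j

lemma sum_smul_mem_rel {G : Submodule ℂ (H × H)} {ι : Type*} [Fintype ι] {f g : ι → H}
    (h : ∀ i, (f i, g i) ∈ G) (a : ι → ℂ) : (∑ i, a i • f i, ∑ i, a i • g i) ∈ G := by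
  have : (∑ i, a i • f i, ∑ i, a i • g i) = ∑ i, a i • (f i, g i) := by
    ext1 <;> simp [Prod.fst_sum, Prod.snd_sum]
  rw [this]
  exact G.sum_mem fun i _ => G.smul_mem _ (h i)

lemma norm_sq_sum_orthonormal {ι : Type*} [Fintype ι] {ψ : ι → H} (hψ : Orthonormal ℂ ψ)
    (a : ι → ℂ) : ‖∑ i, a i • ψ i‖ ^ 2 = ∑ i, ‖a i‖ ^ 2 := by
  have h := hψ.inner_sum a a Finset.univ
  rw [inner_self_eq_norm_sq_to_K] at h
  have h2 : ((‖∑ i, a i • ψ i‖ ^ 2 : ℝ) : ℂ) = ((∑ i, ‖a i‖ ^ 2 : ℝ) : ℂ) := by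
    push_cast
    rw [← Complex.coe_algebraMap, ← RCLike.algebraMap_eq_ofReal] at *
    simpa [Complex.conj_mul'] using h
  exact_mod_cast h2

/-- An orthonormal family of eigenvectors with eigenvalues in `[-K, K]`. -/
structure IsEigenFamily (G : Submodule ℂ (H × H)) (K : ℝ) {m : ℕ} (ψ : Fin m → H)
    (l : Fin m → ℝ) : Prop where
  orthonormal : Orthonormal ℂ ψ
  bound : ∀ i, |l i| ≤ K
  mem : ∀ i, (ψ i, (l i : ℂ) • ψ i) ∈ G

lemma IsEigenFamily.le_finrank {G : Submodule ℂ (H × H)} {K c : ℝ} {m : ℕ} {ψ : Fin m → H}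
    {l : Fin m → ℝ} (h : IsEigenFamily G K ψ l) (V : Submodule ℂ H) [FiniteDimensional ℂ V]
    (hK : 0 < K) (hKc : K < c) (hgap : ∀ p ∈ G, p.1 ∈ Vᗮ → c * ‖p.1‖ ≤ ‖p.2‖) :
    m ≤ Module.finrank ℂ V := by
  by_contra! hlt
  set F : (Fin m → ℂ) →ₗ[ℂ] V :=
    V.orthogonalProjectionOnto.toLinearMap ∘ₗ Fintype.linearCombination ℂ ψ with hF
  have hker : LinearMap.ker F ≠ ⊥ := F.ker_ne_bot_of_finrank_lt (by simpa using hlt)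
  obtain ⟨a, ha, ha0⟩ := Submodule.exists_mem_ne_zero_of_ne_bot hker
  have hmem := sum_smul_mem_rel h.mem a
  have hperp : ∑ i, a i • ψ i ∈ Vᗮ := by
    rw [LinearMap.mem_ker, hF] at ha
    rw [← Submodule.orthogonalProjectionOnto_eq_zero_iff]
    simpa [Fintype.linearCombination_apply] using ha
  have h1 := hgap _ hmem hperp
  have e1 := norm_sq_sum_orthonormal h.orthonormal a
  have e2 : ‖∑ i, a i • (l i : ℂ) • ψ i‖ ^ 2 = ∑ i, ‖a i * (l i : ℂ)‖ ^ 2 := by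
    simp_rw [smul_smul]
    exact norm_sq_sum_orthonormal h.orthonormal _
  have e3 : ∑ i, ‖a i * (l i : ℂ)‖ ^ 2 ≤ K ^ 2 * ∑ i, ‖a i‖ ^ 2 := by
    rw [Finset.mul_sum]
    refine Finset.sum_le_sum fun i _ => ?_
    rw [norm_mul, mul_pow, Complex.norm_real, Real.norm_eq_abs, mul_comm]
    exact mul_le_mul_of_nonneg_right (pow_le_pow_left₀ (abs_nonneg _) (h.bound i) 2)
      (by positivity)
  have hpos : 0 < ∑ i, ‖a i‖ ^ 2 := by
    obtain ⟨i, hi⟩ := Function.ne_iff.1 ha0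
    exact Finset.sum_pos' (fun _ _ => by positivity)
      ⟨i, Finset.mem_univ _, by have := norm_pos_iff.2 hi; positivity⟩
  have h2 : (c * ‖∑ i, a i • ψ i‖) ^ 2 ≤ ‖∑ i, a i • (l i : ℂ) • ψ i‖ ^ 2 :=
    pow_le_pow_left₀ (by have := hK.trans hKc; positivity) h1 2
  rw [mul_pow, e1, e2] at h2
  have : K ^ 2 < c ^ 2 := pow_lt_pow_left₀ hKc hK.le two_ne_zero
  nlinarith

/-- Spectral theorem near zero: a self-adjoint relation which is bounded below by `c` on the
complement of a finite-dimensional space `V` and by less than `K < c` on `V` has exactly `dim V`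
eigenvalues in `[-K, K]`, and it is bounded below by `K` on the complement of the eigenvectors. -/
theorem IsSelfAdjointRel.exists_eigenFamily [CompleteSpace H] {G : Submodule ℂ (H × H)}
    (hG : IsSelfAdjointRel G) (V : Submodule ℂ H) [FiniteDimensional ℂ V] {c K : ℝ}
    (hK : 0 < K) (hKc : K < c) (hgap : ∀ p ∈ G, p.1 ∈ Vᗮ → c * ‖p.1‖ ≤ ‖p.2‖)
    (hV : ∀ v ∈ V, ∃ w, (v, w) ∈ G) (hsmall : ∀ v ∈ V, v ≠ 0 → ∃ w, (v, w) ∈ G ∧ ‖w‖ < K * ‖v‖) :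
    ∃ (ψ : Fin (Module.finrank ℂ V) → H) (l : Fin (Module.finrank ℂ V) → ℝ),
      IsEigenFamily G K ψ l ∧ (∀ p ∈ G, (∀ i, ⟪ψ i, p.1⟫_ℂ = 0) → K * ‖p.1‖ ≤ ‖p.2‖) ∧
      ∀ e : ℝ, |e| ≤ K → ∀ f, (f, (e : ℂ) • f) ∈ G →
        f = ∑ i, ⟪ψ i, f⟫_ℂ • ψ i ∧ ∀ i, e ≠ l i → ⟪ψ i, f⟫_ℂ = 0 := by
  classical
  obtain ⟨C, hco⟩ := exists_coercive V hV (hK.trans hKc).le hgap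
  set P : ℕ → Prop := fun m => ∃ (ψ : Fin m → H) (l : Fin m → ℝ), IsEigenFamily G K ψ l with hP
  have hP0 : P 0 := ⟨Fin.elim0, Fin.elim0, ⟨by simp [Orthonormal], fun i => i.elim0, fun i => i.elim0⟩⟩
  have hPle : ∀ m, P m → m ≤ Module.finrank ℂ V := by
    rintro m ⟨ψ, l, h⟩
    exact h.le_finrank V hK hKc hgap
  set m := Nat.findGreatest P (Module.finrank ℂ V) with hm
  have hPm : P m := Nat.findGreatest_spec (Nat.zero_le _) hP0
  have hPm1 : ¬ P (m + 1) := fun h => by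
    have := Nat.le_findGreatest (hPle _ h) h
    omega
  obtain ⟨ψ, l, hfam⟩ := hPm
  have hno : ∀ u : H, u ≠ 0 → (∀ i, ⟪ψ i, u⟫_ℂ = 0) → ∀ e : ℝ, |e| ≤ K →
      (u, (e : ℂ) • u) ∉ G := by
    intro u hu hpu e he hmem
    refine hPm1 ⟨Fin.cons (((‖u‖⁻¹ : ℝ) : ℂ) • u) ψ, Fin.cons e l, ?_, ?_, ?_⟩
    · refine orthonormal_cons hfam.orthonormal ?_ fun i => ?_
      · simp [norm_smul, hu]
      · rw [inner_smul_right, hpu, mul_zero]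
    · intro i
      refine Fin.cases ?_ (fun i => ?_) i
      · simpa using he
      · simpa using hfam.bound i
    · intro i
      refine Fin.cases ?_ (fun i => ?_) i
      · have := G.smul_mem (((‖u‖⁻¹ : ℝ) : ℂ)) hmem
        rw [Fin.cons_zero, Fin.cons_zero, smul_comm]
        exact this
      · simpa using hfam.mem i
  have hlow : ∀ p ∈ G, (∀ i, ⟪ψ i, p.1⟫_ℂ = 0) → K * ‖p.1‖ ≤ ‖p.2‖ := by
    by_contra! hcon
    obtain ⟨p, hp, hperp, hlt⟩ := hcon
    set W : Submodule ℂ H := Submodule.span ℂ (Set.range ψ) with hW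
    have hfin : FiniteDimensional ℂ W := FiniteDimensional.span_of_finite ℂ (Set.finite_range ψ)
    have hWperp : ∀ u : H, u ∈ Wᗮ ↔ ∀ i, ⟪ψ i, u⟫_ℂ = 0 := by
      intro u
      constructor
      · intro h i
        exact Submodule.inner_right_of_mem_orthogonal
          (Submodule.subset_span (Set.mem_range_self i)) h
      · intro h
        rw [Submodule.mem_orthogonal]
        intro w hw
        induction hw using Submodule.span_induction with
        | mem x hx => obtain ⟨i, rfl⟩ := hx; exact h i
        | zero => simp
        | add x y _ _ hx hy => rw [inner_add_left, hx, hy, add_zero]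
        | smul a x _ hx => rw [inner_smul_left, hx, mul_zero]
    obtain ⟨e, he, u, huW, hu0, huG⟩ := exists_eigenvector hG V hco hKc W (by
        intro w hw
        induction hw using Submodule.span_induction with
        | mem x hx =>
          obtain ⟨i, rfl⟩ := hx
          exact ⟨_, W.smul_mem _ (Submodule.subset_span (Set.mem_range_self i)), hfam.mem i⟩
        | zero => exact ⟨0, W.zero_mem, G.zero_mem⟩
        | add x y _ _ hx hy =>
          obtain ⟨x', hx', hx''⟩ := hx
          obtain ⟨y', hy', hy''⟩ := hy
          exact ⟨x' + y', W.add_mem hx' hy', G.add_mem hx'' hy''⟩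
        | smul a x _ hx =>
          obtain ⟨x', hx', hx''⟩ := hx
          exact ⟨a • x', W.smul_mem a hx', G.smul_mem a hx''⟩)
      ⟨p, hp, (hWperp _).2 hperp, hlt⟩
    exact hno u hu0 ((hWperp u).1 huW) e he huG
  have hmV : m = Module.finrank ℂ V := by
    refine le_antisymm (hPle m ⟨ψ, l, hfam⟩) ?_
    by_contra! hlt
    set F : V →ₗ[ℂ] (Fin m → ℂ) :=
      LinearMap.pi fun i => (innerSL ℂ (ψ i)).toLinearMap ∘ₗ V.subtype with hF
    have hker : LinearMap.ker F ≠ ⊥ := F.ker_ne_bot_of_finrank_lt (by simpa using hlt)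
    obtain ⟨v, hv, hv0⟩ := Submodule.exists_mem_ne_zero_of_ne_bot hker
    have hperp : ∀ i, ⟪ψ i, (v : H)⟫_ℂ = 0 := by
      intro i
      have := congrFun (LinearMap.mem_ker.1 hv) i
      simpa [hF] using this
    obtain ⟨w, hw, hlt'⟩ := hsmall v v.2 (by simpa using hv0)
    exact absurd (hlow _ hw hperp) (not_le.2 hlt')
  have hspan : ∀ e : ℝ, |e| ≤ K → ∀ f, (f, (e : ℂ) • f) ∈ G →
      f = ∑ i, ⟪ψ i, f⟫_ℂ • ψ i ∧ ∀ i, e ≠ l i → ⟪ψ i, f⟫_ℂ = 0 := by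
    intro e he f hf
    have hz : ∀ i, e ≠ l i → ⟪ψ i, f⟫_ℂ = 0 := by
      intro i hi
      have h := hG.symm _ (hfam.mem i) _ hf
      simp only [inner_smul_left, inner_smul_right, Complex.conj_ofReal] at h
      have h' : ((l i : ℂ) - e) * ⟪ψ i, f⟫_ℂ = 0 := by rw [sub_mul, h, sub_self]
      rcases mul_eq_zero.1 h' with h'' | h''
      · exact absurd (by exact_mod_cast (sub_eq_zero.1 h'').symm) hi
      · exact h''
    refine ⟨?_, hz⟩
    have hmem := sum_smul_mem_rel hfam.mem fun i => ⟪ψ i, f⟫_ℂ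
    have e1 : ∑ i, ⟪ψ i, f⟫_ℂ • (l i : ℂ) • ψ i = (e : ℂ) • ∑ i, ⟪ψ i, f⟫_ℂ • ψ i := by
      rw [Finset.smul_sum]
      refine Finset.sum_congr rfl fun i _ => ?_
      by_cases hi : e = l i
      · rw [hi, smul_comm]
      · simp [hz i hi]
    rw [e1] at hmem
    have hd := G.sub_mem hf hmem
    by_contra hne
    refine hno (f - ∑ i, ⟪ψ i, f⟫_ℂ • ψ i) (sub_ne_zero.2 hne) (fun i => ?_) e he ?_
    · rw [inner_sub_right, hfam.orthonormal.inner_right_fintype, sub_self]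
    · rw [smul_sub]; exact hd
  clear_value m
  subst hmV
  exact ⟨ψ, l, hfam, hlow, hspan⟩

end SelfAdjointRelations

section Perturbation

open scoped InnerProductSpace ComplexConjugate Matrix Matrix.Norms.Operator

/-- Matching of approximate eigenvectors with the eigenvectors of a matrix with well separated
eigenvalues `ε μ l`; the `c i l` are the coefficients of the `i`-th approximate eigenvector. -/
lemma exists_matching {n : ℕ} (hn : 1 ≤ n) {μ : Fin n → ℝ} {g : ℝ} (hg : 0 < g)
    (hμ : ∀ l l', l ≠ l' → g ≤ |μ l - μ l'|) {A B : ℝ} (hA : 0 ≤ A) (hB : 0 ≤ B) :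
    ∃ C ε₀ : ℝ, 0 ≤ C ∧ 0 < ε₀ ∧ ∀ ε, 0 < ε → ε < ε₀ → ∀ (e : Fin n → ℝ) (c : Fin n → Fin n → ℂ),
      (∀ i j, ‖∑ l, conj (c i l) * c j l - if i = j then 1 else 0‖ ≤ A * ε) →
      (∀ i l, |ε * μ l - e i| * ‖c i l‖ ≤ B * ε ^ 2) →
      ∃ σ : Equiv.Perm (Fin n), ∀ i, |e i - ε * μ (σ i)| ≤ C * ε ^ 2 ∧
        |‖c i (σ i)‖ - 1| ≤ C * ε ∧ ∀ l, l ≠ σ i → ‖c i l‖ ≤ C * ε := by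
  have hN : (1 : ℝ) ≤ n := by exact_mod_cast hn
  set D := 2 * B / g with hD
  have hD0 : 0 ≤ D := by positivity
  set F := A + n * D ^ 2 with hF
  have hF0 : 0 ≤ F := by positivity
  refine ⟨2 * n * B + D + F, min 1 (min (1 / (2 * (A + 1))) (min (g / (4 * n * (B + 1)))
    (1 / (4 * n ^ 2 * (F + 1))))), by positivity, by positivity, ?_⟩
  intro ε hε hlt e c hc hec
  simp only [lt_min_iff] at hlt
  obtain ⟨h1, h2, h3, h4⟩ := hlt
  rw [lt_div_iff₀ (by positivity)] at h2 h3 h4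
  have hε2 : ε ^ 2 ≤ ε := by nlinarith
  have hnorm : ∀ i, |∑ l, ‖c i l‖ ^ 2 - 1| ≤ A * ε := by
    intro i
    have := hc i i
    rw [if_pos rfl] at this
    have e1 : ∑ l, conj (c i l) * c i l - 1 = ((∑ l, ‖c i l‖ ^ 2 - 1 : ℝ) : ℂ) := by
      push_cast
      simp_rw [Complex.conj_mul']
    rwa [e1, Complex.norm_real] at this
  have hex : ∀ i, ∃ l, 1 / (2 * n) ≤ ‖c i l‖ ^ 2 := by
    intro i
    by_contra! hcon
    have hs : ∑ l, ‖c i l‖ ^ 2 ≤ ∑ _l : Fin n, (1 / (2 * n) : ℝ) :=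
      Finset.sum_le_sum fun l _ => (hcon l).le
    have hs' : ∑ l, ‖c i l‖ ^ 2 < ∑ _l : Fin n, (1 / (2 * n) : ℝ) :=
      Finset.sum_lt_sum_of_nonempty ⟨i, Finset.mem_univ _⟩ fun l _ => hcon l
    have e2 : ∑ _l : Fin n, (1 / (2 * n) : ℝ) = 1 / 2 := by
      rw [Finset.sum_const, Finset.card_univ, Fintype.card_fin, nsmul_eq_mul]
      field_simp
    have := (abs_le.1 (hnorm i)).1
    nlinarith
  choose σ hσ using hex
  have hσ' : ∀ i, 1 / (2 * n) ≤ ‖c i (σ i)‖ := by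
    intro i
    refine le_of_sq_le_sq ?_ (norm_nonneg _)
    refine le_trans ?_ (hσ i)
    rw [div_pow, one_pow, one_div_le_one_div (by positivity) (by positivity)]
    nlinarith
  have hev : ∀ i, |e i - ε * μ (σ i)| ≤ 2 * n * B * ε ^ 2 := by
    intro i
    have h := hec i (σ i)
    rw [abs_sub_comm] at h
    have h' := mul_le_mul_of_nonneg_left (hσ' i) (abs_nonneg (e i - ε * μ (σ i)))
    have h'' := h'.trans h
    rw [mul_one_div, div_le_iff₀ (by positivity)] at h''
    linarith
  have hother : ∀ i l, l ≠ σ i → ‖c i l‖ ≤ D * ε := by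
    intro i l hl
    have hsep : g / 2 * ε ≤ |ε * μ l - e i| := by
      have t1 : ε * g ≤ |ε * μ l - ε * μ (σ i)| := by
        rw [← mul_sub, abs_mul, abs_of_pos hε]
        exact mul_le_mul_of_nonneg_left (hμ _ _ hl) hε.le
      have t2 := abs_sub_le (ε * μ l) (e i) (ε * μ (σ i))
      have t3 := hev i
      have t4 : 2 * n * B * ε ^ 2 ≤ g / 2 * ε := by
        have : ε * (4 * n * B) ≤ g := by nlinarith
        nlinarith
      linarith
    have h := (mul_le_mul_of_nonneg_right hsep (norm_nonneg (c i l))).trans (hec i l)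
    have : ε * (g * ‖c i l‖) ≤ ε * (2 * B * ε) := by nlinarith
    have := le_of_mul_le_mul_left this hε
    rw [hD, div_mul_eq_mul_div, le_div_iff₀ hg]
    linarith
  have hsq : ∀ i j, σ i = σ j →
      ∑ l ∈ Finset.univ.erase (σ i), ‖c i l‖ * ‖c j l‖ ≤ n * D ^ 2 * ε := by
    intro i j hij
    have : ∑ l ∈ Finset.univ.erase (σ i), ‖c i l‖ * ‖c j l‖ ≤
        ∑ _l ∈ Finset.univ.erase (σ i), D ^ 2 * ε := by
      refine Finset.sum_le_sum fun l hl => ?_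
      have hl' := (Finset.mem_erase.1 hl).1
      have := mul_le_mul (hother i l hl') (hother j l (hij ▸ hl')) (norm_nonneg _) (by positivity)
      nlinarith [mul_le_mul_of_nonneg_left hε2 (sq_nonneg D)]
    refine this.trans ?_
    rw [Finset.sum_const, nsmul_eq_mul, mul_assoc]
    refine mul_le_mul_of_nonneg_right ?_ (by positivity)
    have := Finset.card_erase_le (s := (Finset.univ : Finset (Fin n))) (a := σ i)
    rw [Finset.card_univ, Fintype.card_fin] at this
    exact_mod_cast this
  have hdiag : ∀ i, |‖c i (σ i)‖ - 1| ≤ F * ε := by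
    intro i
    have h := hnorm i
    rw [← Finset.add_sum_erase _ _ (Finset.mem_univ (σ i))] at h
    have h' := hsq i i rfl
    simp_rw [← pow_two] at h'
    have h0 : 0 ≤ ∑ l ∈ Finset.univ.erase (σ i), ‖c i l‖ ^ 2 :=
      Finset.sum_nonneg fun _ _ => by positivity
    rw [abs_le] at h ⊢
    have hx := norm_nonneg (c i (σ i))
    have hF' : F * ε = A * ε + n * D ^ 2 * ε := by rw [hF]; ring
    constructor
    · by_contra! hcon
      nlinarith
    · by_contra! hcon
      have : 0 ≤ F * ε := by positivity
      have : 0 ≤ n * D ^ 2 * ε := by positivity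
      nlinarith
  have hinj : Function.Injective σ := by
    intro i j hij
    by_contra hne
    have h := hc i j
    rw [if_neg hne, sub_zero, ← Finset.add_sum_erase _ _ (Finset.mem_univ (σ i))] at h
    have h' : ‖∑ l ∈ Finset.univ.erase (σ i), conj (c i l) * c j l‖ ≤ n * D ^ 2 * ε := by
      refine (norm_sum_le _ _).trans (le_trans (le_of_eq ?_) (hsq i j hij))
      exact Finset.sum_congr rfl fun l _ => by rw [norm_mul, RCLike.norm_conj]
    have h'' : ‖conj (c i (σ i)) * c j (σ i)‖ ≤ F * ε := by
      have := norm_sub_le (conj (c i (σ i)) * c j (σ i) +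
        ∑ l ∈ Finset.univ.erase (σ i), conj (c i l) * c j l)
        (∑ l ∈ Finset.univ.erase (σ i), conj (c i l) * c j l)
      rw [add_sub_cancel_right] at this
      have hF' : F * ε = A * ε + n * D ^ 2 * ε := by rw [hF]; ring
      linarith
    rw [norm_mul, RCLike.norm_conj] at h''
    have hl : 1 / (2 * n) * (1 / (2 * n)) ≤ ‖c i (σ i)‖ * ‖c j (σ i)‖ :=
      mul_le_mul (hσ' i) (hij ▸ hσ' j) (by positivity) (norm_nonneg _)
    have e3 : (1 / (2 * n) * (1 / (2 * n)) : ℝ) = 1 / (4 * n ^ 2) := by field_simp; norm_num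
    rw [e3] at hl
    have := hl.trans h''
    rw [div_le_iff₀ (by positivity)] at this
    nlinarith
  refine ⟨Equiv.ofBijective σ (Finite.injective_iff_bijective.1 hinj), fun i => ⟨?_, ?_, ?_⟩⟩
  · refine (hev i).trans (mul_le_mul_of_nonneg_right ?_ (by positivity))
    linarith
  · refine (hdiag i).trans (mul_le_mul_of_nonneg_right ?_ hε.le)
    have : 0 ≤ 2 * n * B := by positivity
    linarith
  · intro l hl
    refine (hother i l hl).trans (mul_le_mul_of_nonneg_right ?_ hε.le)
    have : 0 ≤ 2 * n * B := by positivity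
    linarith

lemma matrix_norm_le {n : ℕ} (M : Matrix (Fin n) (Fin n) ℂ) {r : ℝ} (hr : 0 ≤ r)
    (h : ∀ i j, ‖M i j‖ ≤ r) : ‖M‖ ≤ n * r := by
  rw [Matrix.linfty_opNorm_def]
  have : (Finset.univ.sup fun i => ∑ j, ‖M i j‖₊) ≤ n * r.toNNReal := by
    refine Finset.sup_le fun i _ => ?_
    have : ∑ j, ‖M i j‖₊ ≤ ∑ _j : Fin n, r.toNNReal :=
      Finset.sum_le_sum fun j _ => by
        rw [← NNReal.coe_le_coe, coe_nnnorm, Real.coe_toNNReal _ hr]; exact h i j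
    simpa using this
  have := NNReal.coe_le_coe.2 this
  simpa [Real.coe_toNNReal _ hr] using this

lemma norm_entry_le {n : ℕ} (M : Matrix (Fin n) (Fin n) ℂ) (i j : Fin n) : ‖M i j‖ ≤ ‖M‖ := by
  rw [Matrix.linfty_opNorm_def, ← coe_nnnorm, NNReal.coe_le_coe]
  refine le_trans ?_ (Finset.le_sup (f := fun i => ∑ j, ‖M i j‖₊) (Finset.mem_univ i))
  exact Finset.single_le_sum (f := fun j => ‖M i j‖₊) (fun _ _ => zero_le) (Finset.mem_univ j)

/-- If `U` is almost an isometry and `Uᴴ Λ U` is close to `M` then `Uᴴ` almost intertwines `Λ`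
and `M`. -/
lemma almost_unitary {n : ℕ} (U L M : Matrix (Fin n) (Fin n) ℂ) {a r s q : ℝ}
    (hU : ‖U‖ ≤ a) (hU' : ‖Uᴴ‖ ≤ a) (h1 : ‖Uᴴ * U - 1‖ ≤ r) (hr : r ≤ 1 / 2)
    (h2 : ‖Uᴴ * L * U - M‖ ≤ s) (hM : ‖M‖ ≤ q) :
    ‖U * Uᴴ - 1‖ ≤ 2 * a ^ 2 * r ∧
      ‖M * Uᴴ - Uᴴ * L‖ ≤ (q + s) * (2 * a) * (2 * a ^ 2 * r) + s * a := by
  have ha : 0 ≤ a := (norm_nonneg _).trans hU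
  have hr0 : 0 ≤ r := (norm_nonneg _).trans h1
  have hs0 : 0 ≤ s := (norm_nonneg _).trans h2
  have hq0 : 0 ≤ q := (norm_nonneg _).trans hM
  have hunit : IsUnit (Uᴴ * U) := by
    have : IsUnit (1 - (1 - Uᴴ * U)) := isUnit_one_sub_of_norm_lt_one (by
      rw [norm_sub_rev]; linarith)
    simpa using this
  have hUu : IsUnit U := isUnit_of_mul_isUnit_right hunit
  obtain ⟨N, huN⟩ : ∃ N, U * N = 1 := ⟨_, hUu.mul_val_inv⟩
  have hNe : N = Uᴴ - (Uᴴ * U - 1) * N := by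
    rw [sub_mul, mul_assoc, huN]; simp
  have hNn : ‖N‖ ≤ 2 * a := by
    have h3 : ‖N‖ ≤ ‖Uᴴ‖ + ‖Uᴴ * U - 1‖ * ‖N‖ := by
      conv_lhs => rw [hNe]
      exact (norm_sub_le _ _).trans (add_le_add le_rfl (norm_mul_le _ _))
    have : ‖Uᴴ * U - 1‖ * ‖N‖ ≤ 1 / 2 * ‖N‖ :=
      mul_le_mul_of_nonneg_right (h1.trans hr) (norm_nonneg _)
    linarith
  have e1 : U * Uᴴ - 1 = U * (Uᴴ * U - 1) * N := by
    rw [mul_sub, sub_mul, mul_one, ← mul_assoc, mul_assoc, huN, mul_one]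
  have b1 : ‖U * Uᴴ - 1‖ ≤ 2 * a ^ 2 * r := by
    rw [e1]
    calc ‖U * (Uᴴ * U - 1) * N‖ ≤ ‖U‖ * ‖Uᴴ * U - 1‖ * ‖N‖ :=
          (norm_mul_le _ _).trans (mul_le_mul_of_nonneg_right (norm_mul_le _ _) (norm_nonneg _))
      _ ≤ a * r * (2 * a) := by gcongr
      _ = _ := by ring
  refine ⟨b1, ?_⟩
  have e2 : M * Uᴴ - Uᴴ * L = (Uᴴ * L * U) * N * (U * Uᴴ - 1) - (Uᴴ * L * U - M) * Uᴴ := by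
    rw [mul_assoc (Uᴴ * L) U N, huN]
    noncomm_ring
  rw [e2]
  have b2 : ‖Uᴴ * L * U‖ ≤ q + s := by
    have := norm_add_le M (Uᴴ * L * U - M)
    rw [add_sub_cancel] at this
    linarith
  calc _ ≤ ‖(Uᴴ * L * U) * N * (U * Uᴴ - 1)‖ + ‖(Uᴴ * L * U - M) * Uᴴ‖ := norm_sub_le _ _
    _ ≤ ‖Uᴴ * L * U‖ * ‖N‖ * ‖U * Uᴴ - 1‖ + ‖Uᴴ * L * U - M‖ * ‖Uᴴ‖ :=
      add_le_add ((norm_mul_le _ _).trans (mul_le_mul_of_nonneg_right (norm_mul_le _ _)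
        (norm_nonneg _))) (norm_mul_le _ _)
    _ ≤ _ := by gcongr

/-- The compression of a self-adjoint relation to its low-lying eigenvectors `ψ i`, tested on
vectors `α k` which are almost mapped to zero. -/
lemma compression_estimates {n : ℕ} {H : Type*} [NormedAddCommGroup H] [InnerProductSpace ℂ H]
    {G : Submodule ℂ (H × H)} (hG : IsSelfAdjointRel G) {K κ δ : ℝ} {ψ : Fin n → H} {e : Fin n → ℝ}
    (hκ : 0 < κ) (hκK : κ ≤ K) (hψ : IsEigenFamily G K ψ e)
    (hlow : ∀ p ∈ G, (∀ i, ⟪ψ i, p.1⟫_ℂ = 0) → K * ‖p.1‖ ≤ ‖p.2‖)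
    {α a : Fin n → H} (hα : ∀ k, (α k, a k) ∈ G) (ha : ∀ k, ‖a k‖ ≤ δ) :
    (∀ k, ‖α k - ∑ i, ⟪ψ i, α k⟫_ℂ • ψ i‖ ≤ δ / κ) ∧
    (∀ j k, ‖⟪α j, α k⟫_ℂ - ∑ i, conj ⟪ψ i, α j⟫_ℂ * ⟪ψ i, α k⟫_ℂ‖ ≤ (δ / κ) ^ 2) ∧
    ∀ j k, ‖⟪α j, a k⟫_ℂ - ∑ i, conj ⟪ψ i, α j⟫_ℂ * e i * ⟪ψ i, α k⟫_ℂ‖ ≤ δ ^ 2 / κ := by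
  set β : Fin n → H := fun k => α k - ∑ i, ⟪ψ i, α k⟫_ℂ • ψ i with hβ
  set b : Fin n → H := fun k => a k - ∑ i, ⟪ψ i, α k⟫_ℂ • (e i : ℂ) • ψ i with hb
  have hβb : ∀ k, (β k, b k) ∈ G := fun k => G.sub_mem (hα k) (sum_smul_mem_rel hψ.mem _)
  have hβψ : ∀ k i, ⟪ψ i, β k⟫_ℂ = 0 := by
    intro k i
    simp only [hβ]
    rw [inner_sub_right, hψ.orthonormal.inner_right_fintype, sub_self]
  have hae : ∀ k i, ⟪ψ i, a k⟫_ℂ = e i * ⟪ψ i, α k⟫_ℂ := by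
    intro k i
    rw [← hG.symm _ (hψ.mem i) _ (hα k)]
    simp
  have hbψ : ∀ k i, ⟪ψ i, b k⟫_ℂ = 0 := by
    intro k i
    simp only [hb, smul_smul]
    rw [inner_sub_right, hψ.orthonormal.inner_right_fintype, hae, mul_comm, sub_self]
  have hbn : ∀ k, ‖b k‖ ≤ δ := by
    intro k
    refine le_trans ?_ (ha k)
    have h0 : ⟪∑ i, ⟪ψ i, α k⟫_ℂ • (e i : ℂ) • ψ i, b k⟫_ℂ = 0 := by
      rw [sum_inner]
      refine Finset.sum_eq_zero fun i _ => ?_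
      rw [inner_smul_left, inner_smul_left, hbψ]; simp
    have h6 := norm_add_sq_eq_norm_sq_add_norm_sq_of_inner_eq_zero _ _ h0
    have h7 : ∑ i, ⟪ψ i, α k⟫_ℂ • (e i : ℂ) • ψ i + b k = a k := by simp [hb]
    rw [h7] at h6
    by_contra! hcon
    nlinarith [norm_nonneg (a k), norm_nonneg (∑ i, ⟪ψ i, α k⟫_ℂ • (e i : ℂ) • ψ i)]
  have hβn : ∀ k, ‖β k‖ ≤ δ / κ := by
    intro k
    have h6 := hlow _ (hβb k) (hβψ k)
    have h7 : κ * ‖β k‖ ≤ δ :=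
      (mul_le_mul_of_nonneg_right hκK (norm_nonneg _)).trans (h6.trans (hbn k))
    rw [le_div_iff₀ hκ]
    linarith
  have hzero : ∀ j (z : Fin n → ℂ), ⟪β j, ∑ i, z i • ψ i⟫_ℂ = 0 := by
    intro j z
    rw [inner_sum]
    refine Finset.sum_eq_zero fun i _ => ?_
    rw [inner_smul_right, inner_eq_zero_symm.1 (hβψ j i), mul_zero]
  have hsplit : ∀ j (x : H), ⟪α j, x⟫_ℂ = ∑ i, conj ⟪ψ i, α j⟫_ℂ * ⟪ψ i, x⟫_ℂ + ⟪β j, x⟫_ℂ := by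
    intro j x
    have h7 : α j = ∑ i, ⟪ψ i, α j⟫_ℂ • ψ i + β j := by simp [hβ]
    conv_lhs => rw [h7]
    rw [inner_add_left, sum_inner]
    simp_rw [inner_smul_left]
  have h1 : ∀ j k, ⟪β j, α k⟫_ℂ = ⟪β j, β k⟫_ℂ := by
    intro j k
    have h7 : α k = ∑ i, ⟪ψ i, α k⟫_ℂ • ψ i + β k := by simp [hβ]
    conv_lhs => rw [h7]
    rw [inner_add_right, hzero, zero_add]
  have h2 : ∀ j k, ⟪β j, a k⟫_ℂ = ⟪β j, b k⟫_ℂ := by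
    intro j k
    have h7 : a k = ∑ i, (⟪ψ i, α k⟫_ℂ * e i) • ψ i + b k := by
      simp only [hb, mul_smul, add_sub_cancel]
    conv_lhs => rw [h7]
    rw [inner_add_right, hzero, zero_add]
  have hδ : ∀ k : Fin n, 0 ≤ δ := fun k => (norm_nonneg _).trans (ha k)
  refine ⟨hβn, fun j k => ?_, fun j k => ?_⟩
  · rw [hsplit j (α k), h1, add_sub_cancel_left, pow_two]
    have := hδ j
    exact (norm_inner_le_norm (𝕜 := ℂ) (β j) (β k)).trans
      (mul_le_mul (hβn j) (hβn k) (norm_nonneg _) (by positivity))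
  · have h3 : ∑ i, conj ⟪ψ i, α j⟫_ℂ * e i * ⟪ψ i, α k⟫_ℂ =
        ∑ i, conj ⟪ψ i, α j⟫_ℂ * ⟪ψ i, a k⟫_ℂ :=
      Finset.sum_congr rfl fun i _ => by rw [hae, mul_assoc]
    rw [hsplit j (a k), h3, add_sub_cancel_left, h2]
    have := hδ j
    refine (norm_inner_le_norm (𝕜 := ℂ) (β j) (b k)).trans
      ((mul_le_mul (hβn j) (hbn k) (norm_nonneg _) (by positivity)).trans (le_of_eq ?_))
    ring

/-- The almost unitary matrix relating the vectors `α k` and the eigenvectors `ψ i`. -/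
lemma transition_estimates {n : ℕ} {H : Type*} [NormedAddCommGroup H] [InnerProductSpace ℂ H]
    {G : Submodule ℂ (H × H)} (hG : IsSelfAdjointRel G) {K κ A ε : ℝ} {ψ : Fin n → H}
    {e : Fin n → ℝ} (hκ : 0 < κ) (hκK : κ ≤ K) (hψ : IsEigenFamily G K ψ e)
    (hlow : ∀ p ∈ G, (∀ i, ⟪ψ i, p.1⟫_ℂ = 0) → K * ‖p.1‖ ≤ ‖p.2‖)
    {α a : Fin n → H} (hα : ∀ k, (α k, a k) ∈ G) (hαn : ∀ k, ‖α k‖ ≤ 2)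
    (J : Matrix (Fin n) (Fin n) ℂ) (hA : 0 ≤ A) (hε : 0 < ε) (hε1 : ε ≤ 1)
    (hr : n * (A + (A / κ) ^ 2) * ε ≤ 1 / 2)
    (hgram : ∀ j k, ‖⟪α j, α k⟫_ℂ - if j = k then 1 else 0‖ ≤ A * ε) (ha : ∀ k, ‖a k‖ ≤ A * ε)
    (hmat : ∀ j k, ‖⟪α j, a k⟫_ℂ - ε * J j k‖ ≤ A * ε ^ 2)
    {U : Matrix (Fin n) (Fin n) ℂ} (hU : ∀ i k, U i k = ⟪ψ i, α k⟫_ℂ) {A₁ B₁ : ℝ}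
    (hA₁ : A₁ = 2 * (n * 2) ^ 2 * (n * (A + (A / κ) ^ 2)))
    (hB₁ : B₁ = (‖J‖ + n * (A + A ^ 2 / κ)) * (2 * (n * 2)) * A₁
      + n * (A + A ^ 2 / κ) * (n * 2)) :
    ‖U * Uᴴ - 1‖ ≤ A₁ * ε ∧
      ‖(ε : ℂ) • J * Uᴴ - Uᴴ * Matrix.diagonal (fun i => (e i : ℂ))‖ ≤ B₁ * ε ^ 2 := by
  have hε2 : ε ^ 2 ≤ ε := by nlinarith
  obtain ⟨-, e1, e2⟩ := compression_estimates hG hκ hκK hψ hlow hα ha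
  have hUU : ‖Uᴴ * U - 1‖ ≤ n * (A + (A / κ) ^ 2) * ε := by
    rw [mul_assoc]
    refine matrix_norm_le _ (by positivity) fun j k => ?_
    have h7 : (Uᴴ * U - 1) j k = (⟪α j, α k⟫_ℂ - if j = k then 1 else 0) -
        (⟪α j, α k⟫_ℂ - ∑ i, conj ⟪ψ i, α j⟫_ℂ * ⟪ψ i, α k⟫_ℂ) := by
      rw [Matrix.sub_apply, Matrix.mul_apply, Matrix.one_apply]
      simp only [Matrix.conjTranspose_apply, hU, RCLike.star_def]
      ring
    rw [h7]
    refine (norm_sub_le _ _).trans ?_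
    have h8 := e1 j k
    have h9 : (A * ε / κ) ^ 2 = (A / κ) ^ 2 * ε ^ 2 := by ring
    rw [h9] at h8
    nlinarith [hgram j k, mul_le_mul_of_nonneg_left hε2 (sq_nonneg (A / κ))]
  have hULU : ‖Uᴴ * Matrix.diagonal (fun i => (e i : ℂ)) * U - (ε : ℂ) • J‖ ≤
      n * (A + A ^ 2 / κ) * ε ^ 2 := by
    rw [mul_assoc (n : ℝ)]
    refine matrix_norm_le _ (by positivity) fun j k => ?_
    have h7 : (Uᴴ * Matrix.diagonal (fun i => (e i : ℂ)) * U - (ε : ℂ) • J) j k =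
        (⟪α j, a k⟫_ℂ - ε * J j k) -
          (⟪α j, a k⟫_ℂ - ∑ i, conj ⟪ψ i, α j⟫_ℂ * e i * ⟪ψ i, α k⟫_ℂ) := by
      rw [Matrix.sub_apply, Matrix.mul_apply]
      simp only [Matrix.conjTranspose_apply, Matrix.mul_diagonal, hU, RCLike.star_def,
        Matrix.smul_apply, smul_eq_mul]
      ring
    rw [h7]
    refine (norm_sub_le _ _).trans ?_
    have h8 := e2 j k
    have h9 : (A * ε) ^ 2 / κ = A ^ 2 / κ * ε ^ 2 := by ring
    rw [h9] at h8
    linarith [hmat j k]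
  have hUent : ∀ i k, ‖U i k‖ ≤ 2 := by
    intro i k
    rw [hU]
    refine (norm_inner_le_norm _ _).trans ?_
    rw [hψ.orthonormal.1 i, one_mul]
    exact hαn k
  have hUn : ‖U‖ ≤ n * 2 := matrix_norm_le _ (by norm_num) hUent
  have hUn' : ‖Uᴴ‖ ≤ n * 2 := matrix_norm_le _ (by norm_num) fun i k => by
    rw [Matrix.conjTranspose_apply, norm_star]; exact hUent k i
  have hMn : ‖(ε : ℂ) • J‖ ≤ ‖J‖ * ε := by
    refine (norm_smul_le _ _).trans ?_
    rw [Complex.norm_real, Real.norm_eq_abs, abs_of_pos hε, mul_comm]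
  obtain ⟨b1, b2⟩ := almost_unitary U _ _ hUn hUn' hUU hr hULU hMn
  refine ⟨b1.trans (le_of_eq (by rw [hA₁]; ring)), b2.trans ?_⟩
  set s₁ := n * (A + A ^ 2 / κ)
  set r₁ := n * (A + (A / κ) ^ 2)
  have hs₁ : 0 ≤ s₁ := by positivity
  have hr₁ : 0 ≤ r₁ := by positivity
  have : (‖J‖ * ε + s₁ * ε ^ 2) * (2 * (n * 2)) * (2 * (n * 2) ^ 2 * (r₁ * ε)) ≤
      (‖J‖ * ε + s₁ * ε) * (2 * (n * 2)) * (2 * (n * 2) ^ 2 * (r₁ * ε)) := by gcongr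
  refine (add_le_add_left this _).trans (le_of_eq ?_)
  rw [hB₁, hA₁]; ring

/-- First order perturbation theory: if the vectors `α k` almost span the low-lying eigenvectors
`ψ i` of a self-adjoint relation, with matrix elements `ε J` up to `O(ε²)`, then the eigenvalues
are those of `ε J` up to `O(ε²)` and the eigenvectors are given by those of `J` up to `O(ε)`. -/
theorem exists_perturbation {n : ℕ} (hn : 1 ≤ n) {J : Matrix (Fin n) (Fin n) ℂ}
    (hJ : J.IsHermitian) {μ : Fin n → ℝ} {g : ℝ} (hg : 0 < g)
    (hμ : ∀ l l', l ≠ l' → g ≤ |μ l - μ l'|)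
    (v : OrthonormalBasis (Fin n) ℂ (EuclideanSpace ℂ (Fin n)))
    (hv : ∀ l, J *ᵥ (v l).ofLp = (μ l : ℂ) • (v l).ofLp) {A κ : ℝ} (hA : 0 ≤ A) (hκ : 0 < κ) :
    ∃ C ε₀ : ℝ, 0 ≤ C ∧ 0 < ε₀ ∧ ∀ {H : Type} [NormedAddCommGroup H] [InnerProductSpace ℂ H]
      (G : Submodule ℂ (H × H)), IsSelfAdjointRel G →
      ∀ ε, 0 < ε → ε < ε₀ → ∀ (K : ℝ) (ψ : Fin n → H) (e : Fin n → ℝ), κ ≤ K →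
      IsEigenFamily G K ψ e → (∀ p ∈ G, (∀ i, ⟪ψ i, p.1⟫_ℂ = 0) → K * ‖p.1‖ ≤ ‖p.2‖) →
      ∀ α a : Fin n → H, (∀ k, (α k, a k) ∈ G) → (∀ k, ‖α k‖ ≤ 2) →
      (∀ j k, ‖⟪α j, α k⟫_ℂ - if j = k then 1 else 0‖ ≤ A * ε) → (∀ k, ‖a k‖ ≤ A * ε) →
      (∀ j k, ‖⟪α j, a k⟫_ℂ - ε * J j k‖ ≤ A * ε ^ 2) →
      ∃ σ : Equiv.Perm (Fin n), ∀ l, |e (σ l) - ε * μ l| ≤ C * ε ^ 2 ∧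
        ∃ u : ℂ, ‖u‖ = 1 ∧ ‖ψ (σ l) - ∑ k, (u * v l k) • α k‖ ≤ C * ε := by
  have hN : (1 : ℝ) ≤ n := by exact_mod_cast hn
  set r₁ : ℝ := n * (A + (A / κ) ^ 2) with hr₁
  obtain ⟨A₁, hA₁⟩ : ∃ A₁ : ℝ, A₁ = 2 * (n * 2) ^ 2 * r₁ := ⟨_, rfl⟩
  obtain ⟨B₁, hB₁⟩ : ∃ B₁ : ℝ, B₁ = (‖J‖ + n * (A + A ^ 2 / κ)) * (2 * (n * 2)) * A₁
      + n * (A + A ^ 2 / κ) * (n * 2) := ⟨_, rfl⟩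
  have hr₁0 : 0 ≤ r₁ := by positivity
  have hA₁0 : 0 ≤ A₁ := by rw [hA₁]; positivity
  have hB₁0 : 0 ≤ B₁ := by rw [hB₁]; positivity
  obtain ⟨C₀, ε₁, hC₀, hε₁, hmatch⟩ := exists_matching hn hg hμ hA₁0 (B := n * B₁) (by positivity)
  refine ⟨C₀ + n * A₁ + n * (2 * (A / κ)) + n * ((n + 1) * C₀ * 2),
    min 1 (min ε₁ (min (1 / (2 * (r₁ + 1))) (1 / (2 * (C₀ + 1))))),
    by positivity, by positivity, ?_⟩
  intro H _ _ G hG ε hε hlt K ψ e hκK hψ hlow α a hα hαn hgram ha hmat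
  simp only [lt_min_iff] at hlt
  obtain ⟨h1, h2, h3, h5⟩ := hlt
  rw [lt_div_iff₀ (by positivity)] at h3 h5
  set U : Matrix (Fin n) (Fin n) ℂ := Matrix.of fun i k => ⟪ψ i, α k⟫_ℂ with hU
  have hUik : ∀ i k, U i k = ⟪ψ i, α k⟫_ℂ := fun i k => rfl
  obtain ⟨b1, b2⟩ := transition_estimates hG hκ hκK hψ hlow hα hαn J hA hε h1.le
    (by nlinarith) hgram ha hmat hUik hA₁ hB₁
  obtain ⟨hβn, -, -⟩ := compression_estimates hG hκ hκK hψ hlow hα ha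
  clear_value U
  have hU2 : ∀ i k, ‖U i k‖ ≤ 2 := by
    intro i k
    rw [hUik]
    refine (norm_inner_le_norm _ _).trans ?_
    rw [hψ.orthonormal.1 i, one_mul]
    exact hαn k
  have hv1 : ∀ l k, ‖v l k‖ ≤ 1 := fun l k => by
    have := PiLp.norm_apply_le (v l) k
    rwa [v.orthonormal.1 l] at this
  set b : Fin n → EuclideanSpace ℂ (Fin n) := fun i => WithLp.toLp 2 fun k => Uᴴ k i with hb
  set c : Fin n → Fin n → ℂ := fun i l => ⟪v l, b i⟫_ℂ with hc
  have hc1 : ∀ i j, ‖∑ l, conj (c i l) * c j l - if i = j then 1 else 0‖ ≤ A₁ * ε := by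
    intro i j
    have e1 : ∑ l, conj (c i l) * c j l = (U * Uᴴ) i j := by
      simp only [hc, inner_conj_symm]
      rw [v.sum_inner_mul_inner, PiLp.inner_apply, Matrix.mul_apply]
      refine Finset.sum_congr rfl fun k _ => ?_
      simp [hb, mul_comm]
    rw [e1, ← Matrix.one_apply, ← Matrix.sub_apply]
    exact (norm_entry_le _ _ _).trans b1
  have hc2 : ∀ i l, |ε * μ l - e i| * ‖c i l‖ ≤ n * B₁ * ε ^ 2 := by
    intro i l
    set x : Fin n → ℂ := fun k => Uᴴ k i with hx
    set w : Fin n → ℂ := (v l).ofLp with hw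
    have hcx : c i l = star w ⬝ᵥ x := by
      simp [hc, hb, PiLp.inner_apply, dotProduct, hx, hw, mul_comm]
    have hJx : star w ⬝ᵥ (J *ᵥ x) = μ l * c i l := by
      rw [Matrix.dotProduct_mulVec]
      have : star w ᵥ* J = (μ l : ℂ) • star w := by
        have h6 := congrArg star (hv l)
        rw [Matrix.star_mulVec, hJ.eq, star_smul] at h6
        simpa using h6
      rw [this, smul_dotProduct, hcx, smul_eq_mul]
    have hD : ∀ k, ((ε : ℂ) • J * Uᴴ - Uᴴ * Matrix.diagonal (fun i => (e i : ℂ))) k i =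
        ε * (J *ᵥ x) k - x k * e i := by
      intro k
      rw [Matrix.sub_apply, Matrix.mul_diagonal, Matrix.smul_mul, Matrix.smul_apply,
        smul_eq_mul]
      rfl
    have hsum : ((ε * μ l - e i : ℝ) : ℂ) * c i l = ∑ k, star (w k) *
        ((ε : ℂ) • J * Uᴴ - Uᴴ * Matrix.diagonal (fun i => (e i : ℂ))) k i := by
      simp_rw [hD, mul_sub, Finset.sum_sub_distrib]
      have t1 : ∑ k, star (w k) * (ε * (J *ᵥ x) k) = ε * (μ l * c i l) := by
        rw [← hJx, dotProduct, Finset.mul_sum]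
        exact Finset.sum_congr rfl fun k _ => by rw [Pi.star_apply]; ring
      have t2 : ∑ k, star (w k) * (x k * e i) = e i * c i l := by
        rw [hcx, dotProduct, Finset.mul_sum]
        exact Finset.sum_congr rfl fun k _ => by rw [Pi.star_apply]; ring
      rw [t1, t2]; push_cast; ring
    rw [← Real.norm_eq_abs, ← Complex.norm_real, ← norm_mul, hsum]
    refine (norm_sum_le _ _).trans ?_
    have : ∑ k, ‖star (w k) *
        ((ε : ℂ) • J * Uᴴ - Uᴴ * Matrix.diagonal (fun i => (e i : ℂ))) k i‖ ≤
        ∑ _k : Fin n, B₁ * ε ^ 2 := by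
      refine Finset.sum_le_sum fun k _ => ?_
      rw [norm_mul, norm_star]
      have := mul_le_mul (hv1 l k) ((norm_entry_le _ k i).trans b2) (norm_nonneg _) zero_le_one
      rwa [one_mul] at this
    refine this.trans (le_of_eq ?_)
    rw [Finset.sum_const, Finset.card_univ, Fintype.card_fin, nsmul_eq_mul, mul_assoc]
  obtain ⟨σ, hσ⟩ := hmatch ε hε h2 e c hc1 hc2
  refine ⟨σ.symm, fun l => ?_⟩
  obtain ⟨m1, m2, m3⟩ := hσ (σ.symm l)
  rw [Equiv.apply_symm_apply] at m1 m2 m3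
  set i := σ.symm l with hi
  refine ⟨m1.trans (mul_le_mul_of_nonneg_right ?_ (by positivity)), ?_⟩
  · have : 0 ≤ n * A₁ + n * (2 * (A / κ)) + n * ((n + 1) * C₀ * 2) := by positivity
    linarith
  have hcpos : 0 < ‖c i l‖ := by
    have := (abs_le.1 m2).1
    nlinarith
  refine ⟨c i l / ‖c i l‖, by simp [hcpos.ne'], ?_⟩
  set u : ℂ := c i l / ‖c i l‖ with hu
  have hcu : ‖c i l - u‖ ≤ C₀ * ε := by
    have hne : ((‖c i l‖ : ℝ) : ℂ) ≠ 0 := by exact_mod_cast hcpos.ne'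
    have : c i l - u = u * ((‖c i l‖ - 1 : ℝ) : ℂ) := by
      rw [hu]; push_cast; field_simp
    rw [this, norm_mul, Complex.norm_real, Real.norm_eq_abs]
    have : ‖u‖ = 1 := by simp [hu, hcpos.ne']
    rw [this, one_mul]
    exact m2
  have hbk : ∀ k, ‖Uᴴ k i - u * v l k‖ ≤ (n + 1) * C₀ * ε := by
    intro k
    have h6 : Uᴴ k i = ∑ l', c i l' * v l' k := by
      have h7 := congrArg (fun y : EuclideanSpace ℂ (Fin n) => y k) (v.sum_repr' (b i))
      simpa [hb, hc] using h7.symm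
    have h7 : Uᴴ k i - u * v l k = (c i l - u) * v l k +
        ∑ l' ∈ Finset.univ.erase l, c i l' * v l' k := by
      rw [h6, ← Finset.add_sum_erase _ _ (Finset.mem_univ l)]; ring
    have h8 : ‖∑ l' ∈ Finset.univ.erase l, c i l' * v l' k‖ ≤ n * (C₀ * ε) := by
      refine (norm_sum_le _ _).trans ?_
      have : ∑ l' ∈ Finset.univ.erase l, ‖c i l' * v l' k‖ ≤
          ∑ _l' ∈ Finset.univ.erase l, C₀ * ε := by
        refine Finset.sum_le_sum fun l' hl' => ?_
        rw [norm_mul]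
        have := mul_le_mul (m3 l' (Finset.mem_erase.1 hl').1) (hv1 l' k) (norm_nonneg _)
          (by positivity)
        rwa [mul_one] at this
      refine this.trans ?_
      rw [Finset.sum_const, nsmul_eq_mul]
      refine mul_le_mul_of_nonneg_right ?_ (by positivity)
      have := Finset.card_erase_le (s := (Finset.univ : Finset (Fin n))) (a := l)
      rw [Finset.card_univ, Fintype.card_fin] at this
      exact_mod_cast this
    have h9 : ‖(c i l - u) * v l k‖ ≤ C₀ * ε := by
      rw [norm_mul]
      have := mul_le_mul hcu (hv1 l k) (norm_nonneg _) (by positivity)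
      rwa [mul_one] at this
    rw [h7]
    refine (norm_add_le _ _).trans ?_
    linarith
  have hdec : ψ i - ∑ k, (u * v l k) • α k = -(∑ j, (U * Uᴴ - 1) j i • ψ j) -
      ∑ k, Uᴴ k i • (α k - ∑ j, ⟪ψ j, α k⟫_ℂ • ψ j) + ∑ k, (Uᴴ k i - u * v l k) • α k := by
    have t1 : ∑ j, (U * Uᴴ - 1) j i • ψ j = ∑ k, Uᴴ k i • ∑ j, ⟪ψ j, α k⟫_ℂ • ψ j - ψ i := by
      simp_rw [Matrix.sub_apply, sub_smul, Finset.sum_sub_distrib]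
      congr 1
      · simp_rw [Matrix.mul_apply, Finset.sum_smul, Finset.smul_sum, smul_smul]
        rw [Finset.sum_comm]
        refine Finset.sum_congr rfl fun k _ => Finset.sum_congr rfl fun j _ => ?_
        rw [hUik, mul_comm]
      · simp [Matrix.one_apply]
    rw [t1]
    simp_rw [smul_sub, sub_smul, Finset.sum_sub_distrib]
    abel
  have d1 : ‖∑ j, (U * Uᴴ - 1) j i • ψ j‖ ≤ n * A₁ * ε := by
    refine (norm_sum_le _ _).trans ?_
    have : ∑ j, ‖(U * Uᴴ - 1) j i • ψ j‖ ≤ ∑ _j : Fin n, A₁ * ε := by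
      refine Finset.sum_le_sum fun j _ => ?_
      rw [norm_smul, hψ.orthonormal.1 j, mul_one]
      exact (norm_entry_le _ j i).trans b1
    refine this.trans (le_of_eq ?_)
    rw [Finset.sum_const, Finset.card_univ, Fintype.card_fin, nsmul_eq_mul, mul_assoc]
  have d2 : ‖∑ k, Uᴴ k i • (α k - ∑ j, ⟪ψ j, α k⟫_ℂ • ψ j)‖ ≤ n * (2 * (A / κ)) * ε := by
    refine (norm_sum_le _ _).trans ?_
    have : ∑ k, ‖Uᴴ k i • (α k - ∑ j, ⟪ψ j, α k⟫_ℂ • ψ j)‖ ≤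
        ∑ _k : Fin n, 2 * (A * ε / κ) := by
      refine Finset.sum_le_sum fun k _ => ?_
      rw [norm_smul, Matrix.conjTranspose_apply, norm_star]
      exact mul_le_mul (hU2 i k) (hβn k) (norm_nonneg _) (by norm_num)
    refine this.trans (le_of_eq ?_)
    rw [Finset.sum_const, Finset.card_univ, Fintype.card_fin, nsmul_eq_mul]
    ring
  have d3 : ‖∑ k, (Uᴴ k i - u * v l k) • α k‖ ≤ n * ((n + 1) * C₀ * 2) * ε := by
    refine (norm_sum_le _ _).trans ?_
    have : ∑ k, ‖(Uᴴ k i - u * v l k) • α k‖ ≤ ∑ _k : Fin n, (n + 1) * C₀ * ε * 2 := by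
      refine Finset.sum_le_sum fun k _ => ?_
      rw [norm_smul]
      exact mul_le_mul (hbk k) (hαn k) (norm_nonneg _) (by positivity)
    refine this.trans (le_of_eq ?_)
    rw [Finset.sum_const, Finset.card_univ, Fintype.card_fin, nsmul_eq_mul]
    ring
  rw [hdec]
  have f1 := norm_add_le (-(∑ j, (U * Uᴴ - 1) j i • ψ j) -
      ∑ k, Uᴴ k i • (α k - ∑ j, ⟪ψ j, α k⟫_ℂ • ψ j)) (∑ k, (Uᴴ k i - u * v l k) • α k)
  have f2 := norm_sub_le (-(∑ j, (U * Uᴴ - 1) j i • ψ j))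
      (∑ k, Uᴴ k i • (α k - ∑ j, ⟪ψ j, α k⟫_ℂ • ψ j))
  rw [norm_neg] at f2
  have : 0 ≤ C₀ * ε := by positivity
  linarith


end Perturbation

section Sobolev

open Filter Topology
open scoped InnerProductSpace ComplexConjugate Convolution

/-- Translation `f ↦ f (· + s)` on `L²`. -/
def translate (s : ℝ) : SpinorL2 →ₗᵢ[ℂ] SpinorL2 :=
  Lp.compMeasurePreservingₗᵢ ℂ (· + s) (measurePreserving_add_right volume s)

lemma translate_coe (s : ℝ) (f : SpinorL2) : translate s f =ᵐ[volume] fun x => f (x + s) :=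
  Lp.coeFn_compMeasurePreserving f (measurePreserving_add_right volume s)

lemma translate_translate (s t : ℝ) (f : SpinorL2) :
    translate s (translate t f) = translate (s + t) f := by
  apply Lp.ext
  have h := (measurePreserving_add_right (volume : Measure ℝ) s).quasiMeasurePreserving.ae_eq
    (translate_coe t f)
  filter_upwards [translate_coe s (translate t f), translate_coe (s + t) f, h] with x h1 h2 h3
  simp only [Function.comp_def] at h3
  rw [h1, h2, h3, add_assoc]

lemma translate_zero (f : SpinorL2) : translate 0 f = f := by
  apply Lp.ext
  filter_upwards [translate_coe 0 f] with x hx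
  rw [hx, add_zero]

lemma continuous_translate (f : SpinorL2) : Continuous fun s => translate s f := by
  let g : C(ℝ, C(ℝ, ℝ)) := ContinuousMap.curry ⟨fun p : ℝ × ℝ => p.2 + p.1, by fun_prop⟩
  exact Continuous.compMeasurePreservingLp (f := fun _ => f) (g := g) continuous_const
    g.continuous (fun s => measurePreserving_add_right volume s) (by norm_num)

lemma inner_translate (s : ℝ) (f g : SpinorL2) : ⟪translate s f, g⟫_ℂ = ⟪f, translate (-s) g⟫_ℂ := by
  rw [← (translate (-s)).inner_map_map, translate_translate, neg_add_cancel, translate_zero]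

lemma memLp_test {φ : ℝ → ℝ} (hφ : Continuous φ) (hc : HasCompactSupport φ) (e : Spinor) :
    MemLp (fun x => φ x • e) 2 (volume : Measure ℝ) :=
  Continuous.memLp_of_hasCompactSupport (by fun_prop) (hc.smul_right (f' := fun _ => e))

/-- The element `x ↦ φ x • e` of `L²`. -/
def testVec {φ : ℝ → ℝ} (hφ : Continuous φ) (hc : HasCompactSupport φ) (e : Spinor) : SpinorL2 :=
  (memLp_test hφ hc e).toLp _

lemma inner_testVec {φ : ℝ → ℝ} (hφ : Continuous φ) (hc : HasCompactSupport φ) (e : Spinor)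
    (f : SpinorL2) : ⟪testVec hφ hc e, f⟫_ℂ = ⟪e, ∫ x, φ x • f x⟫_ℂ := by
  rw [L2.inner_def, ← integral_inner (integrable_test f hφ hc)]
  refine integral_congr_ae ?_
  filter_upwards [(memLp_test hφ hc e).coeFn_toLp] with x hx
  rw [testVec, hx, inner_smul_left_eq_smul, inner_smul_right_eq_smul]

lemma ext_testVec {f g : SpinorL2} (h : ∀ (φ : ℝ → ℝ) (hφ : ContDiff ℝ ∞ φ)
    (hc : HasCompactSupport φ) (e : Spinor),
    ⟪testVec hφ.continuous hc e, f⟫_ℂ = ⟪testVec hφ.continuous hc e, g⟫_ℂ) : f = g := by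
  apply Lp.ext
  refine ae_eq_of_integral_contDiff_smul_eq ((Lp.memLp f).locallyIntegrable (by norm_num))
    ((Lp.memLp g).locallyIntegrable (by norm_num)) fun φ hφ hc => ?_
  refine ext_inner_left ℂ fun e => ?_
  rw [← inner_testVec hφ.continuous hc, ← inner_testVec hφ.continuous hc]
  exact h φ hφ hc e

lemma isWeakDeriv_of_inner {f g : SpinorL2} (h : ∀ (φ : ℝ → ℝ) (hφ : ContDiff ℝ ∞ φ)
    (hc : HasCompactSupport φ) (e : Spinor), ⟪testVec (continuous_deriv_test hφ) hc.deriv e, f⟫_ℂ =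
      -⟪testVec hφ.continuous hc e, g⟫_ℂ) : IsWeakDeriv f g := by
  intro φ hφ hc
  refine ext_inner_left ℂ fun e => ?_
  rw [inner_neg_right, ← inner_testVec hφ.continuous hc,
    ← inner_testVec (continuous_deriv_test hφ) hc.deriv]
  exact h φ hφ hc e

lemma integral_test_translate (φ : ℝ → ℝ) (f : SpinorL2) (s : ℝ) :
    ∫ x, φ x • translate s f x = ((fun t => φ (-t)) ⋆[ContinuousLinearMap.lsmul ℝ ℝ, volume] f) s := by
  rw [convolution_def, ← integral_neg_eq_self]
  have h : ∀ᵐ x : ℝ, translate s f (-x) = f (-x + s) :=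
    (Measure.measurePreserving_neg (volume : Measure ℝ)).quasiMeasurePreserving.ae
      (translate_coe s f)
  refine integral_congr_ae ?_
  filter_upwards [h] with x hx
  rw [hx, ContinuousLinearMap.lsmul_apply, neg_add_eq_sub]

lemma IsWeakDeriv.hasDerivAt_test {f g : SpinorL2} (h : IsWeakDeriv f g) {φ : ℝ → ℝ}
    (hφ : ContDiff ℝ ∞ φ) (hc : HasCompactSupport φ) (s : ℝ) :
    HasDerivAt (fun s => ∫ x, φ x • translate s f x) (∫ x, φ x • translate s g x) s := by
  have hφ' : ContDiff ℝ ∞ fun t => φ (-t) := hφ.comp contDiff_neg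
  have hc' : HasCompactSupport fun t => φ (-t) := hc.comp_homeomorph (Homeomorph.neg ℝ)
  have hd := hc'.hasDerivAt_convolution_left (ContinuousLinearMap.lsmul ℝ ℝ)
    (hφ'.of_le (by simp)) ((Lp.memLp f).locallyIntegrable (μ := volume) (by norm_num)) s
  simp_rw [integral_test_translate φ f]
  convert! hd using 1
  have hψ : ContDiff ℝ ∞ fun x => φ (x - s) := hφ.comp (contDiff_id.sub contDiff_const)
  have hψc : HasCompactSupport fun x => φ (x - s) :=
    hc.comp_homeomorph (Homeomorph.subRight s)
  have key := h _ hψ hψc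
  have e1 : ∫ x, φ x • translate s g x = ∫ x, φ (x - s) • g x := by
    rw [← integral_add_right_eq_self (fun x => φ (x - s) • g x) s]
    refine integral_congr_ae ?_
    filter_upwards [translate_coe s g] with x hx
    rw [hx, add_sub_cancel_right]
  rw [e1, ← neg_eq_iff_eq_neg.2 key, ← integral_neg, convolution_def,
    ← integral_sub_left_eq_self (fun x => -(deriv (fun y => φ (y - s)) x • f x)) volume s]
  refine integral_congr_ae (Eventually.of_forall fun t => ?_)
  simp only [ContinuousLinearMap.lsmul_apply]
  rw [deriv_comp_neg, deriv_comp_sub_const, neg_smul]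
  congr 3
  ring

/-- Difference quotients of an `H¹` function converge in `L²` to the weak derivative. -/
lemma IsWeakDeriv.hasDerivAt_translate {f g : SpinorL2} (h : IsWeakDeriv f g) :
    HasDerivAt (fun s => translate s f) g 0 := by
  have key : ∀ s, translate s f = (∫ t in (0 : ℝ)..s, translate t g) + f := by
    intro s
    refine eq_add_of_sub_eq (ext_testVec fun φ hφ hc e => ?_)
    have hd : ∀ t, HasDerivAt (fun t => ⟪testVec hφ.continuous hc e, translate t f⟫_ℂ)
        ⟪testVec hφ.continuous hc e, translate t g⟫_ℂ t := by
      intro t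
      simp_rw [inner_testVec]
      exact ((innerSL ℂ e).restrictScalars ℝ).hasFDerivAt.comp_hasDerivAt t
        (h.hasDerivAt_test hφ hc t)
    have hcont : Continuous fun t => ⟪testVec hφ.continuous hc e, translate t g⟫_ℂ :=
      continuous_const.inner (continuous_translate g)
    have h1 := intervalIntegral.integral_eq_sub_of_hasDerivAt (a := 0) (b := s)
      (fun t _ => hd t) (hcont.intervalIntegrable _ _)
    rw [translate_zero, ← inner_sub_right] at h1
    rw [← h1]
    exact ((innerSL ℂ (testVec hφ.continuous hc e)).restrictScalars ℝ).intervalIntegral_comp_comm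
      ((continuous_translate g).intervalIntegrable _ _)
  have hd := intervalIntegral.integral_hasDerivAt_right (a := 0) (b := 0)
    ((continuous_translate g).intervalIntegrable _ _)
    ((continuous_translate g).stronglyMeasurableAtFilter _ _)
    (continuous_translate g).continuousAt
  rw [translate_zero] at hd
  exact (hd.add_const f).congr_of_eventuallyEq (Eventually.of_forall key)

/-- Integration by parts in `H¹`. -/
lemma IsWeakDeriv.inner_eq {f g f' g' : SpinorL2} (h : IsWeakDeriv f g) (h' : IsWeakDeriv f' g') :
    ⟪g, f'⟫_ℂ = -⟪f, g'⟫_ℂ := by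
  have h1 := h.hasDerivAt_translate.inner ℂ (hasDerivAt_const (0 : ℝ) f')
  have h2 : HasDerivAt (fun s => translate (-s) f') (-g') 0 := by
    have := HasDerivAt.scomp (0 : ℝ) (h := fun s : ℝ => -s) (h' := -1) (g₁ := fun s => translate s f')
      (g₁' := g') (by simpa using h'.hasDerivAt_translate) (hasDerivAt_neg 0)
    rw [neg_one_smul] at this
    exact this
  have h3 := (hasDerivAt_const (0 : ℝ) f).inner ℂ h2
  simp_rw [inner_translate] at h1
  have := h1.unique h3
  simpa [translate_zero] using this

lemma act_sigma1 (v : Spinor) : act sigma1 v = !₂[v 1, v 0] := by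
  ext i
  fin_cases i <;>
    simp [act, sigma1, Matrix.ofLp_toEuclideanCLM, Matrix.mulVec, dotProduct]

lemma act_sigma3 (v : Spinor) : act sigma3 v = !₂[v 0, -v 1] := by
  ext i
  fin_cases i <;>
    simp [act, sigma3, Matrix.ofLp_toEuclideanCLM, Matrix.mulVec, dotProduct]

lemma act_sigma3_sigma3 (v : Spinor) : act sigma3 (act sigma3 v) = v := by
  rw [act_sigma3, act_sigma3]
  ext i
  fin_cases i <;> simp

lemma inner_sigma3 (v w : Spinor) : ⟪act sigma3 v, w⟫_ℂ = ⟪v, act sigma3 w⟫_ℂ := by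
  simp [act_sigma3, PiLp.inner_apply, Fin.sum_univ_two]

lemma inner_sigma1 (v w : Spinor) : ⟪act sigma1 v, w⟫_ℂ = ⟪v, act sigma1 w⟫_ℂ := by
  simp [act_sigma1, PiLp.inner_apply, Fin.sum_univ_two, add_comm]

/-- `σ₃` acting on `L²`. -/
def sigma3L2 : SpinorL2 →L[ℂ] SpinorL2 := (act sigma3).compLpL 2 volume

lemma sigma3L2_coe (f : SpinorL2) : sigma3L2 f =ᵐ[volume] fun x => act sigma3 (f x) :=
  ContinuousLinearMap.coeFn_compLpL _ f

lemma sigma3L2_sigma3L2 (f : SpinorL2) : sigma3L2 (sigma3L2 f) = f := by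
  apply Lp.ext
  filter_upwards [sigma3L2_coe f, sigma3L2_coe (sigma3L2 f)] with x h1 h2
  rw [h2, h1, act_sigma3_sigma3]

lemma inner_sigma3L2 (f g : SpinorL2) : ⟪sigma3L2 f, g⟫_ℂ = ⟪f, sigma3L2 g⟫_ℂ := by
  rw [L2.inner_def, L2.inner_def]
  refine integral_congr_ae ?_
  filter_upwards [sigma3L2_coe f, sigma3L2_coe g] with x h1 h2
  rw [h1, h2, inner_sigma3]

lemma norm_sigma3L2 (f : SpinorL2) : ‖sigma3L2 f‖ = ‖f‖ := by
  have : ⟪sigma3L2 f, sigma3L2 f⟫_ℂ = ⟪f, f⟫_ℂ := by rw [inner_sigma3L2, sigma3L2_sigma3L2]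
  rw [inner_self_eq_norm_sq_to_K, inner_self_eq_norm_sq_to_K] at this
  have h2 : ‖sigma3L2 f‖ ^ 2 = ‖f‖ ^ 2 := by exact_mod_cast this
  exact (pow_left_inj₀ (norm_nonneg _) (norm_nonneg _) two_ne_zero).1 h2

lemma sigma3L2_testVec {φ : ℝ → ℝ} (hφ : Continuous φ) (hc : HasCompactSupport φ) (e : Spinor) :
    sigma3L2 (testVec hφ hc e) = testVec hφ hc (act sigma3 e) := by
  apply Lp.ext
  filter_upwards [sigma3L2_coe (testVec hφ hc e), (memLp_test hφ hc e).coeFn_toLp,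
    (memLp_test hφ hc (act sigma3 e)).coeFn_toLp] with x h1 h2 h3
  rw [h1, testVec, testVec, h2, h3, ContinuousLinearMap.map_smul_of_tower]

lemma IsWeakDeriv.sigma3 {f g : SpinorL2} (h : IsWeakDeriv f g) :
    IsWeakDeriv (sigma3L2 f) (sigma3L2 g) := by
  refine isWeakDeriv_of_inner fun φ hφ hc e => ?_
  rw [← inner_sigma3L2, ← inner_sigma3L2, sigma3L2_testVec, sigma3L2_testVec, inner_testVec,
    inner_testVec, h φ hφ hc, inner_neg_right]

lemma memLp_mass {m : ℝ → ℝ} (hm : Measurable m) {B : ℝ} (hB : ∀ x, |m x| ≤ B) (f : SpinorL2) :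
    MemLp (fun x => (m x : ℂ) • act sigma1 (f x)) 2 (volume : Measure ℝ) := by
  have m₃ : MemLp (fun x => act sigma1 (f x)) 2 (volume : Measure ℝ) := (act sigma1).comp_memLp f
  refine m₃.of_le_mul (c := B) ?_ ?_
  · exact (Complex.measurable_ofReal.comp hm).aestronglyMeasurable.smul m₃.1
  · refine Eventually.of_forall fun x => ?_
    rw [norm_smul, Complex.norm_real, Real.norm_eq_abs]
    exact mul_le_mul_of_nonneg_right (hB x) (norm_nonneg _)

/-- The graph of the Dirac operator. -/
def diracGraph (m : ℝ → ℝ) : Submodule ℂ (SpinorL2 × SpinorL2) where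
  carrier := {p | DiracRel m p.1 p.2}
  add_mem' := fun h₁ h₂ => DiracRel.add h₁ h₂
  zero_mem' := DiracRel.zero
  smul_mem' := fun c _ h => DiracRel.smul c h

/-- `h = i σ₃ ∂ₓ f + M` where `M` is the mass term `m σ₁ f`. -/
lemma diracRel_iff {m : ℝ → ℝ} {f h : SpinorL2} : DiracRel m f h ↔ ∃ g M : SpinorL2,
    IsWeakDeriv f g ∧ h = Complex.I • sigma3L2 g + M ∧
      ∀ᵐ x : ℝ, M x = (m x : ℂ) • act sigma1 (f x) := by
  constructor
  · rintro ⟨g, hg, he⟩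
    refine ⟨g, h - Complex.I • sigma3L2 g, hg, by simp, ?_⟩
    filter_upwards [he, Lp.coeFn_sub h (Complex.I • sigma3L2 g),
      Lp.coeFn_smul Complex.I (sigma3L2 g), sigma3L2_coe g] with x h1 h2 h3 h4
    rw [h2, Pi.sub_apply, h3, Pi.smul_apply, h4, h1, add_sub_cancel_left]
  · rintro ⟨g, M, hg, rfl, hM⟩
    refine ⟨g, hg, ?_⟩
    filter_upwards [hM, Lp.coeFn_add (Complex.I • sigma3L2 g) M,
      Lp.coeFn_smul Complex.I (sigma3L2 g), sigma3L2_coe g] with x h1 h2 h3 h4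
    rw [h2, Pi.add_apply, h3, Pi.smul_apply, h4, h1]

lemma inner_mass {m : ℝ → ℝ} {f g M N : SpinorL2}
    (hM : ∀ᵐ x : ℝ, M x = (m x : ℂ) • act sigma1 (f x))
    (hN : ∀ᵐ x : ℝ, N x = (m x : ℂ) • act sigma1 (g x)) : ⟪M, g⟫_ℂ = ⟪f, N⟫_ℂ := by
  rw [L2.inner_def, L2.inner_def]
  refine integral_congr_ae ?_
  filter_upwards [hM, hN] with x h1 h2
  rw [h1, h2, inner_smul_left, inner_smul_right, inner_sigma1, Complex.conj_ofReal]

/-- The Dirac operator with bounded mass is self-adjoint. -/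
theorem isSelfAdjointRel_diracGraph {m : ℝ → ℝ} (hm : Measurable m) {B : ℝ}
    (hB : ∀ x, |m x| ≤ B) : IsSelfAdjointRel (diracGraph m) where
  symm := by
    rintro ⟨f, h⟩ hp ⟨f', h'⟩ hq
    obtain ⟨g, M, hg, he, hM⟩ := diracRel_iff.1 hp
    obtain ⟨g', M', hg', he', hM'⟩ := diracRel_iff.1 hq
    simp only at hg he hM hg' he' hM' ⊢
    rw [he, he', inner_add_left, inner_add_right, inner_mass hM hM', inner_smul_left,
      inner_smul_right, hg.sigma3.inner_eq hg', inner_sigma3L2]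
    simp
  maximal := by
    rintro ⟨f, h⟩ hmax
    set M : SpinorL2 := (memLp_mass hm hB f).toLp _ with hMdef
    have hM : ∀ᵐ x : ℝ, M x = (m x : ℂ) • act sigma1 (f x) := (memLp_mass hm hB f).coeFn_toLp
    set d : SpinorL2 := (-Complex.I) • sigma3L2 (h - M) with hd
    refine diracRel_iff.2 ⟨d, M, isWeakDeriv_of_inner fun φ hφ hc e => ?_, ?_, hM⟩
    · set T := testVec hφ.continuous hc (act sigma3 e) with hT
      set T' := testVec (continuous_deriv_test hφ) hc.deriv (act sigma3 e) with hT'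
      set N : SpinorL2 := (memLp_mass hm hB T).toLp _ with hNdef
      have hN : ∀ᵐ x : ℝ, N x = (m x : ℂ) • act sigma1 (T x) := (memLp_mass hm hB T).coeFn_toLp
      have hw : IsWeakDeriv T T' := by
        intro η hη hηc
        have e1 : ∫ x, deriv η x • T x = (∫ x, deriv η x * φ x) • act sigma3 e := by
          rw [← integral_smul_const]
          refine integral_congr_ae ?_
          filter_upwards [(memLp_test hφ.continuous hc (act sigma3 e)).coeFn_toLp] with x hx
          rw [hT, testVec, hx, smul_smul]
        have e2 : ∫ x, η x • T' x = (∫ x, η x * deriv φ x) • act sigma3 e := by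
          rw [← integral_smul_const]
          refine integral_congr_ae ?_
          filter_upwards [(memLp_test (continuous_deriv_test hφ) hc.deriv
            (act sigma3 e)).coeFn_toLp] with x hx
          rw [hT', testVec, hx, smul_smul]
        have e3 : ∫ x, η x * deriv φ x = -∫ x, deriv η x * φ x := by
          refine integral_mul_deriv_eq_deriv_mul_of_integrable
            (fun x _ => (hη.differentiable (by simp) x).hasDerivAt)
            (fun x _ => (hφ.differentiable (by simp) x).hasDerivAt) ?_ ?_ ?_
          · exact (hη.continuous.mul (continuous_deriv_test hφ)).integrable_of_hasCompactSupport
              hηc.mul_right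
          · exact ((continuous_deriv_test hη).mul hφ.continuous).integrable_of_hasCompactSupport
              hc.mul_left
          · exact (hη.continuous.mul hφ.continuous).integrable_of_hasCompactSupport hηc.mul_right
        rw [e1, e2, e3, neg_smul, neg_neg]
      have hrel : DiracRel m T (Complex.I • sigma3L2 T' + N) :=
        diracRel_iff.2 ⟨T', N, hw, rfl, hN⟩
      have key := hmax (T, _) hrel
      simp only at key
      rw [inner_add_right, ← inner_mass hM hN, ← eq_sub_iff_add_eq, ← inner_sub_left,
        inner_smul_right] at key
      have s1 : sigma3L2 T' = testVec (continuous_deriv_test hφ) hc.deriv e := by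
        rw [hT', sigma3L2_testVec, act_sigma3_sigma3]
      have s2 : T = sigma3L2 (testVec hφ.continuous hc e) := by
        rw [hT, sigma3L2_testVec]
      rw [s1, s2, ← inner_sigma3L2] at key
      have key2 := congrArg conj key
      rw [map_mul, inner_conj_symm, inner_conj_symm, Complex.conj_I] at key2
      rw [hd, inner_smul_right, ← key2]
      ring_nf
      simp
    · rw [hd, map_smul, sigma3L2_sigma3L2, smul_smul]
      simp

end Sobolev

section Profile

open Filter Topology
open scoped InnerProductSpace ComplexConjugate

lemma integrable_exp_neg_abs {c : ℝ} (hc : 0 < c) : Integrable fun x : ℝ => Real.exp (-c * |x|) := by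
  have h1 : IntegrableOn (fun x : ℝ => Real.exp (-c * |x|)) (Set.Ioi 0) :=
    (exp_neg_integrableOn_Ioi 0 hc).congr_fun
      (fun x hx => by simp only [abs_of_pos (Set.mem_Ioi.1 hx)]) measurableSet_Ioi
  have h2 : IntegrableOn (fun x : ℝ => Real.exp (-c * |x|)) (Set.Iic 0) := by
    have := (integrableOn_Ici_iff_integrableOn_Ioi (f := fun x : ℝ => Real.exp (-c * |x|))
      (b := 0) (μ := volume)).2 h1
    rw [← neg_zero] at this
    have h3 := (this.comp_neg_Iic : IntegrableOn (fun x : ℝ => Real.exp (-c * |(-x)|)) (Set.Iic 0))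
    simpa using h3
  rw [← integrableOn_univ, ← Set.Iic_union_Ioi (a := (0 : ℝ))]
  exact h2.union h1

lemma integrable_exp_neg_abs_sub {c : ℝ} (hc : 0 < c) (a : ℝ) :
    Integrable fun x : ℝ => Real.exp (-c * |x - a|) :=
  (integrable_exp_neg_abs hc).comp_sub_right a

/-- The integral of `exp (-c |x|)`. -/
def expInt (c : ℝ) : ℝ := ∫ x : ℝ, Real.exp (-c * |x|)

lemma expInt_nonneg (c : ℝ) : 0 ≤ expInt c := integral_nonneg fun _ => (Real.exp_pos _).le

lemma integral_exp_neg_abs_sub (c a : ℝ) : ∫ x : ℝ, Real.exp (-c * |x - a|) = expInt c :=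
  integral_sub_right_eq_self (fun x : ℝ => Real.exp (-c * |x|)) a

variable {κ : ℝ → ℝ} {κinf : ℝ}

lemma IsDomainWall.continuous (hκ : IsDomainWall κ κinf) : Continuous κ := hκ.contDiff.continuous

lemma IsDomainWall.exists_bound (hκ : IsDomainWall κ κinf) : ∃ B, 0 < B ∧ ∀ x, |κ x| ≤ B := by
  obtain ⟨B, hB⟩ := isCompact_Icc.exists_bound_of_continuousOn
    (hκ.continuous.continuousOn (s := Set.Icc (-1) 1))
  have hpos := hκ.pos
  refine ⟨max B κinf, lt_max_of_lt_right hpos, fun x => ?_⟩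
  rcases le_total x (-1) with h | h
  · rw [hκ.left x h, abs_neg, abs_of_pos hpos]; exact le_max_right _ _
  rcases le_total x 1 with h' | h'
  · exact (hB x ⟨h, h'⟩).trans (le_max_left _ _)
  · rw [hκ.right x h', abs_of_pos hpos]; exact le_max_right _ _

lemma IsDomainWall.hasDerivAt_profile (hκ : IsDomainWall κ κinf) (x : ℝ) :
    HasDerivAt (profile κ) (-κ x * profile κ x) x := by
  have h := intervalIntegral.integral_hasDerivAt_right (a := 0)
    (hκ.continuous.intervalIntegrable _ x) (hκ.continuous.stronglyMeasurableAtFilter _ _)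
    hκ.continuous.continuousAt
  have := h.neg.exp
  rwa [mul_comm] at this

lemma profile_pos (κ : ℝ → ℝ) (x : ℝ) : 0 < profile κ x := Real.exp_pos _

lemma IsDomainWall.continuous_profile (hκ : IsDomainWall κ κinf) : Continuous (profile κ) :=
  continuous_iff_continuousAt.2 fun x => (hκ.hasDerivAt_profile x).continuousAt

lemma IsDomainWall.profile_neg (hκ : IsDomainWall κ κinf) (x : ℝ) :
    profile κ (-x) = profile κ x := by
  have h : ∫ y in (0 : ℝ)..-x, κ y = ∫ y in (0 : ℝ)..x, κ y := by
    have h1 := intervalIntegral.integral_comp_neg (a := 0) (b := x) κ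
    simp only [hκ.odd, intervalIntegral.integral_neg, neg_zero] at h1
    rw [intervalIntegral.integral_symm, ← h1, neg_neg]
  rw [profile, profile, h]

lemma IsDomainWall.profile_abs (hκ : IsDomainWall κ κinf) (x : ℝ) :
    profile κ |x| = profile κ x := by
  rcases abs_cases x with ⟨h, -⟩ | ⟨h, -⟩ <;> rw [h]
  exact hκ.profile_neg x

/-- The amplitude of the exponential tail of the profile. -/
def tailAmp (κ : ℝ → ℝ) (κinf : ℝ) : ℝ := profile κ 1 * Real.exp κinf

lemma tailAmp_pos (κ : ℝ → ℝ) (κinf : ℝ) : 0 < tailAmp κ κinf :=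
  mul_pos (profile_pos _ _) (Real.exp_pos _)

lemma IsDomainWall.profile_eq (hκ : IsDomainWall κ κinf) {x : ℝ} (hx : 1 ≤ x) :
    profile κ x = tailAmp κ κinf * Real.exp (-κinf * x) := by
  have h : ∫ y in (1 : ℝ)..x, κ y = (x - 1) * κinf := by
    have : ∫ y in (1 : ℝ)..x, κ y = ∫ _y in (1 : ℝ)..x, κinf := by
      refine intervalIntegral.integral_congr fun y hy => ?_
      rw [Set.uIcc_of_le hx] at hy
      exact hκ.right y hy.1
    rw [this, intervalIntegral.integral_const, smul_eq_mul]
  have h2 := intervalIntegral.integral_add_adjacent_intervals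
    (hκ.continuous.intervalIntegrable (μ := volume) 0 1)
    (hκ.continuous.intervalIntegrable (μ := volume) 1 x)
  rw [profile, tailAmp, profile, ← h2, h, ← Real.exp_add, ← Real.exp_add]
  congr 1
  ring

lemma IsDomainWall.exists_profile_le (hκ : IsDomainWall κ κinf) :
    ∃ b, 0 < b ∧ ∀ x, profile κ x ≤ b * Real.exp (-κinf * |x|) := by
  obtain ⟨M, hM⟩ := isCompact_Icc.exists_bound_of_continuousOn
    (hκ.continuous_profile.continuousOn (s := Set.Icc 0 1))
  have hM0 : 0 ≤ M := (norm_nonneg _).trans (hM 0 (by simp))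
  refine ⟨tailAmp κ κinf + M * Real.exp κinf, by have := tailAmp_pos κ κinf; positivity,
    fun x => ?_⟩
  rw [← hκ.profile_abs, add_mul]
  have ht := tailAmp_pos κ κinf
  rcases le_total 1 |x| with h | h
  · rw [hκ.profile_eq h]
    have : 0 ≤ M * Real.exp κinf * Real.exp (-κinf * |x|) := by positivity
    linarith
  · have h1 := (le_abs_self _).trans (hM |x| ⟨abs_nonneg x, h⟩)
    have h2 : M ≤ M * Real.exp κinf * Real.exp (-κinf * |x|) := by
      rw [mul_assoc, ← Real.exp_add]
      refine le_mul_of_one_le_right hM0 (Real.one_le_exp ?_)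
      nlinarith [hκ.pos]
    have : 0 ≤ tailAmp κ κinf * Real.exp (-κinf * |x|) := by positivity
    linarith

lemma IsDomainWall.integrable_profile_sq (hκ : IsDomainWall κ κinf) :
    Integrable fun x => profile κ x ^ 2 := by
  obtain ⟨b, hb, hle⟩ := hκ.exists_profile_le
  refine ((integrable_exp_neg_abs (c := 2 * κinf) (by linarith [hκ.pos])).const_mul (b ^ 2)).mono'
    (hκ.continuous_profile.pow 2).aestronglyMeasurable (Eventually.of_forall fun x => ?_)
  rw [Real.norm_eq_abs, abs_of_nonneg (by positivity)]
  refine (pow_le_pow_left₀ (profile_pos _ _).le (hle x) 2).trans (le_of_eq ?_)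
  rw [mul_pow, ← Real.exp_nat_mul]
  congr 2
  push_cast
  ring

lemma IsDomainWall.memLp_profile (hκ : IsDomainWall κ κinf) :
    MemLp (profile κ) 2 (volume : Measure ℝ) :=
  (memLp_two_iff_integrable_sq hκ.continuous_profile.aestronglyMeasurable).2
    hκ.integrable_profile_sq

lemma IsDomainWall.gam_sq (hκ : IsDomainWall κ κinf) :
    2 * gam κ ^ 2 * ∫ x, profile κ x ^ 2 = 1 := by
  have hint : 0 < ∫ x, profile κ x ^ 2 := by
    rw [integral_pos_iff_support_of_nonneg (fun x => by positivity) hκ.integrable_profile_sq]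
    have : Function.support (fun x => profile κ x ^ 2) = Set.univ := by
      ext x
      simpa using (profile_pos κ x).ne'
    rw [this]
    simp
  have h := hκ.memLp_profile.eLpNorm_eq_integral_rpow_norm two_ne_zero ENNReal.ofNat_ne_top
  have e : (eLpNorm (profile κ) 2 (volume : Measure ℝ)).toReal ^ 2 = ∫ x, profile κ x ^ 2 := by
    rw [h, ENNReal.toReal_ofReal (by positivity)]
    simp only [ENNReal.toReal_ofNat, Real.rpow_two, Real.norm_eq_abs, sq_abs]
    rw [← Real.rpow_natCast, ← Real.rpow_mul hint.le]
    norm_num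
  rw [gam, div_pow, mul_pow, Real.sq_sqrt (by norm_num), e]
  field_simp

lemma IsDomainWall.gam_sq_pos (hκ : IsDomainWall κ κinf) : 0 < gam κ ^ 2 := by
  have := hκ.gam_sq
  by_contra! h
  have h0 : gam κ ^ 2 = 0 := le_antisymm h (sq_nonneg _)
  rw [h0] at this
  simp at this

lemma IsDomainWall.hopping_eq (hκ : IsDomainWall κ κinf) {δ : ℝ} (hδ : 1 ≤ δ) :
    hopping κ δ = 2 * gam κ ^ 2 * tailAmp κ κinf ^ 2 * Real.exp (-2 * κinf * δ) := by
  have h : Real.exp (-2 * ∫ y in (0 : ℝ)..δ, κ y) = profile κ δ ^ 2 := by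
    rw [profile, ← Real.exp_nat_mul]
    congr 1
    push_cast
    ring
  rw [hopping, h, hκ.profile_eq hδ, mul_pow, ← Real.exp_nat_mul]
  rw [mul_assoc, mul_assoc, mul_assoc]
  congr 4
  push_cast
  ring

end Profile

section Modes

open Filter Topology
open scoped InnerProductSpace ComplexConjugate

variable {κ : ℝ → ℝ} {κinf : ℝ}

/-- The spinor `(1, ± i)` of the zero mode at the `j`-th wall. -/
def wallSpinor (j : ℕ) : Spinor := !₂[1, Complex.I * (-1) ^ j]

lemma inner_wallSpinor (j k : ℕ) :
    ⟪wallSpinor j, wallSpinor k⟫_ℂ = 1 + (-1) ^ (j + k) := by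
  simp only [wallSpinor, PiLp.inner_apply, Fin.sum_univ_two]
  simp [pow_add]
  ring_nf
  simp

lemma norm_wallSpinor_sq (j : ℕ) : ‖wallSpinor j‖ ^ 2 = 2 := by
  have h := inner_wallSpinor j j
  rw [inner_self_eq_norm_sq_to_K, ← two_mul, pow_mul] at h
  norm_num at h
  have : (‖wallSpinor j‖ ^ 2 : ℂ) = ((‖wallSpinor j‖ ^ 2 : ℝ) : ℂ) := by push_cast; rfl
  rw [this] at h
  have h2 : ((‖wallSpinor j‖ ^ 2 : ℝ) : ℂ) = ((2 : ℝ) : ℂ) := by rw [h]; norm_num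
  exact_mod_cast h2

lemma sigma3_wallSpinor (j : ℕ) : act sigma3 (wallSpinor j) = wallSpinor (j + 1) := by
  rw [act_sigma3]
  ext i
  fin_cases i <;> simp [wallSpinor, pow_succ]

lemma sigma1_wallSpinor (j : ℕ) :
    act sigma1 (wallSpinor j) = (Complex.I * (-1) ^ j) • wallSpinor (j + 1) := by
  rw [act_sigma1]
  ext i
  fin_cases i
  · simp [wallSpinor]
  · simp only [wallSpinor, PiLp.smul_apply, smul_eq_mul, pow_succ]
    simp
    have h : ((-1 : ℂ) ^ j) * (-1) ^ j = 1 := by rw [← mul_pow]; simp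
    linear_combination Complex.I ^ 2 * h + Complex.I_sq

lemma shiftedMode_eq (κ : ℝ → ℝ) (n : ℕ) (δ : ℝ) (j : ℕ) (x : ℝ) :
    shiftedMode κ n δ j x = (gam κ * profile κ (x - center n δ j)) • wallSpinor j := by
  rw [shiftedMode]
  split_ifs with h
  · ext i
    fin_cases i
    · simp [zeroMode, wallSpinor]
    · simp [zeroMode, wallSpinor, h.neg_one_pow]; ring
  · have h' := Nat.not_even_iff_odd.1 h
    ext i
    fin_cases i
    · simp [conjSpinor, zeroMode, wallSpinor]
    · simp [conjSpinor, zeroMode, wallSpinor, h'.neg_one_pow]; ring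

lemma memLp_real_smul {w : ℝ → ℝ} (hw : MemLp w 2 (volume : Measure ℝ)) (e : Spinor) :
    MemLp (fun x => w x • e) 2 (volume : Measure ℝ) := by
  refine hw.of_le_mul (c := ‖e‖) (hw.1.smul_const e) (Eventually.of_forall fun x => ?_)
  rw [norm_smul, mul_comm]

/-- The element `x ↦ w x • e` of `L²`. -/
def waveVec {w : ℝ → ℝ} (hw : MemLp w 2 (volume : Measure ℝ)) (e : Spinor) : SpinorL2 :=
  (memLp_real_smul hw e).toLp _

lemma waveVec_coe {w : ℝ → ℝ} (hw : MemLp w 2 (volume : Measure ℝ)) (e : Spinor) :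
    waveVec hw e =ᵐ[volume] fun x => w x • e := (memLp_real_smul hw e).coeFn_toLp

lemma inner_waveVec {v w : ℝ → ℝ} (hv : MemLp v 2 (volume : Measure ℝ))
    (hw : MemLp w 2 (volume : Measure ℝ)) (e f : Spinor) :
    ⟪waveVec hv e, waveVec hw f⟫_ℂ = ((∫ x, v x * w x : ℝ) : ℂ) * ⟪e, f⟫_ℂ := by
  rw [L2.inner_def, ← integral_complex_ofReal, ← integral_mul_const]
  refine integral_congr_ae ?_
  filter_upwards [waveVec_coe hv e, waveVec_coe hw f] with x h1 h2
  rw [h1, h2, inner_smul_left_eq_smul, inner_smul_right_eq_smul, smul_smul, Complex.real_smul]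

lemma norm_waveVec_sq {w : ℝ → ℝ} (hw : MemLp w 2 (volume : Measure ℝ)) (e : Spinor) :
    ‖waveVec hw e‖ ^ 2 = (∫ x, w x ^ 2) * ‖e‖ ^ 2 := by
  have h := inner_waveVec hw hw e e
  rw [inner_self_eq_norm_sq_to_K, inner_self_eq_norm_sq_to_K] at h
  simp_rw [← pow_two] at h
  have h' : ((‖waveVec hw e‖ ^ 2 : ℝ) : ℂ) = (((∫ x, w x ^ 2) * ‖e‖ ^ 2 : ℝ) : ℂ) := by
    push_cast
    exact h
  exact Complex.ofReal_injective h'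

lemma isWeakDeriv_waveVec {w w' : ℝ → ℝ} (hw : MemLp w 2 (volume : Measure ℝ))
    (hw' : MemLp w' 2 (volume : Measure ℝ)) (hc' : Continuous w')
    (hd : ∀ x, HasDerivAt w (w' x) x) (e : Spinor) :
    IsWeakDeriv (waveVec hw e) (waveVec hw' e) := by
  have hc : Continuous w := continuous_iff_continuousAt.2 fun x => (hd x).continuousAt
  intro η hη hηc
  have e1 : ∫ x, deriv η x • waveVec hw e x = (∫ x, deriv η x * w x) • e := by
    rw [← integral_smul_const]
    refine integral_congr_ae ?_
    filter_upwards [waveVec_coe hw e] with x hx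
    rw [hx, smul_smul]
  have e2 : ∫ x, η x • waveVec hw' e x = (∫ x, η x * w' x) • e := by
    rw [← integral_smul_const]
    refine integral_congr_ae ?_
    filter_upwards [waveVec_coe hw' e] with x hx
    rw [hx, smul_smul]
  have e3 : ∫ x, η x * w' x = -∫ x, deriv η x * w x := by
    refine integral_mul_deriv_eq_deriv_mul_of_integrable
      (fun x _ => (hη.differentiable (by simp) x).hasDerivAt) (fun x _ => hd x) ?_ ?_ ?_
    · exact (hη.continuous.mul hc').integrable_of_hasCompactSupport hηc.mul_right
    · exact ((continuous_deriv_test hη).mul hc).integrable_of_hasCompactSupport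
        hηc.deriv.mul_right
    · exact (hη.continuous.mul hc).integrable_of_hasCompactSupport hηc.mul_right
  rw [e1, e2, e3, neg_smul, neg_neg]

/-- The scalar factor `γ exp (-∫₀ˣ κ)` of the zero mode, shifted to the `j`-th wall. -/
def amp (κ : ℝ → ℝ) (n : ℕ) (δ : ℝ) (j : ℕ) (x : ℝ) : ℝ :=
  gam κ * profile κ (x - center n δ j)

lemma IsDomainWall.memLp_amp (hκ : IsDomainWall κ κinf) (n : ℕ) (δ : ℝ) (j : ℕ) :
    MemLp (amp κ n δ j) 2 (volume : Measure ℝ) :=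
  (hκ.memLp_profile.comp_measurePreserving
    (measurePreserving_sub_right volume (center n δ j))).const_mul (gam κ)

lemma IsDomainWall.continuous_amp (hκ : IsDomainWall κ κinf) (n : ℕ) (δ : ℝ) (j : ℕ) :
    Continuous (amp κ n δ j) :=
  continuous_const.mul (hκ.continuous_profile.comp (by fun_prop))

lemma IsDomainWall.hasDerivAt_amp (hκ : IsDomainWall κ κinf) (n : ℕ) (δ : ℝ) (j : ℕ) (x : ℝ) :
    HasDerivAt (amp κ n δ j) (-κ (x - center n δ j) * amp κ n δ j x) x := by
  have := ((hκ.hasDerivAt_profile (x - center n δ j)).comp_sub_const x (center n δ j)).const_mul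
    (gam κ)
  convert! this using 1
  rw [amp]; ring

/-- The shifted zero mode as an element of `L²`. -/
def IsDomainWall.modeVec (hκ : IsDomainWall κ κinf) (n : ℕ) (δ : ℝ) (j : ℕ) : SpinorL2 :=
  waveVec (hκ.memLp_amp n δ j) (wallSpinor j)

lemma IsDomainWall.modeVec_coe (hκ : IsDomainWall κ κinf) (n : ℕ) (δ : ℝ) (j : ℕ) :
    hκ.modeVec n δ j =ᵐ[volume] shiftedMode κ n δ j := by
  filter_upwards [waveVec_coe (hκ.memLp_amp n δ j) (wallSpinor j)] with x hx
  rw [modeVec, hx, shiftedMode_eq, amp]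

lemma IsDomainWall.integral_amp_sq (hκ : IsDomainWall κ κinf) (n : ℕ) (δ : ℝ) (j : ℕ) :
    2 * ∫ x, amp κ n δ j x ^ 2 = 1 := by
  simp_rw [amp, mul_pow]
  rw [integral_const_mul, integral_sub_right_eq_self (fun x => profile κ x ^ 2), ← hκ.gam_sq]
  ring

lemma IsDomainWall.norm_modeVec (hκ : IsDomainWall κ κinf) (n : ℕ) (δ : ℝ) (j : ℕ) :
    ‖hκ.modeVec n δ j‖ = 1 := by
  have h := norm_waveVec_sq (hκ.memLp_amp n δ j) (wallSpinor j)
  rw [norm_wallSpinor_sq, mul_comm, hκ.integral_amp_sq] at h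
  exact (pow_eq_one_iff_of_nonneg (norm_nonneg _) two_ne_zero).1 h

/-- The amplitude of the image of the `j`-th zero mode under the Dirac operator of mass `m`. -/
def residual (κ m : ℝ → ℝ) (n : ℕ) (δ : ℝ) (j : ℕ) (x : ℝ) : ℝ :=
  ((-1) ^ j * m x - κ (x - center n δ j)) * amp κ n δ j x

lemma IsDomainWall.memLp_mul_amp (hκ : IsDomainWall κ κinf) (n : ℕ) (δ : ℝ) (j : ℕ) {r : ℝ → ℝ}
    (hr : Measurable r) {B : ℝ} (hB : ∀ x, |r x| ≤ B) :
    MemLp (fun x => r x * amp κ n δ j x) 2 (volume : Measure ℝ) := by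
  refine (hκ.memLp_amp n δ j).of_le_mul (c := B)
    (hr.aestronglyMeasurable.mul (hκ.memLp_amp n δ j).1) (Eventually.of_forall fun x => ?_)
  rw [norm_mul]
  exact mul_le_mul_of_nonneg_right (hB x) (norm_nonneg _)

lemma IsDomainWall.memLp_residual (hκ : IsDomainWall κ κinf) (n : ℕ) (δ : ℝ) (j : ℕ) {m : ℝ → ℝ}
    (hm : Measurable m) {B : ℝ} (hB : ∀ x, |m x| ≤ B) :
    MemLp (residual κ m n δ j) 2 (volume : Measure ℝ) := by
  obtain ⟨B', -, hB'⟩ := hκ.exists_bound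
  refine hκ.memLp_mul_amp n δ j (B := B + B') ?_ fun x => ?_
  · exact (hm.const_mul _).sub (hκ.continuous.measurable.comp (measurable_id.sub_const _))
  · refine (abs_sub _ _).trans (add_le_add ?_ (hB' _))
    rw [abs_mul, abs_pow, abs_neg, abs_one, one_pow, one_mul]
    exact hB x

/-- The action of the Dirac operator on a shifted zero mode. -/
lemma IsDomainWall.diracRel_modeVec (hκ : IsDomainWall κ κinf) (n : ℕ) (δ : ℝ) (j : ℕ) {m : ℝ → ℝ}
    (hm : Measurable m) {B : ℝ} (hB : ∀ x, |m x| ≤ B) :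
    DiracRel m (hκ.modeVec n δ j)
      (Complex.I • waveVec (hκ.memLp_residual n δ j hm hB) (wallSpinor (j + 1))) := by
  obtain ⟨B', -, hB'⟩ := hκ.exists_bound
  have hmem : MemLp (fun x => -κ (x - center n δ j) * amp κ n δ j x) 2 (volume : Measure ℝ) :=
    hκ.memLp_mul_amp n δ j
      (hκ.continuous.measurable.comp (measurable_id.sub_const _)).neg (B := B')
      (fun x => by rw [abs_neg]; exact hB' _)
  have hcont : Continuous fun x => -κ (x - center n δ j) * amp κ n δ j x :=
    ((hκ.continuous.comp (by fun_prop)).neg).mul (hκ.continuous_amp n δ j)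
  refine ⟨waveVec hmem (wallSpinor j), isWeakDeriv_waveVec _ _ hcont
    (hκ.hasDerivAt_amp n δ j) _, ?_⟩
  filter_upwards [waveVec_coe hmem (wallSpinor j), waveVec_coe (hκ.memLp_amp n δ j) (wallSpinor j),
    waveVec_coe (hκ.memLp_residual n δ j hm hB) (wallSpinor (j + 1)),
    Lp.coeFn_smul Complex.I (waveVec (hκ.memLp_residual n δ j hm hB) (wallSpinor (j + 1)))]
    with x h1 h2 h3 h4
  rw [h4, Pi.smul_apply, h3, modeVec, h2, h1, ContinuousLinearMap.map_smul_of_tower,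
    ContinuousLinearMap.map_smul_of_tower, sigma3_wallSpinor, sigma1_wallSpinor]
  simp only [← Complex.coe_smul, smul_smul, ← add_smul]
  congr 1
  rw [residual]
  push_cast
  ring

lemma integral_translate (φ : ℝ → ℝ) (f : SpinorL2) (s : ℝ) :
    ∫ x, φ x • translate s f x = ∫ x, φ (x - s) • f x := by
  rw [← integral_add_right_eq_self (fun x => φ (x - s) • f x) s]
  refine integral_congr_ae ?_
  filter_upwards [translate_coe s f] with x hx
  rw [hx, add_sub_cancel_right]

lemma IsWeakDeriv.translate {f g : SpinorL2} (h : IsWeakDeriv f g) (s : ℝ) :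
    IsWeakDeriv (translate s f) (translate s g) := by
  intro φ hφ hc
  rw [integral_translate, integral_translate,
    ← h (fun x => φ (x - s)) (hφ.comp (contDiff_id.sub contDiff_const))
      (hc.comp_homeomorph (Homeomorph.subRight s))]
  simp_rw [deriv_comp_sub_const]

lemma DiracRel.translate {m : ℝ → ℝ} {f h : SpinorL2} (H : DiracRel m f h) (s : ℝ) :
    DiracRel (fun x => m (x + s)) (translate s f) (translate s h) := by
  obtain ⟨g, hg, he⟩ := H
  refine ⟨_, hg.translate s, ?_⟩
  filter_upwards [translate_coe s f, translate_coe s g, translate_coe s h,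
    (measurePreserving_add_right (volume : Measure ℝ) s).quasiMeasurePreserving.ae he]
    with x h1 h2 h3 h4
  rw [h1, h2, h3, h4]

lemma sigma1_sigma3 (v : Spinor) : act sigma1 (act sigma3 v) = -act sigma3 (act sigma1 v) := by
  simp only [act_sigma1, act_sigma3]
  ext i
  fin_cases i <;> simp

lemma DiracRel.sigma3 {m : ℝ → ℝ} {f h : SpinorL2} (H : DiracRel m f h) :
    DiracRel (fun x => -m x) (sigma3L2 f) (sigma3L2 h) := by
  obtain ⟨g, hg, he⟩ := H
  refine ⟨_, hg.sigma3, ?_⟩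
  filter_upwards [sigma3L2_coe f, sigma3L2_coe g, sigma3L2_coe h, he] with x h1 h2 h3 h4
  rw [h1, h2, h3, h4, map_add, map_smul, map_smul, sigma1_sigma3]
  simp

lemma DiracRel.congr_mass {m m' : ℝ → ℝ} {f h : SpinorL2} (H : DiracRel m f h)
    (hmm : ∀ᵐ x : ℝ, m x = m' x ∨ f x = 0) : DiracRel m' f h := by
  obtain ⟨g, hg, he⟩ := H
  refine ⟨g, hg, ?_⟩
  filter_upwards [he, hmm] with x h1 h2
  rcases h2 with h2 | h2
  · rw [h1, h2]
  · rw [h1, h2]; simp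

/-- The spectral gap for the zero-centred wall in terms of `DiracRel`. -/
lemma SpectralGap.norm_le (hgap : SpectralGap κ κinf) {f h : SpinorL2} (H : DiracRel κ f h)
    (h0 : ∫ x, inner ℂ (zeroMode κ x) (f x) = 0) : κinf * ‖f‖ ≤ ‖h‖ := by
  have := hgap ⟨f, h, H⟩ h0
  rwa [(dirac_apply (⟨f, h, H⟩ : (dirac κ).domain)).2 H] at this

/-- The mass of the `j`-th wall in the absence of the other walls. -/
def singleMass (κ : ℝ → ℝ) (n : ℕ) (δ : ℝ) (j : ℕ) (x : ℝ) : ℝ :=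
  (-1) ^ j * κ (x - center n δ j)

lemma SpectralGap.single_wall (hgap : SpectralGap κ κinf) (hκ : IsDomainWall κ κinf) {n : ℕ}
    {δ : ℝ} {j : ℕ} {f h : SpinorL2} (H : DiracRel (singleMass κ n δ j) f h)
    (h0 : ⟪hκ.modeVec n δ j, f⟫_ℂ = 0) : κinf * ‖f‖ ≤ ‖h‖ := by
  set s := center n δ j with hs
  have h0' : ∫ x, ⟪shiftedMode κ n δ j (x + s), f (x + s)⟫_ℂ = 0 := by
    rw [integral_add_right_eq_self (fun x => ⟪shiftedMode κ n δ j x, f x⟫_ℂ) s, ← h0, L2.inner_def]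
    refine integral_congr_ae ?_
    filter_upwards [hκ.modeVec_coe n δ j] with x hx
    rw [hx]
  have hz : ∀ x, zeroMode κ x = shiftedMode κ 1 0 0 x := by
    intro x
    simp [shiftedMode, center]
  have H1 := H.translate s
  rcases Nat.even_or_odd j with hj | hj
  · have hm : (fun x => singleMass κ n δ j (x + s)) = κ := by
      funext x
      simp [singleMass, hj.neg_one_pow, hs]
    rw [hm] at H1
    have := hgap.norm_le H1 (by
      rw [← h0']
      refine integral_congr_ae ?_
      filter_upwards [translate_coe s f] with x hx
      rw [hx, shiftedMode, if_pos hj, ← hs, add_sub_cancel_right])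
    simpa using this
  · have hm : (fun x => -singleMass κ n δ j (x + s)) = κ := by
      funext x
      simp [singleMass, hj.neg_one_pow, hs]
    have H2 := H1.sigma3
    rw [hm] at H2
    have := hgap.norm_le H2 (by
      rw [← h0']
      refine integral_congr_ae ?_
      filter_upwards [translate_coe s f, sigma3L2_coe (translate s f)] with x hx hx'
      rw [hx', hx, ← inner_sigma3, hz, shiftedMode_eq, shiftedMode_eq,
        ContinuousLinearMap.map_smul_of_tower, sigma3_wallSpinor, ← hs, add_sub_cancel_right]
      have : wallSpinor (0 + 1) = wallSpinor j := by simp [wallSpinor, hj.neg_one_pow]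
      rw [this]
      simp [center])
    simpa [norm_sigma3L2] using this

lemma IsDomainWall.diracRel_modeVec_single (hκ : IsDomainWall κ κinf) (n : ℕ) (δ : ℝ) (j : ℕ) :
    DiracRel (singleMass κ n δ j) (hκ.modeVec n δ j) 0 := by
  obtain ⟨B, -, hB⟩ := hκ.exists_bound
  have hm : Measurable (singleMass κ n δ j) :=
    (hκ.continuous.measurable.comp (measurable_id.sub_const _)).const_mul _
  have h := hκ.diracRel_modeVec n δ j hm (B := B) (fun x => by
    rw [singleMass, abs_mul, abs_pow, abs_neg, abs_one, one_pow, one_mul]; exact hB _)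
  convert h
  have : waveVec (hκ.memLp_residual n δ j hm (B := B) (fun x => by
    rw [singleMass, abs_mul, abs_pow, abs_neg, abs_one, one_pow, one_mul]; exact hB _))
      (wallSpinor (j + 1)) = 0 := by
    rw [← norm_eq_zero, ← sq_eq_zero_iff, norm_waveVec_sq]
    have : ∀ x, residual κ (singleMass κ n δ j) n δ j x = 0 := by
      intro x
      rw [residual, singleMass, ← mul_assoc, ← mul_pow]
      simp
    simp [this]
  rw [this, smul_zero]

/-- The quadratic form version of the gap for a single wall. -/
lemma SpectralGap.single_wall_sq (hgap : SpectralGap κ κinf) (hκ : IsDomainWall κ κinf) {n : ℕ}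
    {δ : ℝ} {j : ℕ} {f h : SpinorL2} (H : DiracRel (singleMass κ n δ j) f h) :
    κinf ^ 2 * (‖f‖ ^ 2 - ‖⟪hκ.modeVec n δ j, f⟫_ℂ‖ ^ 2) ≤ ‖h‖ ^ 2 := by
  set a := hκ.modeVec n δ j with ha
  set c := ⟪a, f⟫_ℂ with hc
  have haa : ⟪a, a⟫_ℂ = 1 := by
    rw [inner_self_eq_norm_sq_to_K, ha, hκ.norm_modeVec]; simp
  have H' := H.add ((hκ.diracRel_modeVec_single n δ j).smul (-c))
  rw [smul_zero, add_zero, ← ha] at H'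
  have h1 := hgap.single_wall hκ H' (by
    rw [← ha, inner_add_right, inner_smul_right, haa, ← hc]; ring)
  have h2 : ‖f + (-c) • a‖ ^ 2 = ‖f‖ ^ 2 - ‖c‖ ^ 2 := by
    have h0 : ⟪f + (-c) • a, c • a⟫_ℂ = 0 := by
      rw [inner_smul_right, inner_add_left, inner_smul_left, haa, map_neg, ← inner_conj_symm,
        ← hc]
      ring
    have h3 := norm_add_sq_eq_norm_sq_add_norm_sq_of_inner_eq_zero _ _ h0
    have h4 : f + (-c) • a + c • a = f := by simp
    rw [h4, norm_smul, ha, hκ.norm_modeVec, mul_one] at h3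
    rw [pow_two, pow_two, pow_two, h3]
    ring
  rw [← h2, ← mul_pow]
  exact pow_le_pow_left₀ (mul_nonneg hκ.pos.le (norm_nonneg _)) h1 2

end Modes

section Localization

open Filter Topology
open scoped InnerProductSpace ComplexConjugate

variable {κ : ℝ → ℝ} {κinf : ℝ}

lemma cell_le (n : ℕ) (δ x : ℝ) : cell n δ x ≤ n - 1 := min_le_right _ _

lemma lt_of_cell_lt {n : ℕ} {δ x : ℝ} (hδ : 0 < δ) (h : cell n δ x < n - 1) :
    center n δ (cell n δ x) - δ < x := by
  have e : cell n δ x = ⌊((n : ℝ) * δ - x) / (2 * δ)⌋₊ := by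
    rw [cell] at h ⊢
    exact min_eq_left (by omega)
  have h1 := Nat.lt_floor_add_one (((n : ℝ) * δ - x) / (2 * δ))
  rw [← e, div_lt_iff₀ (by positivity)] at h1
  rw [center]
  linarith

lemma le_of_cell_pos {n : ℕ} {δ x : ℝ} (hδ : 0 < δ) (h : 0 < cell n δ x) :
    x ≤ center n δ (cell n δ x) + δ := by
  have e : cell n δ x ≤ ⌊((n : ℝ) * δ - x) / (2 * δ)⌋₊ := min_le_left _ _
  have h1 := (Nat.le_floor_iff' h.ne').1 e
  rw [le_div_iff₀ (by positivity)] at h1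
  rw [center]
  linarith

lemma measurable_cell (n : ℕ) (δ : ℝ) : Measurable (cell n δ) :=
  (Nat.measurable_floor.comp ((measurable_const.sub measurable_id).div_const _)).min
    measurable_const

lemma IsDomainWall.measurable_wallMass (hκ : IsDomainWall κ κinf) (n : ℕ) (δ : ℝ) :
    Measurable (wallMass κ n δ) := by
  have h : Measurable fun p : ℕ × ℝ => (-1 : ℝ) ^ p.1 * κ (p.2 - center n δ p.1) :=
    measurable_from_prod_countable_right fun j =>
      ((hκ.continuous.comp (continuous_id.sub continuous_const)).measurable.const_mul _ :
        Measurable fun x : ℝ => (-1 : ℝ) ^ j * κ (x - center n δ j))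
  exact h.comp ((measurable_cell n δ).prodMk measurable_id)

lemma abs_wallMass_le {B : ℝ} (hB : ∀ x, |κ x| ≤ B) (n : ℕ) (δ x : ℝ) : |wallMass κ n δ x| ≤ B := by
  rw [wallMass, abs_mul, abs_pow, abs_neg, abs_one, one_pow, one_mul]
  exact hB _

/-- Up to the next but one boundary, the mass agrees with that of the `k`-th wall. -/
lemma IsDomainWall.wallMass_eq (hκ : IsDomainWall κ κinf) {n : ℕ} {δ : ℝ} (hδ : 1 ≤ δ) {k : ℕ}
    (hk : k < n) {x : ℝ} (h1 : k ≠ 0 → x ≤ center n δ k + 2 * δ - 1)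
    (h2 : k ≠ n - 1 → center n δ k - 2 * δ + 1 ≤ x) :
    wallMass κ n δ x = singleMass κ n δ k x := by
  have hδ0 : 0 < δ := by linarith
  have hle := cell_le n δ x
  set j := cell n δ x with hj
  rw [wallMass, singleMass, ← hj]
  rcases lt_trichotomy j k with h | h | h
  · have h3 := lt_of_cell_lt hδ0 (by rw [← hj]; omega : cell n δ x < n - 1)
    rw [← hj] at h3
    have h4 := h1 (by omega)
    have hjk : k = j + 1 := by
      by_contra hne
      have : j + 2 ≤ k := by omega
      have hc : (j : ℝ) + 2 ≤ k := by exact_mod_cast this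
      simp only [center] at h3 h4
      nlinarith
    subst hjk
    simp only [center] at h3 h4 ⊢
    push_cast at h4 ⊢
    rw [hκ.left (x - ((n : ℝ) - 1 - 2 * j) * δ) (by linarith),
      hκ.right (x - ((n : ℝ) - 1 - 2 * (j + 1)) * δ) (by linarith), pow_succ]
    ring
  · rw [h]
  · have h3 := le_of_cell_pos hδ0 (by rw [← hj]; omega : 0 < cell n δ x)
    rw [← hj] at h3
    have h4 := h2 (by omega)
    have hjk : j = k + 1 := by
      by_contra hne
      have : k + 2 ≤ j := by omega
      have hc : (k : ℝ) + 2 ≤ j := by exact_mod_cast this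
      simp only [center] at h3 h4
      nlinarith
    rw [hjk] at h3 ⊢
    simp only [center] at h3 h4 ⊢
    push_cast at h3 ⊢
    rw [hκ.left (x - ((n : ℝ) - 1 - 2 * k) * δ) (by linarith),
      hκ.right (x - ((n : ℝ) - 1 - 2 * (k + 1)) * δ) (by linarith), pow_succ]
    ring

lemma exists_deriv_smoothTransition_bound : ∃ M : ℝ, ∀ x, |deriv Real.smoothTransition x| ≤ M := by
  have hc : Continuous (deriv Real.smoothTransition) :=
    (Real.smoothTransition.contDiff (n := 1)).continuous_deriv (by norm_num)
  obtain ⟨M, hM⟩ := isCompact_Icc.exists_bound_of_continuousOn (hc.continuousOn (s := Set.Icc 0 1))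
  have hM0 : 0 ≤ M := (norm_nonneg _).trans (hM 0 (by simp))
  refine ⟨M, fun x => ?_⟩
  rcases lt_or_ge x 0 with h | h
  · have : Real.smoothTransition =ᶠ[𝓝 x] fun _ => 0 := by
      filter_upwards [Iio_mem_nhds h] with y hy
      exact Real.smoothTransition.zero_of_nonpos (le_of_lt hy)
    rw [this.deriv_eq]
    simpa using hM0
  rcases le_or_gt x 1 with h' | h'
  · exact hM x ⟨h, h'⟩
  · have : Real.smoothTransition =ᶠ[𝓝 x] fun _ => 1 := by
      filter_upwards [Ioi_mem_nhds h'] with y hy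
      exact Real.smoothTransition.one_of_one_le (le_of_lt hy)
    rw [this.deriv_eq]
    simpa using hM0

/-- A smooth step at the boundary between the walls `i - 1` and `i`. -/
def step (n : ℕ) (δ : ℝ) (i : ℕ) (x : ℝ) : ℝ :=
  if i = 0 then 1 else if n ≤ i then 0 else
    Real.smoothTransition ((((n : ℝ) - 2 * i) * δ - x) / δ + 1 / 2)

lemma contDiff_step (n : ℕ) (δ : ℝ) (i : ℕ) : ContDiff ℝ ∞ (step n δ i) := by
  unfold step
  split_ifs
  · exact contDiff_const
  · exact contDiff_const
  · exact Real.smoothTransition.contDiff.comp (by fun_prop)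

lemma abs_deriv_step_le {M : ℝ} (hM : ∀ x, |deriv Real.smoothTransition x| ≤ M) (n : ℕ) {δ : ℝ}
    (hδ : 0 < δ) (i : ℕ) (x : ℝ) : |deriv (step n δ i) x| ≤ M / δ := by
  have hM0 : 0 ≤ M := (abs_nonneg _).trans (hM 0)
  unfold step
  split_ifs
  · simp; positivity
  · simp; positivity
  · have h1 : HasDerivAt (fun x : ℝ => (((n : ℝ) - 2 * i) * δ - x) / δ + 1 / 2) (-1 / δ) x :=
      (((hasDerivAt_id x).const_sub _).div_const δ).add_const _
    have h2 := ((Real.smoothTransition.contDiff (n := 1)).differentiable (by norm_num)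
      ((((n : ℝ) - 2 * i) * δ - x) / δ + 1 / 2)).hasDerivAt.comp x h1
    have h3 : deriv (fun x => Real.smoothTransition ((((n : ℝ) - 2 * i) * δ - x) / δ + 1 / 2)) x =
        _ := h2.deriv
    rw [h3, abs_mul, abs_div, abs_neg, abs_one, abs_of_pos hδ, mul_one_div]
    exact div_le_div_of_nonneg_right (hM _) hδ.le

lemma step_zero (n : ℕ) (δ x : ℝ) : step n δ 0 x = 1 := if_pos rfl

lemma step_last {n : ℕ} (hn : 1 ≤ n) (δ x : ℝ) : step n δ n x = 0 := by
  rw [step, if_neg (by omega), if_pos le_rfl]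

lemma step_eq_zero {n : ℕ} {δ : ℝ} (hδ : 0 < δ) {i : ℕ} (hi : i ≠ 0) {x : ℝ}
    (hx : center n δ i + 3 / 2 * δ ≤ x) : step n δ i x = 0 := by
  rw [step, if_neg hi]
  split_ifs
  · rfl
  · refine Real.smoothTransition.zero_of_nonpos ?_
    rw [center] at hx
    have : ((((n : ℝ) - 2 * i) * δ - x) / δ) ≤ -(1 / 2) := by
      rw [div_le_iff₀ hδ]; linarith
    linarith

lemma step_eq_one {n : ℕ} {δ : ℝ} (hδ : 0 < δ) {i : ℕ} (hi : i < n) {x : ℝ}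
    (hx : x ≤ center n δ i + 1 / 2 * δ) : step n δ i x = 1 := by
  rw [step]
  split_ifs
  · rfl
  · omega
  · refine Real.smoothTransition.one_of_one_le ?_
    rw [center] at hx
    have : 1 / 2 ≤ ((((n : ℝ) - 2 * i) * δ - x) / δ) := by
      rw [le_div_iff₀ hδ]; linarith
    linarith

lemma center_succ (n : ℕ) (δ : ℝ) (i : ℕ) : center n δ (i + 1) = center n δ i - 2 * δ := by
  simp only [center]; push_cast; ring

/-- The cutoff to the neighbourhood of the `k`-th wall. -/
def cutoff (n : ℕ) (δ : ℝ) (k : ℕ) (x : ℝ) : ℝ :=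
  Real.sin (Real.pi / 2 * step n δ k x) * Real.cos (Real.pi / 2 * step n δ (k + 1) x)

lemma contDiff_cutoff (n : ℕ) (δ : ℝ) (k : ℕ) : ContDiff ℝ ∞ (cutoff n δ k) :=
  (Real.contDiff_sin.comp (contDiff_const.mul (contDiff_step n δ k))).mul
    (Real.contDiff_cos.comp (contDiff_const.mul (contDiff_step n δ (k + 1))))

lemma abs_cutoff_le (n : ℕ) (δ : ℝ) (k : ℕ) (x : ℝ) : |cutoff n δ k x| ≤ 1 := by
  rw [cutoff, abs_mul]
  exact mul_le_one₀ (Real.abs_sin_le_one _) (abs_nonneg _) (Real.abs_cos_le_one _)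

lemma abs_deriv_cutoff_le {M : ℝ} (hM : ∀ x, |deriv Real.smoothTransition x| ≤ M) (n : ℕ) {δ : ℝ}
    (hδ : 0 < δ) (k : ℕ) (x : ℝ) : |deriv (cutoff n δ k) x| ≤ Real.pi * M / δ := by
  have hd : ∀ i, HasDerivAt (fun x => Real.pi / 2 * step n δ i x)
      (Real.pi / 2 * deriv (step n δ i) x) x := fun i =>
    (((contDiff_step n δ i).differentiable (by simp) x).hasDerivAt).const_mul _
  have h := (hd k).sin.mul (hd (k + 1)).cos
  have e : deriv (cutoff n δ k) x = _ := h.deriv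
  rw [e]
  have hb : ∀ i, |Real.pi / 2 * deriv (step n δ i) x| ≤ Real.pi / 2 * (M / δ) := by
    intro i
    rw [abs_mul, abs_of_pos (by positivity)]
    exact mul_le_mul_of_nonneg_left (abs_deriv_step_le hM n hδ i x) (by positivity)
  have hM0 : 0 ≤ M := (abs_nonneg _).trans (hM 0)
  have hX : 0 ≤ Real.pi / 2 * (M / δ) := by positivity
  refine (abs_add_le _ _).trans ?_
  simp only [abs_mul, abs_neg]
  have a1 := Real.abs_cos_le_one (Real.pi / 2 * step n δ k x)
  have a2 := Real.abs_cos_le_one (Real.pi / 2 * step n δ (k + 1) x)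
  have a3 := Real.abs_sin_le_one (Real.pi / 2 * step n δ k x)
  have a4 := Real.abs_sin_le_one (Real.pi / 2 * step n δ (k + 1) x)
  have b1 := hb k
  have b2 := hb (k + 1)
  rw [abs_mul] at b1 b2
  have c1 : |Real.cos (Real.pi / 2 * step n δ k x)| * (|Real.pi / 2| * |deriv (step n δ k) x|) *
      |Real.cos (Real.pi / 2 * step n δ (k + 1) x)| ≤ 1 * (Real.pi / 2 * (M / δ)) * 1 := by gcongr
  have c2 : |Real.sin (Real.pi / 2 * step n δ k x)| *
      (|Real.sin (Real.pi / 2 * step n δ (k + 1) x)| *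
        (|Real.pi / 2| * |deriv (step n δ (k + 1)) x|)) ≤ 1 * (1 * (Real.pi / 2 * (M / δ))) := by
    gcongr
  refine (add_le_add c1 c2).trans (le_of_eq ?_)
  ring

lemma cutoff_support {n : ℕ} {δ : ℝ} (hδ : 0 < δ) {k : ℕ} (hk : k < n) {x : ℝ}
    (hx : cutoff n δ k x ≠ 0) : (k ≠ 0 → x < center n δ k + 3 / 2 * δ) ∧
      (k ≠ n - 1 → center n δ k - 3 / 2 * δ < x) := by
  constructor
  · intro h0
    by_contra! hcon
    exact hx (by rw [cutoff, step_eq_zero hδ h0 hcon]; simp)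
  · intro h0
    by_contra! hcon
    refine hx ?_
    rw [cutoff, step_eq_one (i := k + 1) hδ (by omega) (by rw [center_succ]; linarith), mul_one,
      Real.cos_pi_div_two, mul_zero]

lemma cutoff_eq_one {n : ℕ} {δ : ℝ} (hδ : 0 < δ) {k : ℕ} (hk : k < n) {x : ℝ}
    (hx : |x - center n δ k| ≤ 1 / 2 * δ) : cutoff n δ k x = 1 := by
  rw [abs_le] at hx
  rw [cutoff, step_eq_one hδ hk (by linarith),
    step_eq_zero hδ (Nat.succ_ne_zero k) (by rw [center_succ]; linarith)]
  simp

lemma cutoff_sq {n : ℕ} {δ : ℝ} (hδ : 0 < δ) {k : ℕ} (hk : k < n) (x : ℝ) :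
    cutoff n δ k x ^ 2 = Real.sin (Real.pi / 2 * step n δ k x) ^ 2 -
      Real.sin (Real.pi / 2 * step n δ (k + 1) x) ^ 2 := by
  rw [cutoff, mul_pow, Real.cos_sq']
  by_cases h : center n δ (k + 1) + 3 / 2 * δ ≤ x
  · rw [step_eq_zero hδ (Nat.succ_ne_zero k) h]; simp
  · rw [step_eq_one hδ hk (by rw [center_succ] at h; linarith)]; simp

lemma sum_cutoff_sq {n : ℕ} (hn : 1 ≤ n) {δ : ℝ} (hδ : 0 < δ) (x : ℝ) :
    ∑ k : Fin n, cutoff n δ k x ^ 2 = 1 := by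
  rw [Fin.sum_univ_eq_sum_range (fun k => cutoff n δ k x ^ 2),
    Finset.sum_congr rfl fun k hk => cutoff_sq hδ (Finset.mem_range.1 hk) x,
    Finset.sum_range_sub', step_zero, step_last hn]
  simp

lemma sum_cutoff_mul_deriv {n : ℕ} (hn : 1 ≤ n) {δ : ℝ} (hδ : 0 < δ) (x : ℝ) :
    ∑ k : Fin n, cutoff n δ k x * deriv (cutoff n δ k) x = 0 := by
  have h : HasDerivAt (fun x => ∑ k : Fin n, cutoff n δ k x ^ 2)
      (∑ k : Fin n, 2 * cutoff n δ k x * deriv (cutoff n δ k) x) x := by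
    refine HasDerivAt.fun_sum fun k _ => ?_
    have := (((contDiff_cutoff n δ k).differentiable (by simp) x).hasDerivAt).fun_pow 2
    simpa using this
  simp_rw [sum_cutoff_sq hn hδ] at h
  have h2 := h.unique (hasDerivAt_const x 1)
  simp_rw [mul_assoc, ← Finset.mul_sum] at h2
  linarith

end Localization

section IMS

open Filter Topology
open scoped InnerProductSpace ComplexConjugate

variable {κ : ℝ → ℝ} {κinf : ℝ}

lemma norm_sq_eq_integral (f : SpinorL2) : ‖f‖ ^ 2 = ∫ x, ‖f x‖ ^ 2 := by
  have h : ⟪f, f⟫_ℂ = ((∫ x, ‖f x‖ ^ 2 : ℝ) : ℂ) := by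
    rw [L2.inner_def, ← integral_complex_ofReal]
    refine integral_congr_ae (Eventually.of_forall fun x => ?_)
    simp only
    rw [inner_self_eq_norm_sq_to_K]
    push_cast
    rfl
  rw [inner_self_eq_norm_sq_to_K] at h
  have h' : ((‖f‖ ^ 2 : ℝ) : ℂ) = ((∫ x, ‖f x‖ ^ 2 : ℝ) : ℂ) := by push_cast at h ⊢; exact h
  exact Complex.ofReal_injective h'

lemma integrable_norm_sq (f : SpinorL2) : Integrable fun x => ‖f x‖ ^ 2 :=
  (memLp_two_iff_integrable_sq_norm (Lp.memLp f).1).1 (Lp.memLp f)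

lemma memLp_bdd_smul {χ : ℝ → ℝ} (hχ : Continuous χ) {B : ℝ} (hB : ∀ x, |χ x| ≤ B) (f : SpinorL2) :
    MemLp (fun x => χ x • f x) 2 (volume : Measure ℝ) := by
  refine (Lp.memLp f).of_le_mul (c := B) (hχ.aestronglyMeasurable.smul (Lp.memLp f).1)
    (Eventually.of_forall fun x => ?_)
  rw [norm_smul]
  exact mul_le_mul_of_nonneg_right (hB x) (norm_nonneg _)

/-- Multiplication by a bounded continuous function. -/
def bddSmul {χ : ℝ → ℝ} (hχ : Continuous χ) {B : ℝ} (hB : ∀ x, |χ x| ≤ B) (f : SpinorL2) :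
    SpinorL2 := (memLp_bdd_smul hχ hB f).toLp _

lemma bddSmul_coe {χ : ℝ → ℝ} (hχ : Continuous χ) {B : ℝ} (hB : ∀ x, |χ x| ≤ B) (f : SpinorL2) :
    bddSmul hχ hB f =ᵐ[volume] fun x => χ x • f x := (memLp_bdd_smul hχ hB f).coeFn_toLp

/-- The Leibniz rule. -/
lemma IsWeakDeriv.bddSmul {f g : SpinorL2} (h : IsWeakDeriv f g) {χ : ℝ → ℝ} (hχ : ContDiff ℝ ∞ χ)
    {B B' : ℝ} (hB : ∀ x, |χ x| ≤ B) (hB' : ∀ x, |deriv χ x| ≤ B') :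
    IsWeakDeriv (bddSmul hχ.continuous hB f)
      (bddSmul hχ.continuous hB g + bddSmul (continuous_deriv_test hχ) hB' f) := by
  intro φ hφ hc
  have key := h (fun x => φ x * χ x) (hφ.mul hχ) hc.mul_right
  have hd : ∀ x, deriv (fun x => φ x * χ x) x = deriv φ x * χ x + φ x * deriv χ x := fun x =>
    deriv_fun_mul (hφ.differentiable (by simp) x) (hχ.differentiable (by simp) x)
  simp_rw [hd, add_smul] at key
  have i1 : Integrable fun x => (deriv φ x * χ x) • f x := integrable_test f
    ((continuous_deriv_test hφ).mul hχ.continuous) hc.deriv.mul_right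
  have i2 : Integrable fun x => (φ x * deriv χ x) • f x := integrable_test f
    (hφ.continuous.mul (continuous_deriv_test hχ)) hc.mul_right
  have i3 : Integrable fun x => (φ x * χ x) • g x := integrable_test g
    (hφ.continuous.mul hχ.continuous) hc.mul_right
  rw [integral_add i1 i2] at key
  have e1 : ∫ x, deriv φ x • DiracWalls.bddSmul hχ.continuous hB f x =
      ∫ x, (deriv φ x * χ x) • f x := by
    refine integral_congr_ae ?_
    filter_upwards [bddSmul_coe hχ.continuous hB f] with x hx
    rw [hx, smul_smul]
  have e2 : ∫ x, φ x • (DiracWalls.bddSmul hχ.continuous hB g +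
      DiracWalls.bddSmul (continuous_deriv_test hχ) hB' f : SpinorL2) x =
      ∫ x, ((φ x * χ x) • g x + (φ x * deriv χ x) • f x) := by
    refine integral_congr_ae ?_
    filter_upwards [bddSmul_coe hχ.continuous hB g, bddSmul_coe (continuous_deriv_test hχ) hB' f,
      Lp.coeFn_add (DiracWalls.bddSmul hχ.continuous hB g)
        (DiracWalls.bddSmul (continuous_deriv_test hχ) hB' f)] with x h1 h2 h3
    rw [h3, Pi.add_apply, h1, h2, smul_add, smul_smul, smul_smul]
  rw [e1, e2, integral_add i3 i2, neg_add, ← key]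
  abel

lemma DiracRel.bddSmul {m : ℝ → ℝ} {f h : SpinorL2} (H : DiracRel m f h) {χ : ℝ → ℝ}
    (hχ : ContDiff ℝ ∞ χ) {B B' : ℝ} (hB : ∀ x, |χ x| ≤ B) (hB' : ∀ x, |deriv χ x| ≤ B') :
    DiracRel m (bddSmul hχ.continuous hB f) (bddSmul hχ.continuous hB h +
      bddSmul (continuous_deriv_test hχ) hB' (Complex.I • sigma3L2 f)) := by
  obtain ⟨g, hg, he⟩ := H
  refine ⟨_, hg.bddSmul hχ hB hB', ?_⟩
  filter_upwards [he, bddSmul_coe hχ.continuous hB f, bddSmul_coe hχ.continuous hB g,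
    bddSmul_coe hχ.continuous hB h, bddSmul_coe (continuous_deriv_test hχ) hB' f,
    bddSmul_coe (continuous_deriv_test hχ) hB' (Complex.I • sigma3L2 f),
    Lp.coeFn_add (DiracWalls.bddSmul hχ.continuous hB h)
      (DiracWalls.bddSmul (continuous_deriv_test hχ) hB' (Complex.I • sigma3L2 f)),
    Lp.coeFn_add (DiracWalls.bddSmul hχ.continuous hB g)
      (DiracWalls.bddSmul (continuous_deriv_test hχ) hB' f),
    Lp.coeFn_smul Complex.I (sigma3L2 f), sigma3L2_coe f] with x h1 h2 h3 h4 h5 h6 h7 h8 h9 h10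
  rw [h7, h8, Pi.add_apply, Pi.add_apply, h2, h3, h4, h5, h6, h9, Pi.smul_apply, h10, h1, map_add,
    ContinuousLinearMap.map_smul_of_tower, ContinuousLinearMap.map_smul_of_tower,
    ContinuousLinearMap.map_smul_of_tower, smul_add, smul_add, smul_comm Complex.I (χ x),
    smul_comm Complex.I (deriv χ x), smul_comm (m x : ℂ) (χ x)]
  abel

lemma sum_norm_sq_smul_add {ι : Type*} [Fintype ι] {a b : ι → ℝ} (ha : ∑ k, a k ^ 2 = 1)
    (hab : ∑ k, a k * b k = 0) (v w : Spinor) :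
    ∑ k, ‖a k • v + b k • w‖ ^ 2 = ‖v‖ ^ 2 + (∑ k, b k ^ 2) * ‖w‖ ^ 2 := by
  have h : ∀ k, ‖a k • v + b k • w‖ ^ 2 =
      a k ^ 2 * ‖v‖ ^ 2 + (a k * b k) * (2 * (⟪v, w⟫_ℂ).re) + b k ^ 2 * ‖w‖ ^ 2 := by
    intro k
    rw [norm_add_sq (𝕜 := ℂ), norm_smul, norm_smul, mul_pow, mul_pow, Real.norm_eq_abs,
      Real.norm_eq_abs, sq_abs, sq_abs, inner_smul_left_eq_smul, inner_smul_right_eq_smul,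
      smul_smul]
    simp
    ring
  simp_rw [h]
  rw [Finset.sum_add_distrib, Finset.sum_add_distrib, ← Finset.sum_mul, ← Finset.sum_mul,
    ← Finset.sum_mul, ha, hab]
  ring

/-- The localization formula. -/
lemma sum_norm_sq_localized {ι : Type*} [Fintype ι] {χ : ι → ℝ → ℝ} (hχ : ∀ k, ContDiff ℝ ∞ (χ k))
    (hsq : ∀ x, ∑ k, χ k x ^ 2 = 1) (hd : ∀ x, ∑ k, χ k x * deriv (χ k) x = 0) {B B' : ℝ}
    (hB : ∀ k x, |χ k x| ≤ B) (hB' : ∀ k x, |deriv (χ k) x| ≤ B') (h w : SpinorL2) :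
    ∑ k, ‖bddSmul (hχ k).continuous (hB k) h +
      bddSmul (continuous_deriv_test (hχ k)) (hB' k) w‖ ^ 2 ≤
      ‖h‖ ^ 2 + Fintype.card ι * B' ^ 2 * ‖w‖ ^ 2 := by
  simp_rw [norm_sq_eq_integral]
  rw [← integral_finsetSum _ fun k _ => integrable_norm_sq _, ← integral_const_mul,
    ← integral_add (integrable_norm_sq h) ((integrable_norm_sq w).const_mul _)]
  refine integral_mono_ae (integrable_finsetSum _ fun k _ => integrable_norm_sq _)
    ((integrable_norm_sq h).add ((integrable_norm_sq w).const_mul _)) ?_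
  have hall : ∀ᵐ x : ℝ, ∀ k, (bddSmul (hχ k).continuous (hB k) h +
      bddSmul (continuous_deriv_test (hχ k)) (hB' k) w : SpinorL2) x =
      χ k x • h x + deriv (χ k) x • w x := by
    rw [ae_all_iff]
    intro k
    filter_upwards [bddSmul_coe (hχ k).continuous (hB k) h,
      bddSmul_coe (continuous_deriv_test (hχ k)) (hB' k) w,
      Lp.coeFn_add (bddSmul (hχ k).continuous (hB k) h)
        (bddSmul (continuous_deriv_test (hχ k)) (hB' k) w)] with x h1 h2 h3
    rw [h3, Pi.add_apply, h1, h2]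
  filter_upwards [hall] with x hx
  simp_rw [hx]
  rw [sum_norm_sq_smul_add (hsq x) (hd x)]
  refine add_le_add le_rfl (mul_le_mul_of_nonneg_right ?_ (by positivity))
  have : ∑ k, deriv (χ k) x ^ 2 ≤ ∑ _k : ι, B' ^ 2 :=
    Finset.sum_le_sum fun k _ => sq_le_sq' (abs_le.1 (hB' k x)).1 (abs_le.1 (hB' k x)).2
  simpa using this

lemma sum_norm_sq_bddSmul {ι : Type*} [Fintype ι] {χ : ι → ℝ → ℝ} (hχ : ∀ k, Continuous (χ k))
    (hsq : ∀ x, ∑ k, χ k x ^ 2 = 1) {B : ℝ} (hB : ∀ k x, |χ k x| ≤ B) (f : SpinorL2) :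
    ∑ k, ‖bddSmul (hχ k) (hB k) f‖ ^ 2 = ‖f‖ ^ 2 := by
  simp_rw [norm_sq_eq_integral]
  rw [← integral_finsetSum _ fun k _ => integrable_norm_sq _]
  have hall : ∀ᵐ x : ℝ, ∀ k, bddSmul (hχ k) (hB k) f x = χ k x • f x := by
    rw [ae_all_iff]
    exact fun k => bddSmul_coe (hχ k) (hB k) f
  refine integral_congr_ae ?_
  filter_upwards [hall] with x hx
  simp_rw [hx, norm_smul, mul_pow, Real.norm_eq_abs, sq_abs]
  rw [← Finset.sum_mul, hsq, one_mul]

/-- A function that vanishes near the `j`-th wall has a small overlap with the zero mode. -/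
lemma IsDomainWall.exists_overlap_bound (hκ : IsDomainWall κ κinf) : ∃ D, 0 ≤ D ∧
    ∀ (n : ℕ) (δ : ℝ) (j : ℕ) (χ : ℝ → ℝ) (hχ : Continuous χ) (hB : ∀ x, |χ x| ≤ 1),
      (∀ x, |x - center n δ j| ≤ 1 / 2 * δ → χ x = 1) → ∀ f : SpinorL2,
      ⟪hκ.modeVec n δ j, f⟫_ℂ = 0 →
      ‖⟪hκ.modeVec n δ j, bddSmul hχ hB f⟫_ℂ‖ ^ 2 ≤ D * Real.exp (-(κinf / 2) * δ) * ‖f‖ ^ 2 := by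
  obtain ⟨b, hb, hle⟩ := hκ.exists_profile_le
  have hpos := hκ.pos
  refine ⟨8 * gam κ ^ 2 * b ^ 2 * expInt κinf, by have := expInt_nonneg κinf; positivity, ?_⟩
  intro n δ j χ hχ hB h1 f h0
  have hmem : MemLp (fun x => (χ x - 1) * amp κ n δ j x) 2 (volume : Measure ℝ) :=
    hκ.memLp_mul_amp n δ j (hχ.measurable.sub_const 1) (B := 2) fun x => by
      have := abs_sub (χ x) 1
      rw [abs_one] at this
      linarith [hB x]
  have e1 : ⟪hκ.modeVec n δ j, bddSmul hχ hB f⟫_ℂ = ⟪waveVec hmem (wallSpinor j), f⟫_ℂ := by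
    have e2 : ⟪hκ.modeVec n δ j, bddSmul hχ hB f⟫_ℂ =
        ⟪hκ.modeVec n δ j, bddSmul hχ hB f - f⟫_ℂ := by rw [inner_sub_right, h0, sub_zero]
    rw [e2, L2.inner_def, L2.inner_def]
    refine integral_congr_ae ?_
    filter_upwards [waveVec_coe hmem (wallSpinor j), waveVec_coe (hκ.memLp_amp n δ j)
      (wallSpinor j), bddSmul_coe hχ hB f, Lp.coeFn_sub (bddSmul hχ hB f) f] with x a1 a2 a3 a4
    rw [a1, a4, Pi.sub_apply, a3, modeVec, a2]
    have : χ x • f x - f x = (χ x - 1) • f x := by rw [sub_smul, one_smul]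
    rw [this, inner_smul_right_eq_smul, inner_smul_left_eq_smul, inner_smul_left_eq_smul,
      smul_smul]
  have e3 : ∫ x, ((χ x - 1) * amp κ n δ j x) ^ 2 ≤
      4 * gam κ ^ 2 * b ^ 2 * Real.exp (-(κinf / 2) * δ) * expInt κinf := by
    rw [← integral_exp_neg_abs_sub κinf (center n δ j), ← integral_const_mul]
    refine integral_mono hmem.integrable_sq
      ((integrable_exp_neg_abs_sub hpos _).const_mul _) fun x => ?_
    simp only
    by_cases hx : |x - center n δ j| ≤ 1 / 2 * δ
    · rw [h1 x hx, sub_self, zero_mul, zero_pow two_ne_zero]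
      positivity
    · push Not at hx
      have t1 : (χ x - 1) ^ 2 ≤ 4 := by
        have := abs_le.1 (hB x)
        nlinarith
      have t2 : profile κ (x - center n δ j) ^ 2 ≤
          b ^ 2 * (Real.exp (-(κinf / 2) * δ) * Real.exp (-κinf * |x - center n δ j|)) := by
        refine (pow_le_pow_left₀ (profile_pos _ _).le (hle _) 2).trans ?_
        rw [mul_pow, ← Real.exp_nat_mul, ← Real.exp_add]
        refine mul_le_mul_of_nonneg_left (Real.exp_le_exp.2 ?_) (by positivity)
        push_cast
        nlinarith
      have t3 : ((χ x - 1) * amp κ n δ j x) ^ 2 =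
          (χ x - 1) ^ 2 * (gam κ ^ 2 * profile κ (x - center n δ j) ^ 2) := by
        rw [amp]; ring
      rw [t3]
      calc (χ x - 1) ^ 2 * (gam κ ^ 2 * profile κ (x - center n δ j) ^ 2) ≤
          4 * (gam κ ^ 2 * (b ^ 2 * (Real.exp (-(κinf / 2) * δ) *
            Real.exp (-κinf * |x - center n δ j|)))) := by gcongr
        _ = _ := by ring
  rw [e1]
  have e4 := norm_inner_le_norm (𝕜 := ℂ) (waveVec hmem (wallSpinor j)) f
  have e5 := pow_le_pow_left₀ (norm_nonneg _) e4 2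
  rw [mul_pow, norm_waveVec_sq, norm_wallSpinor_sq] at e5
  refine e5.trans (mul_le_mul_of_nonneg_right ?_ (by positivity))
  linarith

/-- The Dirac operator with `n` domain walls is bounded below by any constant less than `κinf`
on the orthogonal complement of the shifted zero modes, if the walls are far apart. -/
theorem SpectralGap.multi_wall (hgap : SpectralGap κ κinf) (hκ : IsDomainWall κ κinf) {n : ℕ}
    (hn : 1 ≤ n) {c : ℝ} (hc0 : 0 ≤ c) (hc : c < κinf) : ∃ δ₀ : ℝ, ∀ δ, δ₀ < δ → ∀ f h : SpinorL2,
      DiracRel (wallMass κ n δ) f h → (∀ k : Fin n, ⟪hκ.modeVec n δ k, f⟫_ℂ = 0) →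
      c * ‖f‖ ≤ ‖h‖ := by
  obtain ⟨M, hM⟩ := exists_deriv_smoothTransition_bound
  obtain ⟨D, hD, hover⟩ := hκ.exists_overlap_bound
  have hpos := hκ.pos
  have hlim : Tendsto (fun δ : ℝ => κinf ^ 2 - κinf ^ 2 * (n * (D * Real.exp (-(κinf / 2) * δ))) -
      n * (Real.pi * M / δ) ^ 2) atTop (𝓝 (κinf ^ 2 - κinf ^ 2 * (n * (D * 0)) - n * 0 ^ 2)) := by
    refine (tendsto_const_nhds.sub (((Tendsto.const_mul D ?_).const_mul (n : ℝ)).const_mul _)).sub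
      (((tendsto_const_nhds.div_atTop tendsto_id).pow 2).const_mul _)
    refine Real.tendsto_exp_atBot.comp ?_
    exact tendsto_id.const_mul_atTop_of_neg (by linarith)
  have hev := hlim.eventually_const_lt (u := c ^ 2) (by
    have := pow_lt_pow_left₀ hc hc0 two_ne_zero
    simpa using this)
  obtain ⟨δ₀, hδ₀⟩ := (hev.and (eventually_ge_atTop 2)).exists_forall_of_atTop
  refine ⟨δ₀, fun δ hδ f h H h0 => ?_⟩
  obtain ⟨hlt, hδ2⟩ := hδ₀ δ hδ.le
  have hδpos : 0 < δ := by linarith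
  set χ : Fin n → ℝ → ℝ := fun k => cutoff n δ k with hχdef
  have hχ : ∀ k, ContDiff ℝ ∞ (χ k) := fun k => contDiff_cutoff n δ k
  have hB : ∀ k x, |χ k x| ≤ 1 := fun k x => abs_cutoff_le n δ k x
  have hB' : ∀ k x, |deriv (χ k) x| ≤ Real.pi * M / δ := fun k x =>
    abs_deriv_cutoff_le hM n hδpos k x
  have h1 := sum_norm_sq_localized hχ (fun x => sum_cutoff_sq hn hδpos x)
    (fun x => sum_cutoff_mul_deriv hn hδpos x) hB hB' h (Complex.I • sigma3L2 f)
  have h2 := sum_norm_sq_bddSmul (fun k => (hχ k).continuous)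
    (fun x => sum_cutoff_sq hn hδpos x) hB f
  have h3 : ∀ k : Fin n, κinf ^ 2 * (‖bddSmul (hχ k).continuous (hB k) f‖ ^ 2 -
      D * Real.exp (-(κinf / 2) * δ) * ‖f‖ ^ 2) ≤ ‖bddSmul (hχ k).continuous (hB k) h +
      bddSmul (continuous_deriv_test (hχ k)) (hB' k) (Complex.I • sigma3L2 f)‖ ^ 2 := by
    intro k
    have H1 := H.bddSmul (hχ k) (hB k) (hB' k)
    have H2 : DiracRel (singleMass κ n δ k) _ _ := H1.congr_mass (by
      filter_upwards [bddSmul_coe (hχ k).continuous (hB k) f] with x hx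
      by_cases hz : cutoff n δ k x = 0
      · right
        rw [hx]
        simp only [hχdef]
        rw [hz, zero_smul]
      · left
        obtain ⟨s1, s2⟩ := cutoff_support hδpos k.2 hz
        refine hκ.wallMass_eq (by linarith) k.2 (fun hk => ?_) (fun hk => ?_)
        · have := s1 hk; linarith
        · have := s2 hk; linarith)
    refine le_trans ?_ (hgap.single_wall_sq hκ H2)
    have := hover n δ k (χ k) (hχ k).continuous (hB k)
      (fun x hx => cutoff_eq_one hδpos k.2 hx) f (h0 k)
    gcongr
  have h4 := Finset.sum_le_sum fun k (_ : k ∈ Finset.univ) => h3 k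
  rw [← Finset.mul_sum, Finset.sum_sub_distrib, h2] at h4
  have h5 := h4.trans h1
  rw [norm_smul, Complex.norm_I, one_mul, norm_sigma3L2, Fintype.card_fin, Finset.sum_const,
    Finset.card_univ, Fintype.card_fin, nsmul_eq_mul] at h5
  have h6 : (c * ‖f‖) ^ 2 ≤ ‖h‖ ^ 2 := by
    have := mul_le_mul_of_nonneg_right hlt.le (sq_nonneg ‖f‖)
    rw [mul_pow]
    nlinarith
  exact le_of_sq_le_sq h6 (norm_nonneg _)

end IMS

section MatrixElements

open Filter Topology
open scoped InnerProductSpace ComplexConjugate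

variable {κ : ℝ → ℝ} {κinf : ℝ}

lemma abs_center_sub (n : ℕ) {δ : ℝ} (hδ : 0 ≤ δ) (j k : ℕ) :
    |center n δ j - center n δ k| = 2 * |(j : ℝ) - k| * δ := by
  have : center n δ j - center n δ k = -(2 * ((j : ℝ) - k) * δ) := by simp only [center]; ring
  rw [this, abs_neg, abs_mul, abs_mul, abs_of_nonneg hδ, abs_two]

lemma le_abs_sub_of_add_le {d j k : ℕ} (h : j + d ≤ k ∨ k + d ≤ j) : (d : ℝ) ≤ |(j : ℝ) - k| := by
  rcases h with h | h
  · have : (j : ℝ) + d ≤ k := by exact_mod_cast h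
    rw [abs_sub_comm]
    exact (by linarith : (d : ℝ) ≤ k - j).trans (le_abs_self _)
  · have : (k : ℝ) + d ≤ j := by exact_mod_cast h
    exact (by linarith : (d : ℝ) ≤ j - k).trans (le_abs_self _)

/-- The amount by which the mass `m`, up to the sign of the wall, differs from that of the `j`-th wall. -/
def massDefect (κ m : ℝ → ℝ) (n : ℕ) (δ : ℝ) (j : ℕ) (x : ℝ) : ℝ :=
  (-1) ^ j * m x - κ (x - center n δ j)

lemma residual_eq (κ m : ℝ → ℝ) (n : ℕ) (δ : ℝ) (j : ℕ) (x : ℝ) :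
    residual κ m n δ j x = massDefect κ m n δ j x * amp κ n δ j x := rfl

lemma abs_massDefect_le {B : ℝ} (hB : ∀ x, |κ x| ≤ B) (n : ℕ) (δ : ℝ) (j : ℕ) (x : ℝ) :
    |massDefect κ (wallMass κ n δ) n δ j x| ≤ 2 * B := by
  refine (abs_sub _ _).trans ?_
  rw [abs_mul, abs_pow, abs_neg, abs_one, one_pow, one_mul]
  linarith [abs_wallMass_le hB n δ x, hB (x - center n δ j)]

lemma IsDomainWall.massDefect_eq_zero (hκ : IsDomainWall κ κinf) {n : ℕ} {δ : ℝ} (hδ : 1 ≤ δ)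
    {j : ℕ} (hj : j < n) {x : ℝ} (hx : |x - center n δ j| ≤ 2 * δ - 1) :
    massDefect κ (wallMass κ n δ) n δ j x = 0 := by
  rw [abs_le] at hx
  rw [massDefect, hκ.wallMass_eq hδ hj (fun _ => by linarith) (fun _ => by linarith), singleMass,
    ← mul_assoc, ← mul_pow]
  simp

lemma IsDomainWall.measurable_massDefect (hκ : IsDomainWall κ κinf) (n : ℕ) (δ : ℝ) (j : ℕ) :
    Measurable (massDefect κ (wallMass κ n δ) n δ j) :=
  ((hκ.measurable_wallMass n δ).const_mul _).sub
    (hκ.continuous.measurable.comp (measurable_id.sub_const _))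

lemma abs_amp_mul_amp_le {b : ℝ} (hle : ∀ x, profile κ x ≤ b * Real.exp (-κinf * |x|)) (n : ℕ)
    (δ : ℝ) (j k : ℕ) (x : ℝ) : |amp κ n δ j x * amp κ n δ k x| ≤
      gam κ ^ 2 * b ^ 2 * Real.exp (-κinf * (|x - center n δ j| + |x - center n δ k|)) := by
  have e : |amp κ n δ j x * amp κ n δ k x| =
      gam κ ^ 2 * (profile κ (x - center n δ j) * profile κ (x - center n δ k)) := by
    rw [amp, amp, abs_mul, abs_mul, abs_mul, abs_of_pos (profile_pos _ _),
      abs_of_pos (profile_pos _ _), ← sq_abs (gam κ)]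
    ring
  rw [e]
  have h := mul_le_mul (hle (x - center n δ j)) (hle (x - center n δ k)) (profile_pos _ _).le
    ((profile_pos _ _).le.trans (hle _))
  have h2 := mul_le_mul_of_nonneg_left h (sq_nonneg (gam κ))
  refine h2.trans (le_of_eq ?_)
  rw [mul_add, Real.exp_add]
  ring

lemma exp_overlap_le {c a a' L : ℝ} (hc : 0 ≤ c) (h : L ≤ a + a') (ha' : 0 ≤ a') :
    Real.exp (-c * (a + a')) ≤ Real.exp (-c * (2 / 3 * L)) * Real.exp (-(c / 3) * a) := by
  rw [← Real.exp_add]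
  refine Real.exp_le_exp.2 ?_
  nlinarith

/-- Two functions concentrated at walls of distance at least `L` have an overlap of order
`exp (-2 κinf L / 3)`. -/
lemma abs_integral_overlap_le (hpos : 0 < κinf) {b : ℝ}
    (hle : ∀ x, profile κ x ≤ b * Real.exp (-κinf * |x|)) {n : ℕ} {δ L : ℝ} {j k : ℕ}
    (hL : L ≤ |center n δ j - center n δ k|) {r : ℝ → ℝ} {R : ℝ} (hr : ∀ x, |r x| ≤ R) :
    |∫ x, r x * (amp κ n δ j x * amp κ n δ k x)| ≤
      R * gam κ ^ 2 * b ^ 2 * expInt (κinf / 3) * Real.exp (-κinf * (2 / 3 * L)) := by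
  have hR : 0 ≤ R := (abs_nonneg _).trans (hr 0)
  have hi := (integrable_exp_neg_abs_sub (c := κinf / 3) (by positivity)
    (center n δ j)).const_mul (R * (gam κ ^ 2 * b ^ 2 * Real.exp (-κinf * (2 / 3 * L))))
  have h := norm_integral_le_of_norm_le hi
    (f := fun x => r x * (amp κ n δ j x * amp κ n δ k x)) (Eventually.of_forall fun x => by
      rw [norm_mul, Real.norm_eq_abs, Real.norm_eq_abs, mul_assoc R]
      refine mul_le_mul (hr x) ?_ (abs_nonneg _) hR
      refine (abs_amp_mul_amp_le hle n δ j k x).trans ?_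
      rw [mul_assoc (gam κ ^ 2 * b ^ 2)]
      refine mul_le_mul_of_nonneg_left (exp_overlap_le hpos.le ?_ (abs_nonneg _)) (by positivity)
      refine hL.trans ?_
      have := abs_sub_le (center n δ j) x (center n δ k)
      rwa [abs_sub_comm (center n δ j) x] at this)
  rw [integral_const_mul, integral_exp_neg_abs_sub] at h
  rw [Real.norm_eq_abs] at h
  refine h.trans (le_of_eq ?_)
  ring

/-- The shifted zero modes are almost orthonormal. -/
lemma IsDomainWall.exists_gram_bound (hκ : IsDomainWall κ κinf) : ∃ A, 0 ≤ A ∧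
    ∀ (n : ℕ) (δ : ℝ), 1 ≤ δ → ∀ j k : ℕ, ‖⟪hκ.modeVec n δ j, hκ.modeVec n δ k⟫_ℂ -
      if j = k then 1 else 0‖ ≤ A * Real.exp (-2 * κinf * δ) := by
  obtain ⟨b, hb, hle⟩ := hκ.exists_profile_le
  have hpos := hκ.pos
  have hI := expInt_nonneg (κinf / 3)
  refine ⟨2 * (1 * gam κ ^ 2 * b ^ 2 * expInt (κinf / 3)), by positivity, ?_⟩
  intro n δ hδ j k
  by_cases hjk : j = k
  · subst hjk
    rw [if_pos rfl, inner_self_eq_norm_sq_to_K, hκ.norm_modeVec]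
    simp
    positivity
  rw [if_neg hjk, sub_zero, modeVec, modeVec, inner_waveVec, inner_wallSpinor, norm_mul,
    Complex.norm_real, Real.norm_eq_abs]
  rcases Nat.even_or_odd (j + k) with h | h
  · have hd : (2 : ℕ) ≤ |(j : ℝ) - k| := le_abs_sub_of_add_le (by
      obtain ⟨r, hr⟩ := h
      omega)
    push_cast at hd
    have hL : 4 * δ ≤ |center n δ j - center n δ k| := by
      rw [abs_center_sub n (by linarith)]
      nlinarith
    have h1 := abs_integral_overlap_le hpos hle hL (r := fun _ => 1) (R := 1) (fun _ => by simp)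
    simp only [one_mul] at h1
    rw [h.neg_one_pow]
    have h2 : Real.exp (-κinf * (2 / 3 * (4 * δ))) ≤ Real.exp (-2 * κinf * δ) :=
      Real.exp_le_exp.2 (by nlinarith)
    have h3 : ‖(1 + 1 : ℂ)‖ = 2 := by norm_num
    rw [h3, mul_comm, one_mul, mul_assoc]
    refine mul_le_mul_of_nonneg_left (h1.trans ?_) (by norm_num)
    gcongr
  · rw [h.neg_one_pow]
    simp
    positivity

lemma exp_tail_le {c L y a : ℝ} (h : L ≤ |y - a|) :
    Real.exp (-c * |y - a|) ≤ Real.exp (-c * L) *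
      (Real.exp (-c * |y - (a + L)|) + Real.exp (-c * |y - (a - L)|)) := by
  rw [mul_add, ← Real.exp_add, ← Real.exp_add]
  rcases le_total 0 (y - a) with h0 | h0
  · rw [abs_of_nonneg h0] at h ⊢
    have : Real.exp (-c * (y - a)) = Real.exp (-c * L + -c * |y - (a + L)|) := by
      rw [abs_of_nonneg (by linarith)]; congr 1; ring
    rw [this]
    exact le_add_of_nonneg_right (Real.exp_pos _).le
  · rw [abs_of_nonpos h0] at h ⊢
    have : Real.exp (-c * -(y - a)) = Real.exp (-c * L + -c * |y - (a - L)|) := by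
      rw [abs_of_nonpos (by linarith)]; congr 1; ring
    rw [this]
    exact le_add_of_nonneg_left (Real.exp_pos _).le

/-- The image of the `j`-th shifted zero mode under the Dirac operator with `n` walls. -/
def IsDomainWall.imageVec (hκ : IsDomainWall κ κinf) (n : ℕ) (δ : ℝ) (j : ℕ) : SpinorL2 :=
  Complex.I • waveVec (hκ.memLp_residual n δ j (hκ.measurable_wallMass n δ)
    (abs_wallMass_le hκ.exists_bound.choose_spec.2 n δ)) (wallSpinor (j + 1))

lemma IsDomainWall.diracRel_imageVec (hκ : IsDomainWall κ κinf) (n : ℕ) (δ : ℝ) (j : ℕ) :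
    DiracRel (wallMass κ n δ) (hκ.modeVec n δ j) (hκ.imageVec n δ j) :=
  hκ.diracRel_modeVec n δ j (hκ.measurable_wallMass n δ)
    (abs_wallMass_le hκ.exists_bound.choose_spec.2 n δ)

/-- The shifted zero modes are almost zero modes. -/
lemma IsDomainWall.exists_image_bound (hκ : IsDomainWall κ κinf) : ∃ A, 0 ≤ A ∧
    ∀ (n : ℕ) (δ : ℝ), 1 ≤ δ → ∀ j : ℕ, j < n →
      ‖hκ.imageVec n δ j‖ ≤ A * Real.exp (-2 * κinf * δ) := by
  obtain ⟨b, hb, hle⟩ := hκ.exists_profile_le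
  obtain ⟨B, hB0, hB⟩ := hκ.exists_bound
  have hpos := hκ.pos
  have hI := expInt_nonneg (2 * κinf)
  set A₂ := (2 * B) ^ 2 * (gam κ ^ 2 * b ^ 2 * Real.exp (2 * κinf)) * (expInt (2 * κinf) +
    expInt (2 * κinf)) * 2 with hA₂
  have hA₂0 : 0 ≤ A₂ := by positivity
  refine ⟨√A₂, Real.sqrt_nonneg _, ?_⟩
  intro n δ hδ j hj
  have hmain : ∫ x, residual κ (wallMass κ n δ) n δ j x ^ 2 ≤
      (2 * B) ^ 2 * (gam κ ^ 2 * b ^ 2 * Real.exp (2 * κinf)) * Real.exp (-2 * κinf * δ) ^ 2 *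
      (expInt (2 * κinf) + expInt (2 * κinf)) := by
    set L := 2 * δ - 1 with hL
    have i1 := integrable_exp_neg_abs_sub (c := 2 * κinf) (by positivity) (center n δ j + L)
    have i2 := integrable_exp_neg_abs_sub (c := 2 * κinf) (by positivity) (center n δ j - L)
    conv_rhs => rw [← integral_exp_neg_abs_sub (2 * κinf) (center n δ j + L)]
    conv_rhs =>
      enter [2, 2]
      rw [integral_exp_neg_abs_sub (2 * κinf) (center n δ j + L),
        ← integral_exp_neg_abs_sub (2 * κinf) (center n δ j - L)]
    rw [← integral_add i1 i2, ← integral_const_mul]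
    refine integral_mono (hκ.memLp_residual n δ j (hκ.measurable_wallMass n δ)
      (abs_wallMass_le hB n δ)).integrable_sq ((i1.add i2).const_mul _) fun x => ?_
    simp only
    by_cases hx : |x - center n δ j| ≤ L
    · rw [residual_eq, hκ.massDefect_eq_zero hδ hj hx]
      simp only [zero_mul, ne_eq, OfNat.ofNat_ne_zero, not_false_eq_true, zero_pow]
      positivity
    · push Not at hx
      have t1 : massDefect κ (wallMass κ n δ) n δ j x ^ 2 ≤ (2 * B) ^ 2 :=
        sq_le_sq' (abs_le.1 (abs_massDefect_le hB n δ j x)).1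
          (abs_le.1 (abs_massDefect_le hB n δ j x)).2
      have t2 := abs_amp_mul_amp_le hle n δ j j x
      have t3 := exp_tail_le (c := 2 * κinf) hx.le
      have t4 : Real.exp (-(2 * κinf) * L) =
          Real.exp (2 * κinf) * Real.exp (-2 * κinf * δ) ^ 2 := by
        rw [← Real.exp_nat_mul, ← Real.exp_add]
        congr 1
        push_cast
        rw [hL]; ring
      have t5 : -κinf * (|x - center n δ j| + |x - center n δ j|) =
          -(2 * κinf) * |x - center n δ j| := by ring
      rw [t5, abs_of_nonneg (mul_self_nonneg _), ← pow_two] at t2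
      rw [t4] at t3
      rw [residual_eq, mul_pow]
      calc massDefect κ (wallMass κ n δ) n δ j x ^ 2 * amp κ n δ j x ^ 2 ≤
          (2 * B) ^ 2 * (gam κ ^ 2 * b ^ 2 * Real.exp (-(2 * κinf) * |x - center n δ j|)) := by
            gcongr
        _ ≤ (2 * B) ^ 2 * (gam κ ^ 2 * b ^ 2 * (Real.exp (2 * κinf) *
            Real.exp (-2 * κinf * δ) ^ 2 * (Real.exp (-(2 * κinf) * |x - (center n δ j + L)|) +
            Real.exp (-(2 * κinf) * |x - (center n δ j - L)|)))) := by gcongr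
        _ = _ := by ring
  have h1 : ‖hκ.imageVec n δ j‖ ^ 2 ≤ A₂ * Real.exp (-2 * κinf * δ) ^ 2 := by
    rw [imageVec, norm_smul, Complex.norm_I, one_mul, norm_waveVec_sq, norm_wallSpinor_sq]
    refine (mul_le_mul_of_nonneg_right hmain (by norm_num)).trans (le_of_eq ?_)
    rw [hA₂]; ring
  refine le_of_sq_le_sq ?_ (by positivity)
  rw [mul_pow, Real.sq_sqrt hA₂0]
  exact h1

end MatrixElements

section Hopping

open Filter Topology
open scoped InnerProductSpace ComplexConjugate

variable {κ : ℝ → ℝ} {κinf : ℝ}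

lemma amp_mul_amp_le_of_sub {b : ℝ} (hpos : 0 < κinf)
    (hle : ∀ x, profile κ x ≤ b * Real.exp (-κinf * |x|)) (n : ℕ) (δ : ℝ) {j k : ℕ} {x y : ℝ}
    (h : 4 * δ + 2 * |x - y| ≤ |x - center n δ j| + |x - center n δ k|) :
    |amp κ n δ j x * amp κ n δ k x| ≤ gam κ ^ 2 * b ^ 2 * Real.exp (-2 * κinf * δ) ^ 2 *
      Real.exp (-(2 * κinf) * |x - y|) := by
  refine (abs_amp_mul_amp_le hle n δ j k x).trans ?_
  rw [mul_assoc (gam κ ^ 2 * b ^ 2), ← Real.exp_nat_mul, ← Real.exp_add]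
  refine mul_le_mul_of_nonneg_left (Real.exp_le_exp.2 ?_) (by positivity)
  push_cast
  nlinarith

lemma abs_setIntegral_le_of_le_exp {S : Set ℝ} (hS : MeasurableSet S) {f : ℝ → ℝ} {M c y : ℝ}
    (hM : 0 ≤ M) (hc : 0 < c) (h : ∀ x ∈ S, |f x| ≤ M * Real.exp (-c * |x - y|)) :
    |∫ x in S, f x| ≤ M * expInt c := by
  have hi := (integrable_exp_neg_abs_sub hc y).const_mul M
  have h1 := norm_integral_le_of_norm_le (μ := volume.restrict S) (f := f) hi.integrableOn
    ((ae_restrict_iff' hS).2 (Eventually.of_forall h))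
  refine h1.trans ((setIntegral_le_integral hi (Eventually.of_forall fun x => ?_)).trans ?_)
  · positivity
  · rw [integral_const_mul, integral_exp_neg_abs_sub]

lemma IsDomainWall.two_mul_amp_mul_amp_mid (hκ : IsDomainWall κ κinf) (n : ℕ) (δ : ℝ) (k : ℕ) :
    2 * (amp κ n δ k (center n δ k - δ) * amp κ n δ (k + 1) (center n δ k - δ)) =
      hopping κ δ := by
  have e1 : center n δ k - δ - center n δ k = -δ := by ring
  have e2 : center n δ k - δ - center n δ (k + 1) = δ := by rw [center_succ]; ring
  rw [amp, amp, e1, e2, hκ.profile_neg, hopping, profile]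
  have : Real.exp (-2 * ∫ y in (0 : ℝ)..δ, κ y) = Real.exp (-∫ y in (0 : ℝ)..δ, κ y) ^ 2 := by
    rw [← Real.exp_nat_mul]; congr 1; push_cast; ring
  rw [this]
  ring

lemma IsDomainWall.integrable_mul_amp_mul_amp (hκ : IsDomainWall κ κinf) (n : ℕ) (δ : ℝ)
    (j k : ℕ) {r : ℝ → ℝ} (hr : Measurable r) {R : ℝ} (hR : ∀ x, |r x| ≤ R) :
    Integrable fun x => r x * (amp κ n δ j x * amp κ n δ k x) := by
  have := (hκ.memLp_mul_amp n δ j hr hR).integrable_mul (hκ.memLp_amp n δ k)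
  refine this.congr (Eventually.of_forall fun x => ?_)
  simp only [Pi.mul_apply, mul_assoc]

/-- The derivative of the product of two amplitudes integrates to its boundary value. -/
lemma IsDomainWall.integral_Iic_amp_mul_amp (hκ : IsDomainWall κ κinf) (n : ℕ) (δ : ℝ)
    (j k : ℕ) (z : ℝ) :
    ∫ x in Set.Iic z, -(κ (x - center n δ j) + κ (x - center n δ k)) *
      (amp κ n δ j x * amp κ n δ k x) = amp κ n δ j z * amp κ n δ k z := by
  obtain ⟨B, -, hB⟩ := hκ.exists_bound
  have hm : ∀ i, Measurable fun x => κ (x - center n δ i) := fun i =>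
    hκ.continuous.measurable.comp (measurable_id.sub_const _)
  have hi := hκ.integrable_mul_amp_mul_amp n δ j k
    (r := fun x => -(κ (x - center n δ j) + κ (x - center n δ k))) ((hm j).add (hm k)).neg
    (R := B + B) fun x => by
      rw [abs_neg]
      exact (abs_add_le _ _).trans (add_le_add (hB _) (hB _))
  have hF : Integrable fun x => amp κ n δ j x * amp κ n δ k x :=
    (hκ.memLp_amp n δ j).integrable_mul (hκ.memLp_amp n δ k)
  have hd : ∀ x, HasDerivAt (fun x => amp κ n δ j x * amp κ n δ k x)
      (-(κ (x - center n δ j) + κ (x - center n δ k)) * (amp κ n δ j x * amp κ n δ k x)) x := by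
    intro x
    refine ((hκ.hasDerivAt_amp n δ j x).mul (hκ.hasDerivAt_amp n δ k x)).congr_deriv ?_
    ring
  have ht := tendsto_zero_of_hasDerivAt_of_integrableOn_Iic (a := z) (fun x _ => hd x)
    hi.integrableOn hF.integrableOn
  rw [integral_Iic_of_hasDerivAt_of_tendsto' (fun x _ => hd x) hi.integrableOn ht, sub_zero]

/-- The overlap of neighbouring walls. -/
lemma IsDomainWall.abs_integral_massDefect_sub_le (hκ : IsDomainWall κ κinf) {b : ℝ}
    (hle : ∀ x, profile κ x ≤ b * Real.exp (-κinf * |x|)) {B : ℝ} (hB : ∀ x, |κ x| ≤ B)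
    {n : ℕ} {δ : ℝ} (hδ : 1 ≤ δ) {k : ℕ} (hk : k + 1 < n) :
    |2 * (∫ x, massDefect κ (wallMass κ n δ) n δ k x * (amp κ n δ k x * amp κ n δ (k + 1) x)) -
      hopping κ δ| ≤ 8 * B * gam κ ^ 2 * b ^ 2 * expInt (2 * κinf) *
        Real.exp (-2 * κinf * δ) ^ 2 := by
  have hpos := hκ.pos
  have hB0 : 0 ≤ B := (abs_nonneg _).trans (hB 0)
  set F : ℝ → ℝ := fun x => amp κ n δ k x * amp κ n δ (k + 1) x with hF
  set D : ℕ → ℝ → ℝ := fun j x => massDefect κ (wallMass κ n δ) n δ j x with hD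
  set z := center n δ k - δ with hz
  have hDi : ∀ j, Integrable fun x => D j x * F x := fun j =>
    hκ.integrable_mul_amp_mul_amp n δ k (k + 1) (hκ.measurable_massDefect n δ j)
      (abs_massDefect_le hB n δ j)
  set M := 2 * B * (gam κ ^ 2 * b ^ 2 * Real.exp (-2 * κinf * δ) ^ 2) with hM
  have hM0 : 0 ≤ M := by positivity
  have hc := center_succ n δ k
  have bound : ∀ (j : ℕ) (x y : ℝ), 4 * δ + 2 * |x - y| ≤
      |x - center n δ k| + |x - center n δ (k + 1)| →
      |D j x * F x| ≤ M * Real.exp (-(2 * κinf) * |x - y|) := by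
    intro j x y h
    rw [abs_mul, hM, mul_assoc (2 * B)]
    exact mul_le_mul (abs_massDefect_le hB n δ j x) (amp_mul_amp_le_of_sub hpos hle n δ h)
      (abs_nonneg _) (by positivity)
  have h1 : |∫ x in Set.Iic z, D (k + 1) x * F x| ≤ M * expInt (2 * κinf) := by
    refine abs_setIntegral_le_of_le_exp measurableSet_Iic (y := center n δ (k + 1) - δ) hM0
      (by positivity) fun x hx => ?_
    rw [Set.mem_Iic] at hx
    by_cases h0 : |x - center n δ (k + 1)| ≤ 2 * δ - 1
    · simp only [hD, hκ.massDefect_eq_zero hδ hk h0, zero_mul, abs_zero]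
      positivity
    · have hx' : x < center n δ (k + 1) - δ := by
        by_contra hcon
        exact h0 (abs_le.2 ⟨by linarith, by linarith⟩)
      refine bound _ _ _ (le_of_eq ?_)
      rw [abs_of_nonpos (by linarith), abs_of_nonpos (by linarith), abs_of_nonpos (by linarith)]
      linarith
  have h2 : |∫ x in Set.Ioi z, D k x * F x| ≤ M * expInt (2 * κinf) := by
    refine abs_setIntegral_le_of_le_exp measurableSet_Ioi (y := center n δ k + δ) hM0
      (by positivity) fun x hx => ?_
    rw [Set.mem_Ioi] at hx
    by_cases h0 : |x - center n δ k| ≤ 2 * δ - 1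
    · simp only [hD, hκ.massDefect_eq_zero hδ (by omega : k < n) h0, zero_mul, abs_zero]
      positivity
    · have hx' : center n δ k + δ < x := by
        by_contra hcon
        exact h0 (abs_le.2 ⟨by linarith, by linarith⟩)
      refine bound _ _ _ (le_of_eq ?_)
      rw [abs_of_nonneg (by linarith), abs_of_nonneg (by linarith), abs_of_nonneg (by linarith)]
      linarith
  have h3 : ∫ x in Set.Iic z, D k x * F x =
      F z - ∫ x in Set.Iic z, D (k + 1) x * F x := by
    rw [eq_sub_iff_add_eq, ← integral_add (hDi k).integrableOn (hDi (k + 1)).integrableOn]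
    refine Eq.trans ?_ (hκ.integral_Iic_amp_mul_amp n δ k (k + 1) z)
    refine integral_congr_ae (Eventually.of_forall fun x => ?_)
    simp only [hD, hF, massDefect, pow_succ]
    ring
  have h4 := intervalIntegral.integral_Iic_add_Ioi (b := z) (hDi k).integrableOn
    (hDi k).integrableOn
  rw [← hκ.two_mul_amp_mul_amp_mid n δ k]
  change |2 * (∫ x, D k x * F x) - 2 * F z| ≤ _
  rw [← h4, h3]
  have e : 2 * (F z - (∫ x in Set.Iic z, D (k + 1) x * F x) + ∫ x in Set.Ioi z, D k x * F x) -
      2 * F z = 2 * (∫ x in Set.Ioi z, D k x * F x) -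
      2 * ∫ x in Set.Iic z, D (k + 1) x * F x := by ring
  rw [e]
  refine (abs_sub _ _).trans ?_
  rw [abs_mul, abs_mul, abs_two]
  have e2 : 8 * B * gam κ ^ 2 * b ^ 2 * expInt (2 * κinf) * Real.exp (-2 * κinf * δ) ^ 2 =
      2 * (M * expInt (2 * κinf)) + 2 * (M * expInt (2 * κinf)) := by rw [hM]; ring
  rw [e2]
  linarith

lemma IsDomainWall.inner_modeVec_imageVec (hκ : IsDomainWall κ κinf) (n : ℕ) (δ : ℝ) (j k : ℕ) :
    ⟪hκ.modeVec n δ j, hκ.imageVec n δ k⟫_ℂ = Complex.I *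
      (((∫ x, massDefect κ (wallMass κ n δ) n δ k x * (amp κ n δ k x * amp κ n δ j x) : ℝ) : ℂ) *
        (1 + (-1) ^ (j + (k + 1)))) := by
  rw [modeVec, imageVec, inner_smul_right, inner_waveVec, inner_wallSpinor]
  suffices e : ∫ x, amp κ n δ j x * residual κ (wallMass κ n δ) n δ k x =
      ∫ x, massDefect κ (wallMass κ n δ) n δ k x * (amp κ n δ k x * amp κ n δ j x) by
    rw [e]
  refine integral_congr_ae (Eventually.of_forall fun x => ?_)
  simp only [residual_eq]
  ring

lemma IsDomainWall.inner_imageVec_symm (hκ : IsDomainWall κ κinf) (n : ℕ) (δ : ℝ) (j k : ℕ) :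
    ⟪hκ.modeVec n δ j, hκ.imageVec n δ k⟫_ℂ = conj ⟪hκ.modeVec n δ k, hκ.imageVec n δ j⟫_ℂ := by
  obtain ⟨B, -, hB⟩ := hκ.exists_bound
  have h := (isSelfAdjointRel_diracGraph (hκ.measurable_wallMass n δ)
    (abs_wallMass_le hB n δ)).symm (hκ.modeVec n δ j, hκ.imageVec n δ j)
    (hκ.diracRel_imageVec n δ j) (hκ.modeVec n δ k, hκ.imageVec n δ k) (hκ.diracRel_imageVec n δ k)
  rw [inner_conj_symm]
  exact h.symm

/-- The matrix elements of the Dirac operator between shifted zero modes are those of `M₀(δ)` up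
to errors of second order. -/
lemma IsDomainWall.exists_hopping_bound (hκ : IsDomainWall κ κinf) : ∃ A, 0 ≤ A ∧
    ∀ (n : ℕ) (δ : ℝ), 1 ≤ δ → ∀ j k : Fin n,
      ‖⟪hκ.modeVec n δ j, hκ.imageVec n δ k⟫_ℂ - matrixM0 κ n δ j k‖ ≤
        A * Real.exp (-2 * κinf * δ) ^ 2 := by
  obtain ⟨b, hb, hle⟩ := hκ.exists_profile_le
  obtain ⟨B, hB0, hB⟩ := hκ.exists_bound
  have hpos := hκ.pos
  have hI := expInt_nonneg (2 * κinf)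
  have hI' := expInt_nonneg (κinf / 3)
  set A₁ := 8 * B * gam κ ^ 2 * b ^ 2 * expInt (2 * κinf) with hA₁
  set A₂ := 2 * (2 * B * gam κ ^ 2 * b ^ 2 * expInt (κinf / 3)) with hA₂
  have hA₁0 : 0 ≤ A₁ := by positivity
  have hA₂0 : 0 ≤ A₂ := by positivity
  refine ⟨A₁ + A₂, by positivity, ?_⟩
  intro n δ hδ j k
  have hε := sq_nonneg (Real.exp (-2 * κinf * δ))
  have below : ∀ j k : Fin n, (j : ℕ) = k + 1 →
      ‖⟪hκ.modeVec n δ j, hκ.imageVec n δ k⟫_ℂ - Complex.I * (hopping κ δ : ℂ)‖ ≤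
        A₁ * Real.exp (-2 * κinf * δ) ^ 2 := by
    intro j k h
    have hjn := j.2
    rw [h] at hjn
    have h1 := hκ.abs_integral_massDefect_sub_le hle hB hδ hjn
    rw [hκ.inner_modeVec_imageVec, h, Even.neg_one_pow ⟨(k : ℕ) + 1, rfl⟩]
    refine le_trans (le_of_eq ?_) h1
    rw [← Real.norm_eq_abs, ← Complex.norm_real, ← mul_sub, norm_mul, Complex.norm_I, one_mul]
    congr 1
    push_cast
    ring
  have h2 : A₁ * Real.exp (-2 * κinf * δ) ^ 2 ≤ (A₁ + A₂) * Real.exp (-2 * κinf * δ) ^ 2 := by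
    nlinarith
  rw [matrixM0]
  split_ifs with hkj hjk
  · refine le_trans (le_of_eq ?_) ((below k j hkj).trans h2)
    rw [hκ.inner_imageVec_symm, ← Complex.norm_conj]
    congr 1
    simp [sub_eq_add_neg]
  · exact (below j k hjk).trans h2
  · rw [sub_zero, hκ.inner_modeVec_imageVec, norm_mul, Complex.norm_I, one_mul, norm_mul,
      Complex.norm_real, Real.norm_eq_abs]
    rcases Nat.even_or_odd ((j : ℕ) + (k + 1)) with h | h
    · have hd : (3 : ℕ) ≤ |((k : ℕ) : ℝ) - (j : ℕ)| := le_abs_sub_of_add_le (by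
        obtain ⟨r, hr⟩ := h
        omega)
      push_cast at hd
      have hL : 6 * δ ≤ |center n δ k - center n δ j| := by
        rw [abs_center_sub n (by linarith)]
        nlinarith
      have h1 := abs_integral_overlap_le hpos hle hL
        (r := massDefect κ (wallMass κ n δ) n δ k) (R := 2 * B) (abs_massDefect_le hB n δ k)
      have e : Real.exp (-κinf * (2 / 3 * (6 * δ))) = Real.exp (-2 * κinf * δ) ^ 2 := by
        rw [← Real.exp_nat_mul]; congr 1; push_cast; ring
      have h3 : ‖(1 + 1 : ℂ)‖ = 2 := by norm_num
      rw [e] at h1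
      rw [h.neg_one_pow, h3]
      refine (mul_le_mul_of_nonneg_right h1 (by norm_num)).trans ?_
      rw [hA₂]
      nlinarith
    · rw [h.neg_one_pow]
      simp only [add_neg_cancel, norm_zero, mul_zero]
      positivity

end Hopping

section HoppingMatrix

open Filter Topology
open scoped InnerProductSpace ComplexConjugate

/-- The tridiagonal matrix with hopping coefficient `h`. -/
def hopMatrix (n : ℕ) (h : ℝ) : Matrix (Fin n) (Fin n) ℂ := fun i j =>
  if (j : ℕ) = i + 1 then -(Complex.I * (h : ℂ))
  else if (i : ℕ) = j + 1 then Complex.I * (h : ℂ)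
  else 0

lemma matrixM0_eq (κ : ℝ → ℝ) (n : ℕ) (δ : ℝ) : matrixM0 κ n δ = hopMatrix n (hopping κ δ) := rfl

lemma hopMatrix_mul (n : ℕ) (ε h : ℝ) : hopMatrix n (h * ε) = (ε : ℂ) • hopMatrix n h := by
  ext i j
  simp only [hopMatrix, Matrix.smul_apply, smul_eq_mul]
  split_ifs <;> push_cast <;> ring

lemma isHermitian_hopMatrix (n : ℕ) (h : ℝ) : (hopMatrix n h).IsHermitian := by
  ext i j
  simp only [hopMatrix, Matrix.conjTranspose_apply]
  split_ifs <;> first | omega | simp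

/-- An eigenvector of the tridiagonal matrix is determined by its first component. -/
lemma eq_zero_of_hopMatrix_mulVec {n : ℕ} {h : ℝ} (hh : h ≠ 0) {z : ℂ} {w : Fin n → ℂ}
    (hw : (hopMatrix n h).mulVec w = z • w) (h0 : ∀ i : Fin n, (i : ℕ) = 0 → w i = 0) : w = 0 := by
  have key : ∀ m : ℕ, ∀ i : Fin n, (i : ℕ) ≤ m → w i = 0 := by
    intro m
    induction m with
    | zero => exact fun i hi => h0 i (by omega)
    | succ m ih =>
      intro i hi
      rcases hi.lt_or_eq with hlt | heq
      · exact ih i (by omega)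
      · have him := i.2
        set r : Fin n := ⟨m, by omega⟩ with hr
        have hrow := congrFun hw r
        rw [Pi.smul_apply, ih r le_rfl, smul_zero, Matrix.mulVec, dotProduct,
          Finset.sum_eq_single i] at hrow
        · have hri : hopMatrix n h r i = -(Complex.I * (h : ℂ)) := if_pos heq
          rw [hri, neg_mul, neg_eq_zero] at hrow
          simpa [hh] using hrow
        · intro j _ hj
          by_cases hjm : (j : ℕ) ≤ m
          · rw [ih j hjm, mul_zero]
          · have hji : (j : ℕ) ≠ i := fun e => hj (Fin.ext e)
            have : hopMatrix n h r j = 0 := by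
              rw [hopMatrix, if_neg (by simp only [hr]; omega), if_neg (by simp only [hr]; omega)]
            rw [this, zero_mul]
        · exact fun hni => absurd (Finset.mem_univ i) hni
  funext i
  exact key i i le_rfl

lemma injective_of_hopMatrix_mulVec {n : ℕ} {h : ℝ} (hh : h ≠ 0) {μ : Fin n → ℝ}
    (v : OrthonormalBasis (Fin n) ℂ (EuclideanSpace ℂ (Fin n)))
    (hv : ∀ l, (hopMatrix n h).mulVec (v l).ofLp = (μ l : ℂ) • (v l).ofLp) :
    Function.Injective μ := by
  intro l l' hll
  by_contra hne
  set r : Fin n := ⟨0, by have := l.2; omega⟩ with hr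
  have hw : v l' r • v l - v l r • v l' = 0 := by
    have := eq_zero_of_hopMatrix_mulVec hh (z := (μ l : ℂ))
      (w := (v l' r • v l - v l r • v l').ofLp) (by
        rw [WithLp.ofLp_sub, WithLp.ofLp_smul, WithLp.ofLp_smul, Matrix.mulVec_sub,
          Matrix.mulVec_smul, Matrix.mulVec_smul, hv, hv, ← hll, smul_sub, smul_comm (v l' r),
          smul_comm (v l r)]) (fun i hi => by
        have : i = r := Fin.ext hi
        rw [this]
        simp [mul_comm])
    exact WithLp.ofLp_injective 2 this
  have horth := v.orthonormal.2
  have h1 : v l r = 0 := by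
    have := congrArg (fun x => ⟪v l', x⟫_ℂ) hw
    simpa [inner_sub_right, inner_smul_right, horth (Ne.symm hne), v.orthonormal.1 l',
      inner_self_eq_norm_sq_to_K] using this
  have h2 : (v l).ofLp = 0 := eq_zero_of_hopMatrix_mulVec hh (hv l) (fun i hi => by
    have : i = r := Fin.ext hi
    rw [this]; exact h1)
  have h3 : v l = 0 := WithLp.ofLp_injective 2 h2
  have h4 := v.orthonormal.1 l
  rw [h3, norm_zero] at h4
  exact zero_ne_one h4

lemma exists_hopMatrix_eigenbasis (n : ℕ) {h : ℝ} (hh : h ≠ 0) :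
    ∃ (μ : Fin n → ℝ) (v : OrthonormalBasis (Fin n) ℂ (EuclideanSpace ℂ (Fin n))),
      StrictMono μ ∧ ∀ l, (hopMatrix n h).mulVec (v l).ofLp = (μ l : ℂ) • (v l).ofLp := by
  set hJ := isHermitian_hopMatrix n h
  set σ := Tuple.sort hJ.eigenvalues
  have hv : ∀ l, (hopMatrix n h).mulVec ((hJ.eigenvectorBasis.reindex σ.symm) l).ofLp =
      ((hJ.eigenvalues (σ l) : ℝ) : ℂ) • ((hJ.eigenvectorBasis.reindex σ.symm) l).ofLp := by
    intro l
    rw [OrthonormalBasis.reindex_apply, Equiv.symm_symm, hJ.mulVec_eigenvectorBasis]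
    rfl
  exact ⟨fun l => hJ.eigenvalues (σ l), hJ.eigenvectorBasis.reindex σ.symm,
    (Tuple.monotone_sort hJ.eigenvalues).strictMono_of_injective
      (injective_of_hopMatrix_mulVec hh _ hv), hv⟩

lemma exists_gap_of_injective {n : ℕ} {μ : Fin n → ℝ} (hμ : Function.Injective μ) :
    ∃ g, 0 < g ∧ ∀ l l', l ≠ l' → g ≤ |μ l - μ l'| := by
  rcases (Finset.univ.offDiag : Finset (Fin n × Fin n)).eq_empty_or_nonempty with h | h
  · refine ⟨1, one_pos, fun l l' hl => ?_⟩
    have : (l, l') ∈ (Finset.univ.offDiag : Finset (Fin n × Fin n)) := by simpa using hl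
    simp [h] at this
  · obtain ⟨p, hp, hmin⟩ := Finset.exists_min_image _ (fun p => |μ p.1 - μ p.2|) h
    refine ⟨|μ p.1 - μ p.2|, abs_pos.2 (sub_ne_zero.2 fun e => ?_), fun l l' hl =>
      hmin (l, l') (by simpa using hl)⟩
    have := hμ e
    simp [this] at hp

lemma hasEigenvalue_toLin'_iff {n : ℕ} {M : Matrix (Fin n) (Fin n) ℂ} {ν : Fin n → ℂ}
    (v : OrthonormalBasis (Fin n) ℂ (EuclideanSpace ℂ (Fin n)))
    (hv : ∀ l, M.mulVec (v l).ofLp = ν l • (v l).ofLp) (z : ℂ) :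
    Module.End.HasEigenvalue (Matrix.toLin' M) z ↔ ∃ j, z = ν j := by
  constructor
  · intro hz
    obtain ⟨w, hw⟩ := hz.exists_hasEigenvector
    have hMw : M.mulVec w = z • w := by simpa using hw.apply_eq_smul
    set c := v.repr (WithLp.toLp 2 w) with hc
    have hsum : w = ∑ l, c l • (v l).ofLp := by
      have := congrArg WithLp.ofLp (v.sum_repr (WithLp.toLp 2 w))
      rw [WithLp.ofLp_sum] at this
      exact this.symm
    have h1 : ∑ l, (c l * (ν l - z)) • v l = 0 := by
      apply WithLp.ofLp_injective 2
      have : M.mulVec w - z • w = 0 := by rw [hMw, sub_self]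
      rw [hsum, Matrix.mulVec_sum, Finset.smul_sum, ← Finset.sum_sub_distrib] at this
      rw [WithLp.ofLp_sum, WithLp.ofLp_zero, ← this]
      refine Finset.sum_congr rfl fun l _ => ?_
      rw [Matrix.mulVec_smul, hv, WithLp.ofLp_smul, smul_smul, smul_smul, ← sub_smul]
      congr 1
      ring
    have h2 := Fintype.linearIndependent_iff.1 v.orthonormal.linearIndependent _ h1
    by_contra hcon
    push Not at hcon
    refine hw.2 ?_
    rw [hsum]
    refine Finset.sum_eq_zero fun l _ => ?_
    rcases mul_eq_zero.1 (h2 l) with h | h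
    · rw [h, zero_smul]
    · exact absurd (sub_eq_zero.1 h).symm (hcon l)
  · rintro ⟨j, rfl⟩
    refine Module.End.hasEigenvalue_of_hasEigenvector (x := (v j).ofLp)
      (Module.End.hasEigenvector_iff.2 ⟨Module.End.mem_eigenspace_iff.2 (by simpa using hv j), ?_⟩)
    intro h0
    have h3 : v j = 0 := WithLp.ofLp_injective 2 h0
    have h4 := v.orthonormal.1 j
    rw [h3, norm_zero] at h4
    exact zero_ne_one h4

end HoppingMatrix

section NearlyOrthonormal

open scoped InnerProductSpace ComplexConjugate

variable {H : Type*} [NormedAddCommGroup H] [InnerProductSpace ℂ H]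

lemma sq_sum_norm_le {n : ℕ} (c : Fin n → ℂ) : (∑ k, ‖c k‖) ^ 2 ≤ n * ∑ k, ‖c k‖ ^ 2 := by
  simpa using sq_sum_le_card_mul_sum_sq (s := Finset.univ) (f := fun k => ‖c k‖)

lemma sum_norm_sq_le_of_gram {n : ℕ} {α : Fin n → H} {η : ℝ}
    (hα : ∀ j k, ‖⟪α j, α k⟫_ℂ - if j = k then 1 else 0‖ ≤ η) (hη : n * η ≤ 1 / 2)
    (c : Fin n → ℂ) : ∑ k, ‖c k‖ ^ 2 ≤ 2 * ‖∑ k, c k • α k‖ ^ 2 := by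
  have h1 : ((‖∑ k, c k • α k‖ ^ 2 : ℝ) : ℂ) - ((∑ k, ‖c k‖ ^ 2 : ℝ) : ℂ) =
      ∑ j, ∑ k, conj (c j) * c k * (⟪α j, α k⟫_ℂ - if j = k then 1 else 0) := by
    have e := inner_self_eq_norm_sq_to_K (𝕜 := ℂ) (∑ k, c k • α k)
    push_cast
    rw [show ((‖∑ k, c k • α k‖ : ℝ) : ℂ) ^ 2 = _ from e.symm, sum_inner,
      ← Finset.sum_sub_distrib]
    refine Finset.sum_congr rfl fun j _ => ?_
    rw [inner_sum]
    simp_rw [mul_sub, Finset.sum_sub_distrib, mul_ite, mul_one, mul_zero]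
    rw [Finset.sum_ite_eq, if_pos (Finset.mem_univ _), Complex.conj_mul']
    congr 1
    refine Finset.sum_congr rfl fun k _ => ?_
    rw [inner_smul_left, inner_smul_right]
    ring
  have h2 : ‖((‖∑ k, c k • α k‖ ^ 2 : ℝ) : ℂ) - ((∑ k, ‖c k‖ ^ 2 : ℝ) : ℂ)‖ ≤
      (∑ k, ‖c k‖) ^ 2 * η := by
    rw [h1, pow_two, Finset.sum_mul_sum, Finset.sum_mul]
    refine (norm_sum_le _ _).trans (Finset.sum_le_sum fun j _ => ?_)
    rw [Finset.sum_mul]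
    refine (norm_sum_le _ _).trans (Finset.sum_le_sum fun k _ => ?_)
    rw [norm_mul, norm_mul, RCLike.norm_conj]
    exact mul_le_mul_of_nonneg_left (hα j k) (by positivity)
  rw [← Complex.ofReal_sub, Complex.norm_real, Real.norm_eq_abs] at h2
  have h3 := (abs_le.1 h2).1
  have hS : 0 ≤ ∑ k, ‖c k‖ ^ 2 := Finset.sum_nonneg fun k _ => sq_nonneg _
  rcases n.eq_zero_or_pos with h0 | h0
  · subst h0
    simp
  have hη0 : 0 ≤ η := (norm_nonneg _).trans (hα ⟨0, h0⟩ ⟨0, h0⟩)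
  have h4 := mul_le_mul_of_nonneg_right (sq_sum_norm_le c) hη0
  nlinarith

lemma norm_sum_smul_sq_le {n : ℕ} {a : Fin n → H} {η : ℝ} (ha : ∀ k, ‖a k‖ ≤ η)
    (c : Fin n → ℂ) : ‖∑ k, c k • a k‖ ^ 2 ≤ n * η ^ 2 * ∑ k, ‖c k‖ ^ 2 := by
  have h1 : ‖∑ k, c k • a k‖ ≤ (∑ k, ‖c k‖) * η := by
    rw [Finset.sum_mul]
    refine (norm_sum_le _ _).trans (Finset.sum_le_sum fun k _ => ?_)
    rw [norm_smul]
    exact mul_le_mul_of_nonneg_left (ha k) (norm_nonneg _)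
  refine (pow_le_pow_left₀ (norm_nonneg _) h1 2).trans ?_
  rw [mul_pow]
  refine (mul_le_mul_of_nonneg_right (sq_sum_norm_le c) (sq_nonneg η)).trans (le_of_eq ?_)
  ring

/-- If `n` nearly orthonormal vectors are nearly in the kernel and there is a gap on their
orthogonal complement, then the spectrum near zero consists of `n` eigenvalues. -/
lemma IsSelfAdjointRel.exists_eigenFamily_of_gram [CompleteSpace H] {G : Submodule ℂ (H × H)}
    (hG : IsSelfAdjointRel G) {n : ℕ} {α a : Fin n → H} (hαa : ∀ k, (α k, a k) ∈ G) {η c K : ℝ}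
    (hα : ∀ j k, ‖⟪α j, α k⟫_ℂ - if j = k then 1 else 0‖ ≤ η) (ha : ∀ k, ‖a k‖ ≤ η)
    (hη : n * η ≤ 1 / 2) (hK : 0 < K) (hKc : K < c) (hηK : 2 * (n * η ^ 2) < K ^ 2)
    (hgap : ∀ p ∈ G, (∀ k, ⟪α k, p.1⟫_ℂ = 0) → c * ‖p.1‖ ≤ ‖p.2‖) :
    ∃ (ψ : Fin n → H) (l : Fin n → ℝ), IsEigenFamily G K ψ l ∧
      (∀ p ∈ G, (∀ i, ⟪ψ i, p.1⟫_ℂ = 0) → K * ‖p.1‖ ≤ ‖p.2‖) ∧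
      ∀ e : ℝ, |e| ≤ K → ∀ f, (f, (e : ℂ) • f) ∈ G →
        f = ∑ i, ⟪ψ i, f⟫_ℂ • ψ i ∧ ∀ i, e ≠ l i → ⟪ψ i, f⟫_ℂ = 0 := by
  have hli : LinearIndependent ℂ α := by
    refine Fintype.linearIndependent_iff.2 fun d hd => ?_
    have h := sum_norm_sq_le_of_gram hα hη d
    rw [hd, norm_zero, zero_pow two_ne_zero, mul_zero] at h
    have h' := (Finset.sum_eq_zero_iff_of_nonneg fun k _ => sq_nonneg ‖d k‖).1
      (le_antisymm h (Finset.sum_nonneg fun k _ => sq_nonneg _))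
    intro k
    simpa using h' k (Finset.mem_univ k)
  set V := Submodule.span ℂ (Set.range α) with hV
  have : FiniteDimensional ℂ V := FiniteDimensional.span_of_finite ℂ (Set.finite_range α)
  have hfin : Module.finrank ℂ V = n := by simpa using finrank_span_eq_card hli
  have hmem : ∀ v ∈ V, ∃ d : Fin n → ℂ, ∑ k, d k • α k = v := fun v hv =>
    (Submodule.mem_span_range_iff_exists_fun ℂ).1 hv
  have key := hG.exists_eigenFamily V hK hKc (fun p hp hpV => hgap p hp fun k =>
      (Submodule.mem_orthogonal V p.1).1 hpV _ (Submodule.subset_span ⟨k, rfl⟩))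
    (fun v hv => by
      obtain ⟨d, rfl⟩ := hmem v hv
      exact ⟨_, sum_smul_mem_rel hαa d⟩)
    (fun v hv hv0 => by
      obtain ⟨d, rfl⟩ := hmem v hv
      refine ⟨_, sum_smul_mem_rel hαa d, ?_⟩
      have hpos : 0 < ‖∑ k, d k • α k‖ := norm_pos_iff.2 hv0
      have h1 := norm_sum_smul_sq_le ha d
      have h2 := mul_le_mul_of_nonneg_left (sum_norm_sq_le_of_gram hα hη d)
        (by positivity : (0 : ℝ) ≤ n * η ^ 2)
      have h3 := mul_lt_mul_of_pos_right hηK (pow_pos hpos 2)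
      refine lt_of_pow_lt_pow_left₀ 2 (by positivity) ?_
      rw [mul_pow]
      linarith)
  rwa [hfin] at key

end NearlyOrthonormal

section Spectrum

open Filter Topology
open scoped InnerProductSpace ComplexConjugate

variable {κ : ℝ → ℝ} {κinf : ℝ}

lemma mem_eigenspace_dirac {m : ℝ → ℝ} {z : ℂ} (f : (dirac m).domain) :
    f ∈ eigenspace (dirac m) z ↔ DiracRel m f (z • (f : SpinorL2)) := by
  rw [← dirac_apply f, eigenspace, LinearMap.mem_ker, LinearMap.sub_apply, sub_eq_zero]
  rfl

lemma isEigenvalue_dirac {m : ℝ → ℝ} {z : ℂ} :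
    IsEigenvalue (dirac m) z ↔ ∃ f : SpinorL2, f ≠ 0 ∧ DiracRel m f (z • f) := by
  rw [IsEigenvalue, Submodule.ne_bot_iff]
  constructor
  · rintro ⟨f, hf, h0⟩
    exact ⟨f, fun h => h0 (Subtype.ext h), (mem_eigenspace_dirac f).1 hf⟩
  · rintro ⟨f, h0, hf⟩
    exact ⟨⟨f, _, hf⟩, (mem_eigenspace_dirac _).2 hf, fun h => h0 (congrArg Subtype.val h)⟩

lemma isSimpleEigenvalue_dirac {m : ℝ → ℝ} {z : ℂ} {f : SpinorL2} (h0 : f ≠ 0)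
    (hf : DiracRel m f (z • f)) (huniq : ∀ f', DiracRel m f' (z • f') → ∃ c : ℂ, f' = c • f) :
    IsSimpleEigenvalue (dirac m) z := by
  refine finrank_eq_one (⟨⟨f, _, hf⟩, (mem_eigenspace_dirac _).2 hf⟩ : eigenspace (dirac m) z)
    (fun h => h0 (congrArg (fun w : eigenspace (dirac m) z => ((w : (dirac m).domain) : SpinorL2))
      h)) fun w => ?_
  obtain ⟨c, hc⟩ := huniq _ ((mem_eigenspace_dirac _).1 w.2)
  exact ⟨c, Subtype.ext (Subtype.ext hc.symm)⟩

lemma eLpNorm_sub_sum_smul {n : ℕ} (f : SpinorL2) (b : Fin n → ℂ) {α : Fin n → SpinorL2}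
    {φ : Fin n → ℝ → Spinor} (h : ∀ k, α k =ᵐ[volume] φ k) :
    eLpNorm (fun x => f x - ∑ k, b k • φ k x) 2 volume =
      ENNReal.ofReal ‖f - ∑ k, b k • α k‖ := by
  rw [Lp.norm_def, ENNReal.ofReal_toReal (Lp.eLpNorm_ne_top _)]
  refine eLpNorm_congr_ae ?_
  have hs := Lp.coeFn_finsetSum Finset.univ fun k => b k • α k
  have hb : ∀ᵐ x : ℝ, ∀ k, (b k • α k : SpinorL2) x = b k • φ k x := ae_all_iff.2 fun k => by
    filter_upwards [Lp.coeFn_smul (b k) (α k), h k] with x h1 h2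
    rw [h1, Pi.smul_apply, h2]
  filter_upwards [Lp.coeFn_sub f (∑ k, b k • α k), hs, hb] with x h1 h2 h3
  rw [h1, Pi.sub_apply, h2]
  simp [Finset.sum_apply, h3]

lemma eventually_small {n A κ' C g M K ε₀ : ℝ} (hκ' : 0 < κ') (hg : 0 < g) (hK : 0 < K)
    (hε₀ : 0 < ε₀) : ∀ᶠ ε : ℝ in 𝓝 0, ε < ε₀ ∧ n * (A * ε) < 1 / 2 ∧
      2 * (n * (A * ε) ^ 2) < κ' ^ 2 ∧ 2 * C * ε < g ∧ ε * M + C * ε ^ 2 < K := by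
  have small : ∀ {p : ℝ → ℝ} {r : ℝ}, Continuous p → p 0 = 0 → 0 < r → ∀ᶠ ε in 𝓝 (0 : ℝ), p ε < r :=
    fun hp h0 hr => (hp.tendsto' 0 0 h0).eventually (gt_mem_nhds hr)
  exact (small (by fun_prop) rfl hε₀).and <| (small (by fun_prop) (by simp) (by norm_num)).and <|
    (small (by fun_prop) (by simp) (by positivity)).and <|
    (small (by fun_prop) (by simp) hg).and (small (by fun_prop) (by simp) hK)

lemma tendsto_exp_neg_mul (hpos : 0 < κinf) :
    Tendsto (fun δ => Real.exp (-2 * κinf * δ)) atTop (𝓝 0) := by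
  refine Real.tendsto_exp_atBot.comp ?_
  exact tendsto_id.const_mul_atTop_of_neg (by linarith)

end Spectrum

end DiracWalls

end

theorem mainTheorem3 (κ : ℝ → ℝ) (κinf : ℝ) (hκ : DiracWalls.IsDomainWall κ κinf)
    (hgap : DiracWalls.SpectralGap κ κinf) (n : ℕ) (hn : 1 ≤ n) :
    ∃ C : ℝ, ∀ K : ℝ, 0 < K → K < κinf →
      ∃ δ₀ : ℝ, 1 ≤ δ₀ ∧ ∀ δ : ℝ, δ₀ < δ →
        ∃ E E0 : Fin n → ℝ,
          -- `E 0 < ⋯ < E (n - 1)` are the eigenvalues of the Dirac operator in `[-K, K]`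
          StrictMono E ∧
          {e : ℝ | e ∈ Set.Icc (-K) K ∧
            DiracWalls.IsEigenvalue (DiracWalls.dirac (DiracWalls.wallMass κ n δ)) (e : ℂ)}
              = Set.range E ∧
          (∀ j, DiracWalls.IsSimpleEigenvalue
            (DiracWalls.dirac (DiracWalls.wallMass κ n δ)) (E j : ℂ)) ∧
          -- `E0 0 < ⋯ < E0 (n - 1)` are the eigenvalues of the matrix `M₀(δ)`
          StrictMono E0 ∧
          (∀ z : ℂ, Module.End.HasEigenvalue (Matrix.toLin' (DiracWalls.matrixM0 κ n δ)) z ↔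
            ∃ j, z = (E0 j : ℂ)) ∧
          (∀ j, |E j - E0 j| ≤ C * Real.exp (-4 * κinf * δ)) ∧
          -- every normalized eigenfunction is close to a combination of shifted zero modes
          -- whose coefficients form a normalized eigenvector of `M₀(δ)`
          (∀ j, ∀ ψ ∈ DiracWalls.eigenspace
              (DiracWalls.dirac (DiracWalls.wallMass κ n δ)) (E j : ℂ),
            ‖(ψ : DiracWalls.SpinorL2)‖ = 1 →
            ∃ b : Fin n → ℂ, ∑ k, ‖b k‖ ^ 2 = 1 ∧
              (DiracWalls.matrixM0 κ n δ).mulVec b = (E0 j : ℂ) • b ∧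
              MeasureTheory.eLpNorm
                (fun x => (ψ : DiracWalls.SpinorL2) x -
                  ∑ k : Fin n, b k • DiracWalls.shiftedMode κ n δ k x) 2 MeasureTheory.volume
                ≤ ENNReal.ofReal (C * Real.exp (-2 * κinf * δ))) := by
  have hpos := hκ.pos
  obtain ⟨A₁, hA₁, gram⟩ := hκ.exists_gram_bound
  obtain ⟨A₂, hA₂, image⟩ := hκ.exists_image_bound
  obtain ⟨A₃, hA₃, elem⟩ := hκ.exists_hopping_bound
  set A := A₁ + A₂ + A₃ with hA
  have hA0 : 0 ≤ A := by positivity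
  set h0 := 2 * DiracWalls.gam κ ^ 2 * DiracWalls.tailAmp κ κinf ^ 2 with hh0
  have hh0' : h0 ≠ 0 := (mul_pos (mul_pos two_pos hκ.gam_sq_pos)
    (pow_pos (DiracWalls.tailAmp_pos κ κinf) 2)).ne'
  obtain ⟨μ, v, hμ, hv⟩ := DiracWalls.exists_hopMatrix_eigenbasis n hh0'
  obtain ⟨g, hg, hgμ⟩ := DiracWalls.exists_gap_of_injective hμ.injective
  obtain ⟨C, ε₀, hC, hε₀, pert⟩ := DiracWalls.exists_perturbation hn
    (DiracWalls.isHermitian_hopMatrix n h0) hg hgμ v hv hA0 (half_pos hpos)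
  obtain ⟨M, hM⟩ := Finite.exists_le (fun l => |μ l|)
  obtain ⟨B, -, hB⟩ := hκ.exists_bound
  refine ⟨C, fun K hK hKκ => ?_⟩
  set K₁ := max K (κinf / 2) with hK₁
  have hK₁κ : K₁ < κinf := max_lt hKκ (by linarith)
  have hK₁0 : 0 < K₁ := lt_max_of_lt_left hK
  obtain ⟨δ₁, gap⟩ := hgap.multi_wall hκ hn (c := (K₁ + κinf) / 2) (by linarith) (by linarith)
  obtain ⟨δ₂, small⟩ := Filter.eventually_atTop.1 ((DiracWalls.tendsto_exp_neg_mul hpos).eventually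
    (DiracWalls.eventually_small (n := n) (A := A) (C := C) (M := M) (half_pos hpos) hg hK hε₀))
  refine ⟨max 1 (max δ₁ δ₂), le_max_left _ _, fun δ hδ => ?_⟩
  have hδ1 : 1 ≤ δ := (le_max_left _ _).trans hδ.le
  have hδ₁ : δ₁ < δ := ((le_max_left _ _).trans (le_max_right _ _)).trans_lt hδ
  obtain ⟨hs1, hs2, hs3, hs4, hs5⟩ :=
    small δ (((le_max_right _ _).trans (le_max_right _ _)).trans hδ.le)
  set ε := Real.exp (-2 * κinf * δ) with hε
  have hε0 : 0 < ε := Real.exp_pos _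
  have hM0 : DiracWalls.matrixM0 κ n δ = (ε : ℂ) • DiracWalls.hopMatrix n h0 := by
    rw [DiracWalls.matrixM0_eq, hκ.hopping_eq hδ1, DiracWalls.hopMatrix_mul]
  have hMv : ∀ l, (DiracWalls.matrixM0 κ n δ).mulVec (v l).ofLp =
      ((ε * μ l : ℝ) : ℂ) • (v l).ofLp := fun l => by
    rw [hM0, Matrix.smul_mulVec, hv, smul_smul, Complex.ofReal_mul]
  set G := DiracWalls.diracGraph (DiracWalls.wallMass κ n δ)
  have hG : DiracWalls.IsSelfAdjointRel G := DiracWalls.isSelfAdjointRel_diracGraph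
    (hκ.measurable_wallMass n δ) (DiracWalls.abs_wallMass_le hB n δ)
  set α : Fin n → DiracWalls.SpinorL2 := fun k => hκ.modeVec n δ k with hα
  set a : Fin n → DiracWalls.SpinorL2 := fun k => hκ.imageVec n δ k with ha
  have hαa : ∀ k, (α k, a k) ∈ G := fun k => hκ.diracRel_imageVec n δ k
  have hgram : ∀ j k, ‖inner ℂ (α j) (α k) - if j = k then 1 else 0‖ ≤ A * ε := fun j k => by
    have := gram n δ hδ1 j k
    simp only [Fin.val_inj] at this
    exact this.trans (mul_le_mul_of_nonneg_right (by linarith) hε0.le)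
  have himage : ∀ k, ‖a k‖ ≤ A * ε := fun k =>
    (image n δ hδ1 k k.2).trans (mul_le_mul_of_nonneg_right (by linarith) hε0.le)
  have helem : ∀ j k, ‖inner ℂ (α j) (a k) - ε * DiracWalls.hopMatrix n h0 j k‖ ≤ A * ε ^ 2 :=
    fun j k => by
      have := elem n δ hδ1 j k
      rw [hM0] at this
      exact this.trans (mul_le_mul_of_nonneg_right (by linarith) (sq_nonneg ε))
  have hKK : (κinf / 2) ^ 2 ≤ K₁ ^ 2 := pow_le_pow_left₀ (by linarith) (le_max_right _ _) 2
  obtain ⟨ψ, e, hfam, hlow, hexp⟩ := hG.exists_eigenFamily_of_gram hαa hgram himage hs2.le hK₁0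
    (by linarith) (hs3.trans_le hKK) (fun p hp hp' => gap δ hδ₁ p.1 p.2 hp hp')
  obtain ⟨σ, hσ⟩ := pert G hG ε hε0 hs1 K₁ ψ e (le_max_right _ _) hfam hlow α a hαa
    (fun k => by rw [hα]; simp only [hκ.norm_modeVec]; norm_num) hgram himage helem
  have hmono : StrictMono fun l => e (σ l) := by
    intro l l' hll
    have h1 := abs_le.1 (hσ l).1
    have h2 := abs_le.1 (hσ l').1
    have h3 := hgμ l' l hll.ne'
    rw [abs_of_pos (sub_pos.2 (hμ hll))] at h3
    have h4 := mul_le_mul_of_nonneg_left h3 hε0.le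
    have h5 := mul_lt_mul_of_pos_left hs4 hε0
    change e (σ l) < e (σ l')
    nlinarith
  have hinj : Function.Injective e := fun i i' h => by
    have : e (σ (σ.symm i)) = e (σ (σ.symm i')) := by simpa using h
    simpa using hmono.injective this
  have hbound : ∀ l, |e (σ l)| ≤ K := fun l => by
    have h1 := (hσ l).1
    have h2 : |ε * μ l| ≤ ε * M := by
      rw [abs_mul, abs_of_pos hε0]
      exact mul_le_mul_of_nonneg_left (hM l) hε0.le
    have h3 := abs_add_le (e (σ l) - ε * μ l) (ε * μ l)
    rw [sub_add_cancel] at h3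
    linarith
  have hψ0 : ∀ i, ψ i ≠ 0 := fun i => hfam.orthonormal.ne_zero i
  have huniq : ∀ l f, DiracWalls.DiracRel (DiracWalls.wallMass κ n δ) f
      (((e (σ l) : ℝ) : ℂ) • f) → f = (inner ℂ (ψ (σ l)) f : ℂ) • ψ (σ l) := fun l f hf => by
    obtain ⟨h1, h2⟩ := hexp (e (σ l)) (hfam.bound _) f hf
    conv_lhs => rw [h1]
    refine Finset.sum_eq_single _ (fun i _ hi => ?_) fun h => absurd (Finset.mem_univ _) h
    rw [h2 i fun h => hi (hinj h).symm, zero_smul]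
  have hε2 : Real.exp (-4 * κinf * δ) = ε ^ 2 := by
    rw [hε, ← Real.exp_nat_mul]
    congr 1
    push_cast
    ring
  refine ⟨fun l => e (σ l), fun l => ε * μ l, hmono, ?_, fun l => ?_,
    hμ.const_mul hε0, fun z => ?_, fun l => ?_, fun l f hf hf1 => ?_⟩
  · ext x
    simp only [Set.mem_ofPred_eq, Set.mem_range, DiracWalls.isEigenvalue_dirac]
    constructor
    · rintro ⟨hx, f, hf0, hf⟩
      obtain ⟨h1, h2⟩ := hexp x ((abs_le.2 hx).trans (le_max_left _ _)) f hf
      by_contra! hcon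
      refine hf0 (h1.trans (Finset.sum_eq_zero fun i _ => ?_))
      rw [h2 i fun h => hcon (σ.symm i) (by rw [Equiv.apply_symm_apply, h]), zero_smul]
    · rintro ⟨l, rfl⟩
      exact ⟨abs_le.1 (hbound l), ψ (σ l), hψ0 _, hfam.mem _⟩
  · exact DiracWalls.isSimpleEigenvalue_dirac (hψ0 (σ l)) (hfam.mem _) fun f hf =>
      ⟨_, huniq l f hf⟩
  · exact DiracWalls.hasEigenvalue_toLin'_iff v hMv z
  · rw [hε2]
    exact (hσ l).1
  · obtain ⟨u, hu, hclose⟩ := (hσ l).2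
    have hfc := huniq l f ((DiracWalls.mem_eigenspace_dirac f).1 hf)
    set c : ℂ := inner ℂ (ψ (σ l)) (f : DiracWalls.SpinorL2)
    have hc : ‖c‖ = 1 := by
      rw [hfc, norm_smul, hfam.orthonormal.1, mul_one] at hf1
      exact hf1
    have hvl : ∑ k, ‖v l k‖ ^ 2 = 1 := by
      rw [← EuclideanSpace.norm_sq_eq, v.orthonormal.1, one_pow]
    refine ⟨(c * u) • (v l).ofLp, ?_, ?_, ?_⟩
    · rw [← hvl]
      refine Finset.sum_congr rfl fun k _ => ?_
      rw [Pi.smul_apply, smul_eq_mul, norm_mul, norm_mul, hc, hu, one_mul, one_mul]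
    · rw [Matrix.mulVec_smul, hMv, smul_comm]
    · rw [DiracWalls.eLpNorm_sub_sum_smul f _ (α := α) fun k => hκ.modeVec_coe n δ k]
      refine ENNReal.ofReal_le_ofReal (le_trans (le_of_eq ?_) hclose)
      have : ∑ k, ((c * u) • (v l).ofLp) k • α k = c • ∑ k, (u * v l k) • α k := by
        rw [Finset.smul_sum]
        refine Finset.sum_congr rfl fun k _ => ?_
        rw [Pi.smul_apply, smul_eq_mul, smul_smul, mul_assoc]
      rw [this, hfc, ← smul_sub, norm_smul, hc, one_mul]
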